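/- **Setting.** Let $X=\mathbb Z\times[0,1]^{\mathbb N}$ with the product $\lambda$ of the counting measure and the Lebesgue measure. A measurable map $f:X\to X$ is non-singular if $\lambda(f(A))=0\Leftrightarrow\lambda(A)=0$; a microcosm is a set of non-singular maps that contains the identity and is closed under composition. For $i\in\{1,2,\dots\}\cup\{\infty\}$ let $\mathfrak m_i$ be the smallest microcosm containing the translations $\tau_k:(n,x)\mapsto(n+k,x)$, $k\in\mathbb Z$, and the maps $s_j$ that exchange the coordinates $x_1$ and $x_j$, $2\le j\le i$ (all $j\ge 2$ if $i=\infty$). A ($\{1\}$-weighted, non-deterministic) *graphing* $F$ of carrier $V^F\subseteq X$ (measurable) is a countable family of edges $e$, each given by a measurable source $S_e\subseteq V^F$ and a map $\phi_e:S_e\to V^F$ that is the restriction of a bijective non-singular map of $X$; it is *in* $\mathfrak m$ if every $\phi_e$ is the restriction of an element of $\mathfrak m$. It is *finite* if it has finitely many edges and each source is a finite union of unit cells $\{n\}\times[0,1]^{\mathbb N}$. The execution $F\odot G$ is the graphing with carrier $V^F\mathbin\triangle V^G$ whose edges are the alternating paths of edges of $F$ and $G$, restricted to the points of $V^F\mathbin\triangle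 V^G$ that are mapped into $V^F\mathbin\triangle V^G$. The measurement $[\![F,G]\!]\in[0,\infty]$ is the $\lambda$-measure of the set of points lying on some cycle that alternates between edges of $F$ and edges of $G$. A graphing $F$ is orthogonal to a pair $(\zeta,T)$, with $\zeta\in\mathbb R$ and $T$ a graphing, if $\zeta+[\![F,T]\!]\notin\{0,\infty\}$. The type of carrier $V$ generated by a set $S$ of graphings of carrier $V$ is the set of all graphings of carrier $V$ that are orthogonal to every pair $(\zeta,T)$ with $V^T=V$ to which all elements of $S$ are orthogonal. For types $A,B$ of carriers $V,W$, $A\multimap B$ is the set of graphings $P$ of carrier $V\cup W$ with $P\odot F\in B$ for all $F\in A$. **Words.** Number the cells $8q,\dots,8q+5$ ($q\in\mathbb Z$) as $\star_{in},\star_{out},0_{in},0_{out},1_{in},1_{out}$ (the copy with number $q$ of the six vertices). For a binary word $w=a_1\cdots a_n$ put $a_0=\star$ and read indices modulo $n+1$. The graphing $!L_w$ has the union of all these cells as its carrier and, for each $q\in\mathbb Z$ and $p\in\mathbb Z/(n+1)$, an edge from $\{x_1\in[\frac p{n+1},\frac{p+1}{n+1})\}$ in the cell $(a_p)_{out}$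 of the copy $q$ to $\{x_1\in[\frac{p'}{n+1},\frac{p'+1}{n+1})\}$, $p'=p+1 \bmod (n+1)$, in the cell $(a_{p+1})_{in}$ of the same copy, realised by a translation of both coordinates, together with the inverse edge. $!\mathrm{List}$ is the type generated by all $!L_w$. **Booleans and tests.** The cells $6$ and $7$ are called "accept" and "reject". $\mathrm{NBool}$ is the type generated by the graphings of carrier accept $\cup$ reject each of whose edges leads from accept to accept ("true") or from accept to reject ("false"). Let $\Gamma$ be the countable monoid of maps of $X$ generated by the $s_j$ ($j\ge2$) and the rotations $x_1\mapsto x_1+\frac1{m}\bmod 1$, $m\geq 1$ (with $x_1=1$ left fixed). Let $T_a$ (resp. $T_r$) be the graphing of carrier accept $\cup$ reject that has for each element of $\Gamma$ an edge from the whole cell accept (resp. reject) to the cell accept, realised by this element (resp. composed with $\tau_{-1}$). The tests are $T_{NL}=\{(0,T_a)\}$ and $T_{coNL}=\{(\zeta,T_r):\zeta\in\mathbb R\setminus\{0\}\}$. The programs over $\mathfrak m_i$ are the finite graphings in $\mathfrak m_i$ that belong to $!\mathrm{List}\multimap\mathrm{NBool}$. For a program $P$ and a test $T$ let $[P]_T$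 be the set of the binary words $w$ for which $P\odot{!L_w}$ is orthogonal to all elements of $T$. The non-deterministic model over $\mathfrak m_i$ *characterises* a set $\mathcal L$ of languages w.r.t. $T$ if $\{[P]_T: P\text{ a program over }\mathfrak m_i\}=\mathcal L$. **Theorem.** For every $i\in\{1,2,\dots\}\cup\{\infty\}$, the non-deterministic model over $\mathfrak m_i$ characterises, w.r.t. $T_{NL}$, the class of the binary languages accepted by two-way non-deterministic finite automata with at most $i$ heads (with any finite number of heads if $i=\infty$), and, w.r.t. $T_{coNL}$, the class of the languages whose complements are accepted by such automata. In particular, the model over $\mathfrak m_1$ characterises the class of regular languages w.r.t. $T_{NL}$ and w.r.t. $T_{coNL}$, and the model over $\mathfrak m_\infty$ characterises NLogspace w.r.t. $T_{NL}$ and coNLogspace (the class of the languages whose complements are in NLogspace) w.r.t. $T_{coNL}$. (NLogspace is the class of the binary languages recognised by non-deterministic Turing machines with a read-only two-way input tape and one work tape, of which at most $O(\log n)$ cells are visited on any input of length $n$.) -/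

import Mathlib

open MeasureTheory Set

noncomputable section

namespace IG

/-! ## The measured space, non-singular maps, microcosms -/

/-- The space `ℤ × [0,1]^ℕ`.  The coordinate `x_{j+1}` of a point is `x.2 j`. -/
abbrev Space : Type := ℤ × (ℕ → unitInterval)

/-- Counting measure on `ℤ` times Lebesgue measure on the Hilbert cube. -/
def vol : Measure Space :=
  (Measure.count : Measure ℤ).prod
    (Measure.infinitePi fun _ : ℕ => (volume : Measure unitInterval))

/-- Measurable maps `f` such that `f(A)` is a null set if and only if `A` is.  (For a measurable
map it does not matter whether `A` ranges over all sets or over the measurable ones.) -/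
def NonSingular (f : Space → Space) : Prop :=
  Measurable f ∧ ∀ A : Set Space, vol (f '' A) = 0 ↔ vol A = 0

/-- A microcosm: a set of non-singular maps that contains the identity and is closed under
composition. -/
def IsMicrocosm (m : Submonoid (Function.End Space)) : Prop :=
  ∀ f ∈ m, NonSingular f

/-- The ambient microcosm: all bijective non-singular transformations of the space. -/
def ambient : Submonoid (Function.End Space) where
  carrier := {f | NonSingular f ∧ Function.Bijective f}
  one_mem' := ⟨⟨measurable_id, fun A => by
    change vol (id '' A) = 0 ↔ _
    rw [image_id]⟩, Function.bijective_id⟩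
  mul_mem' := by
    rintro f g ⟨⟨hf, hf'⟩, hf2⟩ ⟨⟨hg, hg'⟩, hg2⟩
    refine ⟨⟨hf.comp hg, fun A => ?_⟩, hf2.comp hg2⟩
    have h : (f * g : Function.End Space) '' A = f '' (g '' A) := image_comp f g A
    rw [h, hf', hg']

/-- The translation `τ_k : (n, x) ↦ (n + k, x)`. -/
def transl (k : ℤ) : Function.End Space := fun x => (x.1 + k, x.2)

/-- The map `s_{j+1}`, which exchanges the first and the `(j+1)`-st coordinate of the cube. -/
def swap (j : ℕ) : Function.End Space := fun x => (x.1, fun l => x.2 (Equiv.swap 0 j l))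

/-- Rotation of `[0,1)` by `r`, extended to `[0,1]` by `1 ↦ 1`. -/
def rot (r : ℝ) (x : unitInterval) : unitInterval :=
  if x = 1 then 1 else ⟨Int.fract ((x : ℝ) + r), Int.fract_nonneg _, (Int.fract_lt_one _).le⟩

/-- Rotation of the first coordinate of the cube. -/
def rotate (r : ℝ) : Function.End Space :=
  fun x => (x.1, fun l => if l = 0 then rot r (x.2 l) else x.2 l)

/-- The microcosm `m_i`, `i ∈ ℕ ∪ {∞}`: the smallest one that contains all translations and the
maps `s_2, …, s_i` (all the maps `s_j` if `i = ∞`). -/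
def microcosm (i : ℕ∞) : Submonoid (Function.End Space) :=
  Submonoid.closure (range transl ∪ swap '' {j : ℕ | 1 ≤ j ∧ (j : ℕ∞) < i})

/-! Helper facts: the maps above are non-singular bijections. -/

theorem mem_ambient_of_inverse {f g : Space → Space} (hf : MeasurePreserving f vol vol)
    (hg : MeasurePreserving g vol vol) (h1 : Function.LeftInverse g f)
    (h2 : Function.RightInverse g f) : (f : Function.End Space) ∈ ambient := by
  refine ⟨⟨hf.measurable, fun A => ⟨fun h => ?_, fun h => ?_⟩⟩, h1.injective, h2.surjective⟩
  · have := hf.quasiMeasurePreserving.preimage_null h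
    rwa [preimage_image_eq _ h1.injective] at this
  · rw [image_eq_preimage_of_inverse h1 h2]
    exact hg.quasiMeasurePreserving.preimage_null h

theorem measurePreserving_transl (k : ℤ) : MeasurePreserving (transl k) vol vol :=
  (measurePreserving_add_right Measure.count k).prod (MeasurePreserving.id _)

theorem transl_mem_ambient (k : ℤ) : transl k ∈ ambient :=
  mem_ambient_of_inverse (measurePreserving_transl k) (measurePreserving_transl (-k))
    (fun x => by simp [transl]) (fun x => by simp [transl])

theorem measurePreserving_swap (j : ℕ) : MeasurePreserving (swap j) vol vol := by
  have h : MeasurePreserving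
      (fun (x : ℕ → unitInterval) l => x (Equiv.swap 0 j l))
      (Measure.infinitePi fun _ : ℕ => (volume : Measure unitInterval))
      (Measure.infinitePi fun _ : ℕ => (volume : Measure unitInterval)) := by
    refine ⟨by fun_prop, ?_⟩
    have := Measure.infinitePi_map_piCongrLeft
      (μ := fun _ : ℕ => (volume : Measure unitInterval)) (Equiv.swap 0 j)
    convert this using 2
    ext x l
    obtain ⟨a, rfl⟩ := (Equiv.swap 0 j).surjective l
    rw [MeasurableEquiv.coe_piCongrLeft, Equiv.piCongrLeft_apply_apply, Equiv.swap_apply_self]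
  exact (MeasurePreserving.id _).prod h

theorem swap_mem_ambient (j : ℕ) : swap j ∈ ambient :=
  mem_ambient_of_inverse (measurePreserving_swap j) (measurePreserving_swap j)
    (fun x => by simp [swap]) (fun x => by simp [swap])

theorem rot_leftInverse (r : ℝ) : Function.LeftInverse (rot (-r)) (rot r) := by
  intro x
  by_cases hx : x = 1
  · simp [rot, hx]
  · have h1 : (x : ℝ) < 1 := lt_of_le_of_ne x.2.2 (fun h => hx (Subtype.ext h))
    have h2 : (⟨Int.fract ((x : ℝ) + r), Int.fract_nonneg _, (Int.fract_lt_one _).le⟩ :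
        unitInterval) ≠ 1 := fun h =>
      (Int.fract_lt_one ((x : ℝ) + r)).ne (congrArg Subtype.val h)
    simp only [rot, hx, if_false, h2]
    apply Subtype.ext
    change Int.fract (Int.fract ((x : ℝ) + r) + -r) = x
    rw [Int.fract_eq_iff]
    refine ⟨x.2.1, h1, -⌊(x : ℝ) + r⌋, ?_⟩
    rw [Int.fract]
    push_cast
    ring

theorem measurable_rot (r : ℝ) : Measurable (rot r) := by
  refine Measurable.ite (measurableSet_singleton _) measurable_const ?_
  refine Measurable.subtype_mk ?_
  exact measurable_fract.comp (by fun_prop)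

theorem measurePreserving_rot (r : ℝ) :
    MeasurePreserving (rot r) (volume : Measure unitInterval) volume := by
  have hI : volume.restrict unitInterval = volume.restrict (Ioc (0 : ℝ) (0 + 1)) := by
    rw [zero_add]
    exact (Measure.restrict_congr_set Ioc_ae_eq_Icc).symm
  let e : unitInterval → UnitAddCircle := fun x => ((x : ℝ) : UnitAddCircle)
  have he : MeasurePreserving e volume volume := by
    have h1 := unitInterval.measurePreserving_coe
    rw [hI] at h1
    exact (UnitAddCircle.measurePreserving_mk 0).comp h1
  let g : UnitAddCircle → unitInterval := fun c =>
    ⟨AddCircle.equivIco (1 : ℝ) 0 c, (AddCircle.equivIco (1 : ℝ) 0 c).2.1,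
      by simpa using (AddCircle.equivIco (1 : ℝ) 0 c).2.2.le⟩
  have hgm : Measurable g :=
    (measurable_subtype_coe.comp (AddCircle.measurableEquivIco (1 : ℝ) 0).measurable).subtype_mk
  have hgy : ∀ y : ℝ, ((g (y : UnitAddCircle) : unitInterval) : ℝ) = Int.fract y := by
    intro y
    refine (AddCircle.coe_equivIco_mk_apply (p := (1 : ℝ)) y).trans ?_
    rw [div_one, mul_one]
  have hne : ∀ᵐ x : unitInterval, x ≠ 1 := by
    rw [ae_iff]
    simp
  have hg : MeasurePreserving g volume volume := by
    refine ⟨hgm, ?_⟩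
    rw [← he.map_eq, Measure.map_map hgm he.measurable]
    have : g ∘ e =ᵐ[volume] id := by
      filter_upwards [hne] with x hx
      have h1 : (x : ℝ) < 1 := lt_of_le_of_ne x.2.2 (fun h => hx (Subtype.ext h))
      apply Subtype.ext
      change ((g ((x : ℝ) : UnitAddCircle) : unitInterval) : ℝ) = x
      rw [hgy, Int.fract_eq_self.2 ⟨x.2.1, h1⟩]
    rw [Measure.map_congr this, Measure.map_id]
  have hc : MeasurePreserving (fun c : UnitAddCircle => c + ((r : ℝ) : UnitAddCircle))
      volume volume := measurePreserving_add_right _ _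
  have htot := hg.comp (hc.comp he)
  refine ⟨measurable_rot r, ?_⟩
  refine (Measure.map_congr ?_).trans htot.map_eq
  filter_upwards [hne] with x hx
  apply Subtype.ext
  change _ = ((g (((x : ℝ) : UnitAddCircle) + ((r : ℝ) : UnitAddCircle)) : unitInterval) : ℝ)
  rw [← AddCircle.coe_add, hgy]
  simp [rot, hx]

theorem measurePreserving_rotate (r : ℝ) : MeasurePreserving (rotate r) vol vol := by
  have h : MeasurePreserving
      (fun (x : ℕ → unitInterval) l => (if l = 0 then rot r (x l) else x l))
      (Measure.infinitePi fun _ : ℕ => (volume : Measure unitInterval))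
      (Measure.infinitePi fun _ : ℕ => (volume : Measure unitInterval)) := by
    have hm : ∀ l : ℕ, MeasurePreserving (fun y : unitInterval => if l = 0 then rot r y else y)
        volume volume := by
      intro l
      by_cases hl : l = 0
      · simpa [hl] using measurePreserving_rot r
      · simp only [hl, if_false]
        exact MeasurePreserving.id (volume : Measure unitInterval)
    have := Measure.infinitePi_map_pi (fun _ : ℕ => (volume : Measure unitInterval))
      (fun l => (hm l).measurable)
    refine ⟨?_, ?_⟩
    · exact measurable_pi_lambda _ fun l => (hm l).measurable.comp (measurable_pi_apply l)
    · rw [this]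
      congr 1
      funext l
      exact (hm l).map_eq
  exact (MeasurePreserving.id _).prod h

theorem rotate_leftInverse (r : ℝ) : Function.LeftInverse (rotate (-r)) (rotate r) := by
  intro x
  refine Prod.ext rfl (funext fun l => ?_)
  by_cases hl : l = 0
  · simpa [rotate, hl] using rot_leftInverse r (x.2 0)
  · simp [rotate, hl]

theorem rotate_mem_ambient (r : ℝ) : rotate r ∈ ambient :=
  mem_ambient_of_inverse (measurePreserving_rotate r) (measurePreserving_rotate (-r))
    (rotate_leftInverse r) (fun x => by simpa using rotate_leftInverse (-r) x)

theorem microcosm_le_ambient (i : ℕ∞) : microcosm i ≤ ambient := by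
  refine Submonoid.closure_le.2 ?_
  rintro f (⟨k, rfl⟩ | ⟨j, -, rfl⟩)
  · exact transl_mem_ambient k
  · exact swap_mem_ambient j

theorem isMicrocosm_ambient : IsMicrocosm ambient := fun _ hf => hf.1

theorem isMicrocosm_microcosm (i : ℕ∞) : IsMicrocosm (microcosm i) := fun _ hf =>
  (microcosm_le_ambient i hf).1

/-! ## Graphings -/

/-- A graphing with weights in the one-element monoid `{1}` (so that no weights have to be
recorded and every graphing is a non-deterministic one): a countable family of edges, each of
them the restriction of a map of the ambient microcosm to a measurable subset of the carrier,
with values in the carrier. -/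
structure Graphing where
  carrier : Set Space
  measurableSet_carrier : MeasurableSet carrier
  Edge : Type
  countable_edge : Countable Edge
  map : Edge → Function.End Space
  map_mem : ∀ e, map e ∈ ambient
  source : Edge → Set Space
  measurableSet_source : ∀ e, MeasurableSet (source e)
  source_subset : ∀ e, source e ⊆ carrier
  target_subset : ∀ e, map e '' source e ⊆ carrier

namespace Graphing

/-- The target of an edge. -/
def target (F : Graphing) (e : F.Edge) : Set Space := F.map e '' F.source e

theorem measurableSet_target (F : Graphing) (e : F.Edge) : MeasurableSet (F.target e) :=
  (F.measurableSet_source e).image_of_measurable_injOn (F.map_mem e).1.1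
    (F.map_mem e).2.1.injOn

/-- `F` is a graphing in the microcosm `m`: each edge is realised by the restriction of an element
of `m`. -/
def IsIn (F : Graphing) (m : Submonoid (Function.End Space)) : Prop :=
  ∀ e, ∃ f ∈ m, EqOn (F.map e) f (F.source e)

/-- The unit cell `{n} × [0,1]^ℕ`. -/
def cell (n : ℤ) : Set Space := {x | x.1 = n}

/-- `F` is finite: it has finitely many edges, and the source of each edge consists of finitely
many entire unit cells. -/
def IsFinite (F : Graphing) : Prop :=
  Finite F.Edge ∧ ∀ e, ∃ A : Finset ℤ, F.source e = ⋃ n ∈ A, cell n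

/-- Some edge of `F` leads from the point `x` to the point `y`. -/
def Step (F : Graphing) (x y : Space) : Prop :=
  ∃ e, x ∈ F.source e ∧ F.map e x = y

/-! ### Execution -/

/-- The realiser of an edge of `F` or of `G`. -/
def edgeMap (F G : Graphing) : F.Edge ⊕ G.Edge → Function.End Space := Sum.elim F.map G.map

/-- The source of an edge of `F` or of `G`. -/
def edgeSource (F G : Graphing) : F.Edge ⊕ G.Edge → Set Space := Sum.elim F.source G.source

/-- The map realised by a path (its first edge is the head of the list). -/
def pathMap (F G : Graphing) : List (F.Edge ⊕ G.Edge) → Function.End Space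
  | [] => 1
  | e :: l => pathMap F G l * edgeMap F G e

/-- The set of the points along which a path can be followed. -/
def pathDom (F G : Graphing) : List (F.Edge ⊕ G.Edge) → Set Space
  | [] => univ
  | e :: l => edgeSource F G e ∩ edgeMap F G e ⁻¹' pathDom F G l

/-- The alternating paths between `F` and `G`: non-empty sequences of edges, of which no two
consecutive ones belong to the same graphing. -/
def AltPath (F G : Graphing) : Type :=
  {l : List (F.Edge ⊕ G.Edge) // l ≠ [] ∧ l.IsChain fun a b => a.isLeft ≠ b.isLeft}

theorem edgeMap_mem (F G : Graphing) (e : F.Edge ⊕ G.Edge) : edgeMap F G e ∈ ambient := by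
  cases e
  · exact F.map_mem _
  · exact G.map_mem _

theorem pathMap_mem (F G : Graphing) (l : List (F.Edge ⊕ G.Edge)) :
    pathMap F G l ∈ ambient := by
  induction l with
  | nil => exact ambient.one_mem
  | cons e l ih => exact ambient.mul_mem ih (edgeMap_mem F G e)

theorem measurableSet_pathDom (F G : Graphing) (l : List (F.Edge ⊕ G.Edge)) :
    MeasurableSet (pathDom F G l) := by
  induction l with
  | nil => exact MeasurableSet.univ
  | cons e l ih =>
    refine MeasurableSet.inter ?_ ((edgeMap_mem F G e).1.1 ih)
    cases e
    · exact F.measurableSet_source _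
    · exact G.measurableSet_source _

open scoped symmDiff in
/-- The execution of `F` and `G`.  Its carrier is the symmetric difference of the carriers, and
its edges are the alternating paths, restricted to the points that lie outside of the common part
of the carriers and are mapped outside of it. -/
def exec (F G : Graphing) : Graphing where
  carrier := F.carrier ∆ G.carrier
  measurableSet_carrier := F.measurableSet_carrier.symmDiff G.measurableSet_carrier
  Edge := AltPath F G
  countable_edge := by
    have := F.countable_edge
    have := G.countable_edge
    exact Subtype.countable
  map l := pathMap F G l.1
  map_mem l := pathMap_mem F G l.1
  source l := pathDom F G l.1 ∩
    (F.carrier ∆ G.carrier ∩ pathMap F G l.1 ⁻¹' (F.carrier ∆ G.carrier))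
  measurableSet_source l := by
    have h := F.measurableSet_carrier.symmDiff G.measurableSet_carrier
    exact (measurableSet_pathDom F G l.1).inter (h.inter ((pathMap_mem F G l.1).1.1 h))
  source_subset _ _ hx := hx.2.1
  target_subset l := by
    rintro _ ⟨x, hx, rfl⟩
    exact hx.2.2

/-! ### Measurement and orthogonality -/

/-- The points that lie on an alternating cycle between `F` and `G`: following an edge of the one,
an edge of the other, and so on alternately (an even, non-zero number of edges), one can return to
the point. -/
def cyclePoints (F G : Graphing) : Set Space :=
  {x | Relation.TransGen (Relation.Comp F.Step G.Step) x x ∨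
    Relation.TransGen (Relation.Comp G.Step F.Step) x x}

/-- The measurement of `F` and `G`: the measure of the union of the supports of all cycles between
`F` and `G`. -/
def meas (F G : Graphing) : ENNReal := vol (cyclePoints F G)

end Graphing

/-- A weighted graphing `(ζ, T)`. -/
structure Project where
  wager : ℝ
  graph : Graphing

/-- A graphing `F` is orthogonal to `(ζ, T)` if `ζ + ⟦F, T⟧` is neither `0` nor `∞`. -/
def Orth (F : Graphing) (t : Project) : Prop :=
  (t.wager : EReal) + (Graphing.meas F t.graph : EReal) ≠ 0 ∧
    (t.wager : EReal) + (Graphing.meas F t.graph : EReal) ≠ ⊤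

/-- The type of carrier `V` generated by a set `S` of graphings of carrier `V`: its
bi-orthogonal. -/
def biorth (V : Set Space) (S : Set Graphing) : Set Graphing :=
  {F | F.carrier = V ∧
    ∀ t : Project, t.graph.carrier = V → (∀ G ∈ S, Orth G t) → Orth F t}

/-- The type `A ⊸ B`, for types `A` of carrier `V` and `B` of carrier `W`. -/
def lolli (V : Set Space) (A : Set Graphing) (W : Set Space) (B : Set Graphing) : Set Graphing :=
  {P | P.carrier = V ∪ W ∧ ∀ F ∈ A, Graphing.exec P F ∈ B}

/-! ## Words -/

/-- The position of the symbols `⋆` (coded by `none`), `0`, `1` in the list `⋆, 0, 1`. -/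
def symIdx : Option Bool → ℤ
  | none => 0
  | some false => 1
  | some true => 2

/-- The number of the unit cell that represents, in the copy with number `q`, the vertex
"in" (`out = false`) or "out" (`out = true`) of the symbol `a`: the block of the eight cells
`8q, …, 8q+7` starts with the cells `⋆i, ⋆o, 0i, 0o, 1i, 1o`. -/
def vertex (q : ℤ) (a : Option Bool) (out : Bool) : ℤ :=
  8 * q + 2 * symIdx a + if out then 1 else 0

/-- The carrier of the representations of words: countably many copies of the vertices. -/
def listCarrier : Set Space := {x | x.1 % 8 < 6}

/-- The list `⋆ w`. -/
def symbols (w : List Bool) : Fin (w.length + 1) → Option Bool :=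
  Fin.cons none fun j => some (w.get j)

/-- The piece with number `p` of the cell `n`, when the unit interval of the first coordinate is
divided into `k` pieces of equal length. -/
def piece (k : ℕ) (n : ℤ) (p : ℕ) : Set Space :=
  {x | x.1 = n ∧ (p : ℝ) / k ≤ (x.2 0 : ℝ) ∧ (x.2 0 : ℝ) < (p + 1 : ℝ) / k}

theorem measurableSet_piece (k : ℕ) (n : ℤ) (p : ℕ) : MeasurableSet (piece k n p) := by
  have h : Measurable fun x : Space => (x.2 0 : ℝ) := by fun_prop
  exact (measurable_fst (measurableSet_singleton n)).inter
    ((measurableSet_le measurable_const h).inter (measurableSet_lt h measurable_const))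

theorem vertex_mod (q : ℤ) (a : Option Bool) (o : Bool) : vertex q a o % 8 < 6 := by
  rcases a with _ | a <;> rcases o with _ | _ <;> try rcases a with _ | _
  all_goals simp [vertex, symIdx] <;> omega

/-- The representation `!L_w` of the word `w`.  Let `⋆w = a_0 … a_n`.  In each copy, for each
`p ∈ ℤ/(n+1)`, there is an edge from the `p`-th piece of the cell `a_p` "out" to the `(p+1)`-st
piece of the cell `a_{p+1}` "in", and an edge in the opposite direction. -/
def expWord (w : List Bool) : Graphing where
  carrier := listCarrier
  measurableSet_carrier := measurable_fst (.of_discrete (s := {n : ℤ | n % 8 < 6}))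
  Edge := ℤ × Fin (w.length + 1) × Bool
  countable_edge := inferInstance
  map := fun ⟨q, p, fwd⟩ =>
    if fwd then
      transl (vertex q (symbols w (p + 1)) false - vertex q (symbols w p) true) *
        rotate (1 / (w.length + 1))
    else
      transl (vertex q (symbols w p) true - vertex q (symbols w (p + 1)) false) *
        rotate (-(1 / (w.length + 1)))
  map_mem := by
    rintro ⟨q, p, _ | _⟩
    · exact ambient.mul_mem (transl_mem_ambient _) (rotate_mem_ambient _)
    · exact ambient.mul_mem (transl_mem_ambient _) (rotate_mem_ambient _)
  source := fun ⟨q, p, fwd⟩ =>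
    if fwd then piece (w.length + 1) (vertex q (symbols w p) true) p
    else piece (w.length + 1) (vertex q (symbols w (p + 1)) false) (p + 1 : Fin _)
  measurableSet_source := by
    rintro ⟨q, p, _ | _⟩
    · exact measurableSet_piece _ _ _
    · exact measurableSet_piece _ _ _
  source_subset := by
    rintro ⟨q, p, _ | _⟩ x ⟨hx, -⟩
    · change x.1 % 8 < 6
      rw [hx]; exact vertex_mod _ _ _
    · change x.1 % 8 < 6
      rw [hx]; exact vertex_mod _ _ _
  target_subset := by
    rintro ⟨q, p, _ | _⟩ _ ⟨x, ⟨hx, -⟩, rfl⟩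
    · change (x.1 + (_ - _)) % 8 < 6
      rw [hx, add_sub_cancel]; exact vertex_mod _ _ _
    · change (x.1 + (_ - _)) % 8 < 6
      rw [hx, add_sub_cancel]; exact vertex_mod _ _ _

/-- The type `!List` of binary words. -/
def expList : Set Graphing := biorth listCarrier (range expWord)

/-! ## Non-deterministic booleans and tests -/

/-- The number of the cell "accept". -/
def acc : ℤ := 6

/-- The number of the cell "reject". -/
def rej : ℤ := 7

/-- The carrier of the booleans: the cells "accept" and "reject". -/
def boolCarrier : Set Space := {x | x.1 = acc ∨ x.1 = rej}

/-- Sets of booleans: graphings all of whose edges lead from "accept" to "accept" (an answer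
"true") or from "accept" to "reject" (an answer "false"). -/
def boolSets : Set Graphing :=
  {F | F.carrier = boolCarrier ∧ ∀ e, F.source e ⊆ Graphing.cell acc ∧
    (F.target e ⊆ Graphing.cell acc ∨ F.target e ⊆ Graphing.cell rej)}

/-- The type `NBool` of non-deterministic booleans. -/
def nBool : Set Graphing := biorth boolCarrier boolSets

/-- The countable set of maps on the cube used by the tests: compositions of rotations of the
first coordinate by `1/(n+1)` and of the maps `s_j`. -/
def addressMap (l : List (ℕ ⊕ ℕ)) : Function.End Space :=
  (l.map (Sum.elim (fun n : ℕ => rotate (1 / (n + 1))) swap)).prod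

theorem addressMap_mem (l : List (ℕ ⊕ ℕ)) : addressMap l ∈ ambient := by
  refine ambient.list_prod_mem ?_
  intro f hf
  obtain ⟨a, -, rfl⟩ := List.mem_map.1 hf
  cases a
  · exact rotate_mem_ambient _
  · exact swap_mem_ambient _

theorem addressMap_fst (l : List (ℕ ⊕ ℕ)) (x : Space) : (addressMap l x).1 = x.1 := by
  induction l with
  | nil => rfl
  | cons a l ih =>
    rw [← ih]
    cases a <;> rfl

/-- The graphing on the cells "accept" and "reject" with one edge, whose source is the whole cell
`s` and whose target is the whole cell "accept", for each of the maps `addressMap l`. -/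
def returnGraphing (s : ℤ) (hs : s = acc ∨ s = rej) : Graphing where
  carrier := boolCarrier
  measurableSet_carrier := measurable_fst (.of_discrete (s := {n : ℤ | n = acc ∨ n = rej}))
  Edge := List (ℕ ⊕ ℕ)
  countable_edge := inferInstance
  map l := transl (acc - s) * addressMap l
  map_mem l := ambient.mul_mem (transl_mem_ambient _) (addressMap_mem l)
  source _ := Graphing.cell s
  measurableSet_source _ := measurable_fst (measurableSet_singleton s)
  source_subset := by
    rintro _ x hx
    change x.1 = s at hx
    change x.1 = acc ∨ x.1 = rej
    rwa [hx]
  target_subset := by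
    rintro l _ ⟨x, hx, rfl⟩
    left
    change x.1 = s at hx
    change (addressMap l x).1 + (acc - s) = acc
    rw [addressMap_fst, hx, add_sub_cancel]

/-- The test `T_NL`: its edges lead from "accept" back to "accept". -/
def testNL : Set Project := {⟨0, returnGraphing acc (.inl rfl)⟩}

/-- The test `T_coNL`: its edges lead from "reject" back to "accept"; the wagers are the
non-zero real numbers. -/
def testCoNL : Set Project := {t | ∃ ζ : ℝ, ζ ≠ 0 ∧ t = ⟨ζ, returnGraphing rej (.inr rfl)⟩}

/-! ## Programs and their languages -/

/-- The programs of type `!List ⊸ NBool` in the non-deterministic model over the microcosm `m`. -/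
def programs (m : Submonoid (Function.End Space)) : Set Graphing :=
  {P | P.IsIn m ∧ P.IsFinite ∧ P ∈ lolli listCarrier expList boolCarrier nBool}

/-- The language `[P]_T` of the words that `P` accepts with respect to the test `T`. -/
def lang (P : Graphing) (T : Set Project) : Language Bool :=
  {w : List Bool | ∀ t ∈ T, Orth (Graphing.exec P (expWord w)) t}

/-- The non-deterministic model over `m` characterises the set `𝓛` of languages with respect to
the test `T`. -/
def Characterises (m : Submonoid (Function.End Space)) (T : Set Project)
    (𝓛 : Set (Language Bool)) : Prop :=
  {L | ∃ P ∈ programs m, L = lang P T} = 𝓛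

/-! ## Automata and Turing machines -/

/-- The symbols on an input tape: letters and two end markers. -/
inductive TapeSym
  | left
  | letter (b : Bool)
  | right

/-- The symbol at position `p ≤ |w| + 1` of the input tape of `w`. -/
def tapeAt (w : List Bool) : ℕ → TapeSym
  | 0 => .left
  | p + 1 => (w[p]?).elim .right .letter

/-- Head movements. -/
inductive Dir
  | left
  | stay
  | right

/-- A movement leads from position `p` to position `p'`. -/
def Dir.Moves : Dir → ℕ → ℕ → Prop
  | .left, p, p' => p = p' + 1
  | .stay, p, p' => p' = p
  | .right, p, p' => p' = p + 1

/-- Two-way non-deterministic automata with `k` heads. -/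
structure MultiheadNFA (k : ℕ) where
  State : Type
  finite_state : Finite State
  start : State
  accept : Set State
  trans : State → (Fin k → TapeSym) → Set (State × (Fin k → Dir))

/-- One step of computation on the input `w`; the heads do not leave the tape. -/
def MultiheadNFA.Step {k : ℕ} (M : MultiheadNFA k) (w : List Bool)
    (c c' : M.State × (Fin k → ℕ)) : Prop :=
  ∃ d : Fin k → Dir, (c'.1, d) ∈ M.trans c.1 (fun j => tapeAt w (c.2 j)) ∧
    ∀ j, (d j).Moves (c.2 j) (c'.2 j) ∧ c'.2 j ≤ w.length + 1

/-- The language accepted by an automaton: all heads start on the left end marker, and some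
computation reaches an accepting state. -/
def MultiheadNFA.language {k : ℕ} (M : MultiheadNFA k) : Language Bool :=
  {w : List Bool | ∃ c, Relation.ReflTransGen (M.Step w) (M.start, fun _ => 0) c ∧
    c.1 ∈ M.accept}

/-- Languages accepted by two-way non-deterministic automata with at most `i` heads (with any
number of heads if `i = ∞`). -/
def twoNFA (i : ℕ∞) : Set (Language Bool) :=
  {L | ∃ k : ℕ, (k : ℕ∞) ≤ i ∧ ∃ M : MultiheadNFA k, L = M.language}

/-- The languages whose complements belong to `twoNFA i`. -/
def coTwoNFA (i : ℕ∞) : Set (Language Bool) := {L | Lᶜ ∈ twoNFA i}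

/-- Non-deterministic Turing machines with a read-only input tape and a one-sided work tape. -/
structure NTM where
  State : Type
  finite_state : Finite State
  Work : Type
  finite_work : Finite Work
  blank : Work
  start : State
  accept : Set State
  trans : State → TapeSym → Work → Set (State × Work × Dir × Dir)

/-- Configurations: state, position of the input head, position of the work head, work tape. -/
structure NTM.Config (M : NTM) where
  state : M.State
  inPos : ℕ
  workPos : ℕ
  work : ℕ → M.Work

/-- One step of computation on the input `w`; the heads do not leave the tapes. -/
def NTM.Step (M : NTM) (w : List Bool) (c c' : M.Config) : Prop :=
  ∃ (a : M.Work) (d e : Dir),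
    (c'.state, a, d, e) ∈ M.trans c.state (tapeAt w c.inPos) (c.work c.workPos) ∧
    c'.work = Function.update c.work c.workPos a ∧
    d.Moves c.inPos c'.inPos ∧ c'.inPos ≤ w.length + 1 ∧ e.Moves c.workPos c'.workPos

/-- The initial configuration. -/
def NTM.init (M : NTM) : M.Config := ⟨M.start, 0, 0, fun _ => M.blank⟩

/-- The language recognised by a machine. -/
def NTM.language (M : NTM) : Language Bool :=
  {w : List Bool | ∃ c, Relation.ReflTransGen (M.Step w) M.init c ∧ c.state ∈ M.accept}

/-- Logarithmic space: on inputs of length `n`, only `O(log n)` cells of the work tape are visited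
in any computation. -/
def NTM.LogSpace (M : NTM) : Prop :=
  ∃ b : ℕ, ∀ (w : List Bool) (c : M.Config), Relation.ReflTransGen (M.Step w) M.init c →
    c.workPos < b * (Nat.log 2 w.length + 1)

/-- Languages recognised by non-deterministic Turing machines in logarithmic space. -/
def nLogspace : Set (Language Bool) := {L | ∃ M : NTM, M.LogSpace ∧ L = M.language}

/-- The languages whose complements belong to `nLogspace`. -/
def coNLogspace : Set (Language Bool) := {L | Lᶜ ∈ nLogspace}

/-- The regular languages. -/
def regular : Set (Language Bool) := {L | L.IsRegular}

end IG

end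

/-! An execution is read as a computation of a multihead automaton. The head j is the coordinate
x_j; for a word of length n its position on the circular list ⋆w is the piece of length 1/(n+1) that
contains x_j; the cell is the state. An edge of a program shifts cells and permutes coordinates, so
it chooses the head that becomes x_1. An edge of !L_w moves this head by one position, and the cells
that it joins show the symbols that the head leaves and reaches.

Both kinds of edges act on cells and pieces alone (`CellData.phaseStep_disc`,
`CellData.exists_phaseStep`). Hence a discretised path lifts to every point of its initial box, a
set of positive measure, and only the null set of points with a coordinate 1 escapes this
description. Up to a translation, each edge is undone by an element of Γ (`returns_microcosm`,
`returns_expWord`), so one edge of the test closes a path from accept to the tested cell into a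
cycle. The measurement is therefore non-zero exactly if such a discretised path exists
(`meas_exec_ne_zero_iff`). It is always finite, since cycles stay in two cells. Thus T_NL asks for a
path to accept, while T_coNL, whose wagers can cancel any positive value, asks that there be none to
reject. Membership in !List ⊸ NBool is ensured by letting no edge of the program start in reject
(`mem_lolli`).

It remains to compare models of computation. Discretised paths are the computations of programs on
circular lists (`CellData.mem_circLang_prog`, and conversely `Prog.mem_circLang_iff`), and these are
equivalent to two-way automata with the same number of heads (`exists_headLang_eq_circLang`,
`exists_circular`). This gives `twoNFA_eq`, from which both characterisations follow.

For one head, the behaviour of an automaton on a prefix is one of finitely many crossing relations,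
so that the language has finitely many left quotients. For arbitrarily many heads, the automata
capture NLogspace: a head is a number up to n+1, hence about log n bits. A work tape of length O(log
n) is cut into residue classes of positions, each stored as two stacks of digits in heads;
conversely heads are binary counters on a work tape.

All simulations are assembled from small programs by one principle (`Impl.graph`): a finite graph
whose edges are labelled by implementable relations is itself implementable. -/

noncomputable section

namespace IG

/-! ## Finite non-deterministic programs over a set of instructions -/

/-- A finite automaton with silent moves whose transitions are labelled by instructions. -/
structure Prog (Λ : Type) where
  State : Type
  finite_state : Finite State
  start : State
  final : State
  trans : State → Option Λ → State → Prop

namespace Prog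

variable {Λ C : Type} (M : Prog Λ) (act : Λ → C → C → Prop)

/-- One step of a program: a silent move, or the execution of an instruction. -/
def Step (x y : M.State × C) : Prop :=
  ∃ l, M.trans x.1 l y.1 ∧ l.elim (x.2 = y.2) (fun l => act l x.2 y.2)

/-- The computations of a program. -/
def Reach : M.State × C → M.State × C → Prop := Relation.ReflTransGen (M.Step act)

end Prog

/-- An interpretation of the instructions of `Λ` on concrete configurations in `C`, some of which
are safe, together with the representation of abstract configurations in `A` by concrete ones. -/
structure Sem (Λ C A : Type) where
  act : Λ → C → C → Prop
  safe : C → Prop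
  rep : C → A → Prop
  safe_of_rep : ∀ c a, rep c a → safe c

variable {W Λ C A : Type} {𝒮 : W → Sem Λ C A}

/-- The program `M` implements, on the abstract configurations in `V`, the relation `R`, and passes
through safe configurations only. -/
structure Prog.Implements (𝒮 : W → Sem Λ C A) (V : W → A → Prop) (R : W → A → A → Prop)
    (M : Prog Λ) : Prop where
  safe : ∀ w c a, (𝒮 w).rep c a → V w a → ∀ x, M.Reach (𝒮 w).act (M.start, c) x →
    (𝒮 w).safe x.2
  sound : ∀ w c a, (𝒮 w).rep c a → V w a → ∀ c', M.Reach (𝒮 w).act (M.start, c) (M.final, c') →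
    ∃ a', (𝒮 w).rep c' a' ∧ R w a a'
  complete : ∀ w c a, (𝒮 w).rep c a → V w a → ∀ a', R w a a' →
    ∃ c', (𝒮 w).rep c' a' ∧ M.Reach (𝒮 w).act (M.start, c) (M.final, c')

/-- Some program implements the relation `R` on `V`. -/
def Impl (𝒮 : W → Sem Λ C A) (V : W → A → Prop) (R : W → A → A → Prop) : Prop :=
  ∃ M : Prog Λ, M.Implements 𝒮 V R

/-- The steps in a finite graph whose edges are labelled by relations. -/
def GStep {S E : Type} (src dst : E → S) (R : E → A → A → Prop) (x y : S × A) : Prop :=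
  ∃ e, src e = x.1 ∧ dst e = y.1 ∧ R e x.2 y.2

/-- The program obtained from a finite graph whose edges are labelled by programs. -/
def Prog.graph {S E : Type} [Finite S] [Finite E] (src dst : E → S) (M : E → Prog Λ) (s t : S) :
    Prog Λ where
  State := S ⊕ (Σ e, (M e).State)
  finite_state := by
    have := fun e => (M e).finite_state
    infer_instance
  start := .inl s
  final := .inl t
  trans
    | .inl s, l, .inr ⟨e, q⟩ => l = none ∧ s = src e ∧ q = (M e).start
    | .inr ⟨e, q⟩, l, .inl s => l = none ∧ s = dst e ∧ q = (M e).final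
    | .inr ⟨e, q⟩, l, .inr y => ∃ q', y = ⟨e, q'⟩ ∧ (M e).trans q l q'
    | .inl _, _, .inl _ => False

theorem Prog.graph_reach {S E : Type} [Finite S] [Finite E] {src dst : E → S} {M : E → Prog Λ}
    {s t : S} {act : Λ → C → C → Prop} {e : E} {x y : (M e).State × C}
    (h : (M e).Reach act x y) :
    (Prog.graph src dst M s t).Reach act (.inr ⟨e, x.1⟩, x.2) (.inr ⟨e, y.1⟩, y.2) := by
  induction h with
  | refl => exact .refl
  | tail _ h ih =>
    obtain ⟨l, hl, h⟩ := h
    exact ih.tail ⟨l, ⟨_, rfl, hl⟩, h⟩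

theorem Prog.Implements.graph {S E : Type} [Finite S] [Finite E] {src dst : E → S}
    {V : S → W → A → Prop} {R : E → W → A → A → Prop} {M : E → Prog Λ}
    (h : ∀ e, (M e).Implements 𝒮 (V (src e)) (R e))
    (hV : ∀ e w a a', V (src e) w a → R e w a a' → V (dst e) w a') (s t : S) :
    (Prog.graph src dst M s t).Implements 𝒮 (V s) fun w a a' =>
      Relation.ReflTransGen (GStep src dst (fun e => R e w)) (s, a) (t, a') := by
  -- The invariant of a run: at a vertex, the configuration represents an abstract one that the
  -- graph reaches; inside the copy of `M e`, the run of this copy began with such a configuration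
  -- at the source of `e`.
  have key : ∀ w c a, (𝒮 w).rep c a → V s w a → ∀ x,
      (Prog.graph src dst M s t).Reach (𝒮 w).act (.inl s, c) x →
      match x with
      | (.inl r, c') => ∃ a', (𝒮 w).rep c' a' ∧ V r w a' ∧
          Relation.ReflTransGen (GStep src dst (fun e => R e w)) (s, a) (r, a')
      | (.inr ⟨e, q⟩, c') => ∃ c₁ a₁, (𝒮 w).rep c₁ a₁ ∧ V (src e) w a₁ ∧
          Relation.ReflTransGen (GStep src dst (fun e => R e w)) (s, a) (src e, a₁) ∧
          (M e).Reach (𝒮 w).act ((M e).start, c₁) (q, c') := by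
    intro w c a hc ha x hx
    induction hx with
    | refl => exact ⟨a, hc, ha, .refl⟩
    | @tail x y _ h ih =>
      obtain ⟨l, hl, h⟩ := h
      rcases x with ⟨r | ⟨e, q⟩, c'⟩ <;> rcases y with ⟨r' | ⟨e', q'⟩, c''⟩
      · exact hl.elim
      · obtain ⟨rfl, rfl, rfl⟩ := hl
        obtain ⟨a', h1, h2, h3⟩ := ih
        obtain rfl : c' = c'' := h
        exact ⟨c', a', h1, h2, h3, .refl⟩
      · obtain ⟨rfl, rfl, rfl⟩ := hl
        obtain ⟨c₁, a₁, h1, h2, h3, h4⟩ := ih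
        obtain rfl : c' = c'' := h
        obtain ⟨a', h5, h6⟩ := (h e).sound w c₁ a₁ h1 h2 _ h4
        exact ⟨a', h5, hV e w _ _ h2 h6, h3.tail ⟨e, rfl, rfl, h6⟩⟩
      · obtain ⟨q'', h', hl⟩ := hl
        cases h'
        obtain ⟨c₁, a₁, h1, h2, h3, h4⟩ := ih
        exact ⟨c₁, a₁, h1, h2, h3, h4.tail ⟨l, hl, h⟩⟩
  refine ⟨fun w c a hc ha x hx => ?_, fun w c a hc ha c' hx => ?_, fun w c a hc ha a' hR => ?_⟩
  · have := key w c a hc ha x hx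
    rcases x with ⟨r | ⟨e, q⟩, c'⟩
    · obtain ⟨a', h1, -⟩ := this
      exact (𝒮 w).safe_of_rep _ _ h1
    · obtain ⟨c₁, a₁, h1, h2, -, h4⟩ := this
      exact (h e).safe w c₁ a₁ h1 h2 _ h4
  · obtain ⟨a', h1, -, h2⟩ := key w c a hc ha _ hx
    exact ⟨a', h1, h2⟩
  -- Completeness of an edge yields some representative of the next abstract configuration, not a
  -- prescribed one. The induction thus consumes the path from its head and quantifies over all
  -- representatives of the current configuration.
  · suffices ∀ x y : S × A, Relation.ReflTransGen (GStep src dst (fun e => R e w)) x y →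
        ∀ c, (𝒮 w).rep c x.2 → V x.1 w x.2 → ∃ c', (𝒮 w).rep c' y.2 ∧
        (Prog.graph src dst M s t).Reach (𝒮 w).act (.inl x.1, c) (.inl y.1, c') from
      this _ _ hR c hc ha
    intro x y hxy
    induction hxy using Relation.ReflTransGen.head_induction_on with
    | refl => exact fun c hc _ => ⟨c, hc, .refl⟩
    | @head x z h' _ ih =>
      intro c hc hx
      obtain ⟨e, h1, h2, h3⟩ := h'
      rw [← h1] at hx
      obtain ⟨c₁, h4, h5⟩ := (h e).complete w c _ hc hx _ h3
      obtain ⟨c₂, h6, h7⟩ := ih c₁ h4 (h2 ▸ hV e w _ _ hx h3)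
      refine ⟨c₂, h6, .trans (.head ?_ (.tail (Prog.graph_reach h5) ?_)) h7⟩
      · exact ⟨none, ⟨rfl, h1.symm, rfl⟩, rfl⟩
      · exact ⟨none, ⟨rfl, h2.symm, rfl⟩, rfl⟩

/-- Sequences, loops and finite unions are graphs with at most three vertices, and each simulation
below is one such graph whose vertices are the states of the simulated device. -/
theorem Impl.graph {S E : Type} [Finite S] [Finite E] {src dst : E → S}
    {V : S → W → A → Prop} {R : E → W → A → A → Prop}
    (h : ∀ e, Impl 𝒮 (V (src e)) (R e))
    (hV : ∀ e w a a', V (src e) w a → R e w a a' → V (dst e) w a') (s t : S) :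
    Impl 𝒮 (V s) fun w a a' =>
      Relation.ReflTransGen (GStep src dst (fun e => R e w)) (s, a) (t, a') := by
  choose M hM using h
  exact ⟨_, Prog.Implements.graph hM hV s t⟩

theorem Impl.congr {V V' : W → A → Prop} {R R' : W → A → A → Prop} (h : Impl 𝒮 V R)
    (hV : ∀ w a, V' w a → V w a) (hR : ∀ w a, V' w a → ∀ a', R w a a' ↔ R' w a a') :
    Impl 𝒮 V' R' := by
  obtain ⟨M, hM⟩ := h
  refine ⟨M, fun w c a hc ha => hM.safe w c a hc (hV _ _ ha), fun w c a hc ha c' hx => ?_,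
    fun w c a hc ha a' hx => hM.complete w c a hc (hV _ _ ha) a' ((hR _ _ ha _).2 hx)⟩
  obtain ⟨a', h1, h2⟩ := hM.sound w c a hc (hV _ _ ha) c' hx
  exact ⟨a', h1, (hR _ _ ha _).1 h2⟩

theorem Impl.mono {V V' : W → A → Prop} {R : W → A → A → Prop} (h : Impl 𝒮 V R)
    (hV : ∀ w a, V' w a → V w a) : Impl 𝒮 V' R :=
  h.congr hV fun _ _ _ _ => Iff.rfl

/-- A single instruction implements a relation. -/
theorem Impl.act {V : W → A → Prop} {R : W → A → A → Prop} (l : Λ)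
    (hs : ∀ w c a c', (𝒮 w).rep c a → V w a → (𝒮 w).act l c c' →
      ∃ a', (𝒮 w).rep c' a' ∧ R w a a')
    (hc : ∀ w c a a', (𝒮 w).rep c a → V w a → R w a a' →
      ∃ c', (𝒮 w).rep c' a' ∧ (𝒮 w).act l c c') : Impl 𝒮 V R := by
  let M : Prog Λ := ⟨Bool, inferInstance, false, true, fun q m q' => q = false ∧ m = some l ∧
    q' = true⟩
  have key : ∀ w c x, M.Reach (𝒮 w).act (false, c) x → x = (false, c) ∨
      x.1 = true ∧ (𝒮 w).act l c x.2 := by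
    intro w c x hx
    induction hx with
    | refl => exact .inl rfl
    | tail _ h ih =>
      obtain ⟨_, ⟨h1, rfl, h2⟩, h⟩ := h
      rcases ih with rfl | ih
      · exact .inr ⟨h2, h⟩
      · exact absurd (ih.1.symm.trans h1) (by simp)
  refine ⟨M, fun w c a h1 h2 x hx => ?_, fun w c a h1 h2 c' hx => ?_, fun w c a h1 h2 a' h3 => ?_⟩
  · rcases key w c x hx with rfl | ⟨-, h⟩
    · exact (𝒮 w).safe_of_rep _ _ h1
    · obtain ⟨a', h3, -⟩ := hs w c a _ h1 h2 h
      exact (𝒮 w).safe_of_rep _ _ h3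
  · rcases key w c _ hx with h | ⟨-, h⟩
    · exact absurd (congrArg Prod.fst h) (by simp [M])
    · exact hs w c a _ h1 h2 h
  · obtain ⟨c', h4, h5⟩ := hc w c a a' h1 h2 h3
    exact ⟨c', h4, .single ⟨some l, ⟨rfl, rfl, rfl⟩, h5⟩⟩

theorem Impl.seq {V V' : W → A → Prop} {R R' : W → A → A → Prop} (h : Impl 𝒮 V R)
    (hV : ∀ w a a', V w a → R w a a' → V' w a') (h' : Impl 𝒮 V' R') :
    Impl 𝒮 V fun w => Relation.Comp (R w) (R' w) := by
  -- A path with the vertices 0, 1, 2. Nothing leaves the vertex 2, so no condition has to be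
  -- maintained there.
  have := Impl.graph (𝒮 := 𝒮) (S := Fin 3) (E := Bool) (src := fun b => cond b 1 0)
    (dst := fun b => cond b 2 1)
    (V := fun s w a => s = 0 ∧ V w a ∨ s = 1 ∧ V' w a ∨ s = 2)
    (R := fun b => cond b R' R) ?_ ?_ 0 2
  · refine this.congr (fun w a ha => .inl ⟨rfl, ha⟩) fun w a _ a' => ⟨fun hr => ?_, ?_⟩
    · suffices ∀ x : Fin 3 × A, Relation.ReflTransGen (GStep (fun b : Bool => cond b 1 0)
          (fun b => cond b 2 1) (fun b => (cond b R' R) w)) (0, a) x →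
          x.1 = 0 ∧ x.2 = a ∨ x.1 = 1 ∧ R w a x.2 ∨ x.1 = 2 ∧ Relation.Comp (R w) (R' w) a x.2 by
        simpa using this _ hr
      intro x hx
      induction hx with
      | refl => exact .inl ⟨rfl, rfl⟩
      | @tail y z _ h ih =>
        obtain ⟨_ | _, h1, h2, h3⟩ := h
        · simp only [cond_false] at h1 h2 h3
          simp only [← h1, ← h2, true_and, Fin.reduceEq, false_and, or_false, false_or] at ih ⊢
          rw [← ih]; exact h3
        · simp only [cond_true] at h1 h2 h3
          simp only [← h1, ← h2, true_and, Fin.reduceEq, false_and, or_false, false_or] at ih ⊢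
          exact ⟨_, ih, h3⟩
    · rintro ⟨b, h1, h2⟩
      exact .tail (b := (1, b)) (.single ⟨false, rfl, rfl, h1⟩) ⟨true, rfl, rfl, h2⟩
  · rintro (_ | _)
    · exact h.mono fun w a ha => by simpa using ha
    · exact h'.mono fun w a ha => by simpa using ha
  · rintro (_ | _) w a a' h1 h2
    · exact .inr (.inl ⟨rfl, hV w a a' (by simpa using h1) h2⟩)
    · exact .inr (.inr rfl)

theorem Impl.star {V : W → A → Prop} {R : W → A → A → Prop} (h : Impl 𝒮 V R)
    (hV : ∀ w a a', V w a → R w a a' → V w a') :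
    Impl 𝒮 V fun w => Relation.ReflTransGen (R w) := by
  refine (Impl.graph (S := Unit) (E := Unit) (src := id) (dst := id) (V := fun _ => V)
    (R := fun _ => R) (fun _ => h) (fun _ => hV) () ()).congr (fun _ _ h => h)
    fun w a _ a' => ⟨fun hr => ?_, fun hr => ?_⟩
  · suffices ∀ x y, Relation.ReflTransGen (GStep (S := Unit) (E := Unit) id id fun _ => R w) x y →
      Relation.ReflTransGen (R w) x.2 y.2 from this _ _ hr
    intro x y hxy
    induction hxy with
    | refl => exact .refl
    | tail _ h ih =>
      obtain ⟨_, _, _, h⟩ := h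
      exact ih.tail h
  · induction hr with
    | refl => exact .refl
    | tail _ h ih => exact ih.tail ⟨(), rfl, rfl, h⟩

theorem Impl.skip {V : W → A → Prop} : Impl 𝒮 V fun _ => Eq := by
  refine (Impl.graph (S := Unit) (E := Empty) (src := fun _ => ()) (dst := fun _ => ())
    (V := fun _ => V) (R := fun _ _ _ _ => False) (fun e => e.elim) (fun e => e.elim) () ()).congr
    (fun _ _ h => h) fun w a _ a' => ⟨fun hr => ?_, fun hr => hr ▸ .refl⟩
  rcases hr.cases_head with h | ⟨_, ⟨e, _⟩, _⟩
  · exact congrArg Prod.snd h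
  · exact e.elim

theorem Impl.iUnion {ι : Type} [Finite ι] {V : W → A → Prop} {R : ι → W → A → A → Prop}
    (h : ∀ i, Impl 𝒮 V (R i)) : Impl 𝒮 V fun w a a' => ∃ i, R i w a a' := by
  refine (Impl.graph (S := Bool) (E := ι) (src := fun _ => false) (dst := fun _ => true)
    (V := fun s w a => s = false → V w a) (R := R) (fun e => (h e).mono fun w a ha => ha rfl)
    (fun e w a a' _ _ h => absurd h (by simp)) false true).congr (fun _ _ h _ => h)
    fun w a _ a' => ⟨fun hr => ?_, fun ⟨i, hr⟩ => .single ⟨i, rfl, rfl, hr⟩⟩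
  rcases hr.cases_head with h | ⟨⟨s, b⟩, ⟨e, h1, h2, h3⟩, h4⟩
  · exact absurd (congrArg Prod.fst h) (by simp)
  · rcases h4.cases_head with h | ⟨_, ⟨e', h5, h6, -⟩, _⟩
    · cases h; exact ⟨e, h3⟩
    · exact absurd (h5.trans h2.symm) (by simp)

/-- The relations of a list, one after the other. -/
def listRel (l : List (A → A → Prop)) : A → A → Prop := l.foldr Relation.Comp Eq

theorem Impl.list {ι : Type} {V : W → A → Prop} {R : ι → W → A → A → Prop} (l : List ι)
    (h : ∀ i ∈ l, Impl 𝒮 V (R i)) (hV : ∀ i ∈ l, ∀ w a a', V w a → R i w a a' → V w a') :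
    Impl 𝒮 V fun w => listRel (l.map fun i => R i w) := by
  induction l with
  | nil => exact Impl.skip
  | cons i l ih =>
    exact (h i (by simp)).seq (hV i (by simp)) (ih (fun j hj => h j (by simp [hj]))
      fun j hj => hV j (by simp [hj]))

/-! ## Programs that move heads on the input tape -/

instance : Finite TapeSym :=
  Finite.of_surjective (fun o : Option (Option Bool) => match o with
    | none => TapeSym.left
    | some none => .right
    | some (some b) => .letter b) fun s => by
      cases s with
      | left => exact ⟨none, rfl⟩
      | letter b => exact ⟨some (some b), rfl⟩
      | right => exact ⟨some none, rfl⟩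

instance : Finite Dir :=
  Finite.of_surjective (fun o : Option Bool => match o with
    | none => Dir.stay
    | some false => .left
    | some true => .right) fun s => by
      cases s with
      | left => exact ⟨some false, rfl⟩
      | stay => exact ⟨none, rfl⟩
      | right => exact ⟨some true, rfl⟩

theorem tapeAt_eq_left {w : List Bool} {p : ℕ} : tapeAt w p = .left ↔ p = 0 := by
  rcases p with _ | p
  · simp [tapeAt]
  · cases h : w[p]? <;> simp [tapeAt, h]

theorem tapeAt_eq_right {w : List Bool} {p : ℕ} : tapeAt w p = .right ↔ w.length < p := by
  rcases p with _ | p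
  · simp [tapeAt]
  · cases h : w[p]?
    · have h' := List.getElem?_eq_none_iff.1 h
      simp only [tapeAt, h, Option.elim_none, true_iff]; omega
    · obtain ⟨h, -⟩ := List.getElem?_eq_some_iff.1 h
      simp only [tapeAt, *, Option.elim_some, reduceCtorEq, false_iff]; omega

/-- The relation on families of numbers that changes the number with index `j` according to the
relation `r`. -/
def locRel {ι : Type} [DecidableEq ι] (j : ι) (r : ℕ → ℕ → Prop) (p p' : ι → ℕ) : Prop :=
  ∃ v, r (p j) v ∧ p' = Function.update p j v

/-- The indices are distinct, so no change affects the test or the result of another one, and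
changes made one after the other amount to a simultaneous change. This is how one step of an
automaton, which moves all heads, becomes a sequence of instructions. -/
theorem listRel_locRel {ι κ : Type} [DecidableEq ι] {f : κ → ι} (hf : f.Injective)
    (r : κ → ℕ → ℕ → Prop) {l : List κ} (hl : l.Nodup) {p p' : ι → ℕ} :
    listRel (l.map fun j => locRel (f j) (r j)) p p' ↔
      (∀ j ∈ l, r j (p (f j)) (p' (f j))) ∧ ∀ i, (∀ j ∈ l, f j ≠ i) → p' i = p i := by
  induction l generalizing p with
  | nil =>
    simp only [List.map_nil, listRel, List.foldr_nil, List.not_mem_nil, false_imp_iff, implies_true,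
      true_and, forall_const]
    exact ⟨fun h i => by rw [h], fun h => (funext h).symm⟩
  | cons a l ih =>
    obtain ⟨ha, hl⟩ := List.nodup_cons.1 hl
    have hne : ∀ j ∈ l, f j ≠ f a := fun j hj h => ha (hf h ▸ hj)
    constructor
    · rintro ⟨q, ⟨v, hv, rfl⟩, h⟩
      obtain ⟨h1, h2⟩ := (ih hl).1 h
      refine ⟨fun j hj => ?_, fun i hi => ?_⟩
      · rcases List.mem_cons.1 hj with rfl | hj
        · rw [h2 _ hne, Function.update_self]; exact hv
        · have := h1 j hj
          rwa [Function.update_of_ne (hne j hj)] at this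
      · rw [h2 i fun j hj => hi j (by simp [hj]), Function.update_of_ne (hi a (by simp)).symm]
    · rintro ⟨h1, h2⟩
      refine ⟨Function.update p (f a) (p' (f a)), ⟨_, h1 a (by simp), rfl⟩, (ih hl).2 ⟨?_, ?_⟩⟩
      · intro j hj
        rw [Function.update_of_ne (hne j hj)]
        exact h1 j (by simp [hj])
      · intro i hi
        by_cases h : i = f a
        · rw [h, Function.update_self]
        · rw [Function.update_of_ne h]
          exact h2 i fun j hj => (List.mem_cons.1 hj).elim (fun e => e ▸ Ne.symm h) (hi j)

/-! ### Multihead automata as programs -/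

/-- The instructions of multihead automata: test whether the symbol under the head `j` belongs to
some set, and move this head. -/
abbrev HLab (ι : Type) : Type := ι × Set TapeSym × Dir

/-- The effect of an instruction on the position of the head that it concerns. -/
def hRel (w : List Bool) (S : Set TapeSym) (d : Dir) (u v : ℕ) : Prop :=
  tapeAt w u ∈ S ∧ d.Moves u v ∧ v ≤ w.length + 1

/-- The effect of an instruction on the positions of the heads. -/
def hAct {ι : Type} [DecidableEq ι] (w : List Bool) (l : HLab ι) : (ι → ℕ) → (ι → ℕ) → Prop :=
  locRel l.1 (hRel w l.2.1 l.2.2)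

/-- The interpretation of instructions on configurations that represent themselves. -/
def exactSem {Λ C : Type} (act : Λ → C → C → Prop) : Sem Λ C C :=
  ⟨act, fun _ => True, Eq, fun _ _ _ => trivial⟩

/-- The interpretation of the instructions of multihead automata. -/
abbrev hSem (ι : Type) [DecidableEq ι] (w : List Bool) : Sem (HLab ι) (ι → ℕ) (ι → ℕ) :=
  exactSem (hAct w)

theorem Impl.act_exact {W Λ C : Type} {act : W → Λ → C → C → Prop} {V : W → C → Prop} (l : Λ) :
    Impl (fun w => exactSem (act w)) V fun w => act w l :=
  Impl.act l (fun _ _ _ c' h _ h' => ⟨c', rfl, by cases h; exact h'⟩)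
    fun _ _ _ c' h _ h' => ⟨c', rfl, by cases h; exact h'⟩

theorem Prog.Implements.reach_exact {W Λ C : Type} {act : W → Λ → C → C → Prop} {V : W → C → Prop}
    {R : W → C → C → Prop} {M : Prog Λ} (h : M.Implements (fun w => exactSem (act w)) V R)
    {w : W} {c c' : C} (hc : V w c) : M.Reach (act w) (M.start, c) (M.final, c') ↔ R w c c' := by
  constructor
  · intro hr
    obtain ⟨_, rfl, h2⟩ := h.sound w c c rfl hc c' hr
    exact h2
  · intro hr
    obtain ⟨_, rfl, h2⟩ := h.complete w c c rfl hc c' hr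
    exact h2

/-- The language of a program: the words on which it can reach its final state when all heads start
on the left end marker. -/
def headLang {ι : Type} [DecidableEq ι] (M : Prog (HLab ι)) : Language Bool :=
  {w : List Bool | ∃ p, M.Reach (hAct w) (M.start, fun _ => 0) (M.final, p)}

/-- The multihead automaton given by a program. -/
def Prog.toMultihead {ι : Type} {k : ℕ} (M : Prog (HLab ι)) (e : ι ≃ Fin k) : MultiheadNFA k where
  State := M.State
  finite_state := M.finite_state
  start := M.start
  accept := {M.final}
  trans q σ := {x | (M.trans q none x.1 ∧ x.2 = fun _ => .stay) ∨
    ∃ j S d, M.trans q (some (j, S, d)) x.1 ∧ σ (e j) ∈ S ∧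
      x.2 = Function.update (fun _ => .stay) (e j) d}

/-- The bound on the positions enters because an automaton requires of every head, even of one that
stays, that it be on the tape, whereas an instruction constrains a single head. -/
theorem Prog.step_toMultihead {ι : Type} [DecidableEq ι] {k : ℕ} (M : Prog (HLab ι))
    (e : ι ≃ Fin k) {w : List Bool} {q q' : M.State} {p : ι → ℕ} {p' : Fin k → ℕ}
    (hp : ∀ j, p j ≤ w.length + 1) :
    (M.toMultihead e).Step w (q, fun j => p (e.symm j)) (q', p') ↔
      M.Step (hAct w) (q, p) (q', fun j => p' (e j)) := by
  constructor
  · rintro ⟨d, ⟨h1, rfl⟩ | ⟨j, S, d, h1, h2, rfl⟩, h3⟩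
    · refine ⟨none, h1, funext fun j => ?_⟩
      simpa [Dir.Moves] using (h3 (e j)).1.symm
    · refine ⟨some (j, S, d), h1, p' (e j), ⟨by simpa using h2, ?_, (h3 _).2⟩, funext fun i => ?_⟩
      · simpa using (h3 (e j)).1
      · by_cases hi : i = j
        · subst hi; simp
        · have := (h3 (e i)).1
          rw [Function.update_of_ne (by simpa using hi)] at this
          simpa [hi, Dir.Moves] using this
  · rintro ⟨_ | ⟨j, S, d⟩, h1, h2⟩
    · have h2 : p = fun j => p' (e j) := h2
      refine ⟨_, .inl ⟨h1, rfl⟩, fun j => ?_⟩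
      have := hp (e.symm j)
      simp only [h2, Equiv.apply_symm_apply] at this ⊢
      exact ⟨rfl, this⟩
    · obtain ⟨v, ⟨h2, h3, h4⟩, h5⟩ := h2
      have h5 : (fun j => p' (e j)) = Function.update p j v := h5
      refine ⟨Function.update (fun _ => .stay) (e j) d, .inr ⟨j, S, d, h1, by simpa using h2, rfl⟩,
        fun i => ?_⟩
      obtain ⟨i, rfl⟩ := e.surjective i
      have h6 := congrFun h5 i
      simp only [Equiv.symm_apply_apply, h6]
      by_cases hi : i = j
      · subst hi
        rw [Function.update_self, Function.update_self]
        exact ⟨h3, h4⟩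
      · have : e i ≠ e j := by simpa using hi
        rw [Function.update_of_ne hi]
        refine ⟨?_, hp i⟩
        rw [Function.update_of_ne this]
        rfl

theorem Prog.Step.le {ι : Type} [DecidableEq ι] {M : Prog (HLab ι)} {w : List Bool}
    {x y : M.State × (ι → ℕ)} (h : M.Step (hAct w) x y) (hx : ∀ j, x.2 j ≤ w.length + 1) (j : ι) :
    y.2 j ≤ w.length + 1 := by
  obtain ⟨_ | ⟨i, S, d⟩, -, h⟩ := h
  · have h : x.2 = y.2 := h
    rw [← h]; exact hx j
  · obtain ⟨v, ⟨-, -, h4⟩, h5⟩ := h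
    rw [h5]
    by_cases hj : j = i
    · subst hj; simpa using h4
    · rw [Function.update_of_ne hj]; exact hx j

theorem Prog.language_toMultihead {ι : Type} [DecidableEq ι] {k : ℕ} (M : Prog (HLab ι))
    (e : ι ≃ Fin k) : (M.toMultihead e).language = headLang M := by
  ext w
  constructor
  · rintro ⟨⟨q, c⟩, hc, hq⟩
    obtain rfl : q = M.final := hq
    refine ⟨fun j => c (e j), ?_⟩
    suffices ∀ c, Relation.ReflTransGen ((M.toMultihead e).Step w) (M.start, fun _ => 0) c →
        M.Reach (hAct w) (M.start, fun _ => 0) (c.1, fun j => c.2 (e j)) ∧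
        ∀ j, c.2 (e j) ≤ w.length + 1 from (this _ hc).1
    intro c hc
    induction hc with
    | refl => exact ⟨.refl, fun _ => Nat.zero_le _⟩
    | @tail a b _ h ih =>
      have := (M.step_toMultihead e (q := a.1) (p := fun j => a.2 (e j)) (p' := b.2) (q' := b.1)
        ih.2).1 (by simpa using h)
      exact ⟨ih.1.tail this, this.le ih.2⟩
  · rintro ⟨p, hp⟩
    suffices ∀ x, M.Reach (hAct w) (M.start, fun _ => 0) x → Relation.ReflTransGen
        ((M.toMultihead e).Step w) (M.start, fun _ => 0) (x.1, fun j => x.2 (e.symm j)) ∧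
        ∀ j, x.2 j ≤ w.length + 1 from ⟨_, (this _ hp).1, rfl⟩
    intro x hx
    induction hx with
    | refl => exact ⟨.refl, fun _ => Nat.zero_le _⟩
    | @tail a b _ h ih =>
      exact ⟨ih.1.tail ((M.step_toMultihead e ih.2).2 (by simpa using h)), h.le ih.2⟩

theorem headLang_mem_twoNFA {ι : Type} [DecidableEq ι] {k : ℕ} {i : ℕ∞} (hk : (k : ℕ∞) ≤ i)
    (M : Prog (HLab ι)) (e : ι ≃ Fin k) : headLang M ∈ twoNFA i :=
  ⟨k, hk, M.toMultihead e, (M.language_toMultihead e).symm⟩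

/-- A multihead automaton can be replaced by a program, with at least as many heads, that tests at
the beginning whether all heads are on the left end marker. -/
theorem MultiheadNFA.exists_prog {k k' : ℕ} (hk : k ≤ k') (M : MultiheadNFA k) :
    ∃ M' : Prog (HLab (Fin k')), ∀ w p,
      (∃ p', M'.Reach (hAct w) (M'.start, p) (M'.final, p')) ↔ p = (fun _ => 0) ∧ w ∈ M.language := by
  have := M.finite_state
  have := Finite.of_injective _ (Fin.castLE_injective hk)
  let T := {x : M.State × (Fin k → TapeSym) × M.State × (Fin k → Dir) //
    (x.2.2.1, x.2.2.2) ∈ M.trans x.1 x.2.1}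
  let src : Unit ⊕ T ⊕ M.accept → Option (Option M.State)
    | .inl _ => none
    | .inr (.inl x) => some (some x.1.1)
    | .inr (.inr q) => some (some q)
  let dst : Unit ⊕ T ⊕ M.accept → Option (Option M.State)
    | .inl _ => some (some M.start)
    | .inr (.inl x) => some (some x.1.2.2.1)
    | .inr (.inr q) => some none
  let R : Unit ⊕ T ⊕ M.accept → List Bool → (Fin k' → ℕ) → (Fin k' → ℕ) → Prop
    | .inl _, w => listRel ((List.finRange k').map fun j => locRel j (hRel w {.left} .stay))
    | .inr (.inl x), w => listRel ((List.finRange k).map fun j =>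
        locRel (Fin.castLE hk j) (hRel w {x.1.2.1 j} (x.1.2.2.2 j)))
    | .inr (.inr q), _ => Eq
  have hR : ∀ e, Impl (hSem (Fin k')) (fun _ _ => True) (R e) := by
    rintro (_ | x | q)
    · exact Impl.list _ (fun j _ => Impl.act_exact (act := hAct) (j, {.left}, .stay))
        fun _ _ _ _ _ _ _ => trivial
    · exact Impl.list _ (fun j _ => Impl.act_exact (act := hAct)
        (Fin.castLE hk j, {x.1.2.1 j}, x.1.2.2.2 j)) fun _ _ _ _ _ _ _ => trivial
    · exact Impl.skip
  obtain ⟨M', hM'⟩ := Impl.graph (src := src) (dst := dst) (V := fun _ _ _ => True) hR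
    (fun _ _ _ _ _ _ => trivial) none (some none)
  have hT : ∀ x : T, ∀ w p p', R (.inr (.inl x)) w p p' ↔
      (∀ j, hRel w {x.1.2.1 j} (x.1.2.2.2 j) (p (Fin.castLE hk j)) (p' (Fin.castLE hk j))) ∧
      ∀ i, (∀ j, Fin.castLE hk j ≠ i) → p' i = p i := by
    intro x w p p'
    refine (listRel_locRel (Fin.castLE_injective hk) (fun j => hRel w {x.1.2.1 j} (x.1.2.2.2 j))
      (List.nodup_finRange k)).trans ?_
    simp
  -- This first edge matters later: a computation on a circular list may begin with its heads
  -- anywhere, and the test discards all beginnings but one.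
  have h0 : ∀ w p p', R (.inl ()) w p p' ↔ p = (fun _ => 0) ∧ p' = p := by
    intro w p p'
    refine (listRel_locRel (f := id) Function.injective_id (fun j => hRel w {.left} .stay)
      (List.nodup_finRange k')).trans ?_
    simp only [List.mem_finRange, hRel, mem_singleton_iff, tapeAt_eq_left, Dir.Moves, id,
      forall_const, funext_iff]
    constructor
    · exact fun h => ⟨fun j => (h.1 j).1, fun j => (h.1 j).2.1⟩
    · exact fun ⟨h1, h2⟩ => ⟨fun j => ⟨h1 j, h2 j, by rw [h2, h1]; exact Nat.zero_le _⟩,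
        fun j _ => h2 j⟩
  refine ⟨M', fun w p => ?_⟩
  simp only [hM'.reach_exact (w := w) trivial]
  constructor
  · rintro ⟨p', h⟩
    suffices ∀ x, Relation.ReflTransGen (GStep src dst fun e => R e w) (none, p) x →
        match x with
        | (none, _) => x = (none, p)
        | (some none, _) => p = (fun _ => 0) ∧ w ∈ M.language
        | (some (some q), p') => p = (fun _ => 0) ∧ Relation.ReflTransGen (M.Step w)
          (M.start, fun _ => 0) (q, fun j => p' (Fin.castLE hk j)) from this _ h
    intro x hx
    induction hx with
    | refl => rfl
    | @tail y z _ hs ih =>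
      obtain ⟨y, p₁⟩ := y
      obtain ⟨z, p₂⟩ := z
      obtain ⟨_ | x | q, rfl, rfl, hs⟩ := hs
      · obtain rfl : p₁ = p := congrArg Prod.snd (ih : (none, p₁) = (none, p))
        obtain ⟨rfl, rfl⟩ := (h0 w p₁ p₂).1 hs
        exact ⟨rfl, .refl⟩
      · obtain ⟨h1, -⟩ := (hT x w p₁ p₂).1 hs
        refine ⟨ih.1, ih.2.tail ⟨x.1.2.2.2, ?_, fun j => (h1 j).2⟩⟩
        have : (fun j => tapeAt w (p₁ (Fin.castLE hk j))) = x.1.2.1 := funext fun j => (h1 j).1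
        simp only [this]
        exact x.2
      · exact ⟨ih.1, _, ih.2, q.2⟩
  · rintro ⟨rfl, c, hc, hq⟩
    suffices ∀ c, Relation.ReflTransGen (M.Step w) (M.start, fun _ => 0) c → ∃ p : Fin k' → ℕ,
        (∀ j, p (Fin.castLE hk j) = c.2 j) ∧ Relation.ReflTransGen (GStep src dst fun e => R e w)
        (none, fun _ => 0) (some (some c.1), p) by
      obtain ⟨p, -, h⟩ := this c hc
      exact ⟨p, h.tail ⟨.inr (.inr ⟨_, hq⟩), rfl, rfl, rfl⟩⟩
    intro c hc
    induction hc with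
    | refl => exact ⟨_, fun _ => rfl, .single ⟨.inl (), rfl, rfl, (h0 w _ _).2 ⟨rfl, rfl⟩⟩⟩
    | @tail a b _ h ih =>
      obtain ⟨p, h1, h2⟩ := ih
      obtain ⟨d, h3, h4⟩ := h
      -- The `k` simulated heads take their new positions; the additional ones never move.
      refine ⟨fun i => if hi : (i : ℕ) < k then b.2 ⟨i, hi⟩ else p i, fun j => by simp, ?_⟩
      refine h2.tail ⟨.inr (.inl ⟨⟨a.1, _, b.1, d⟩, h3⟩), rfl, rfl, (hT _ w _ _).2 ⟨?_, ?_⟩⟩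
      · intro j
        have : (⟨(Fin.castLE hk j : Fin k'), j.2⟩ : Fin k) = j := rfl
        simp only [hRel, h1, Fin.val_castLE, j.2, dite_true, mem_singleton_iff]
        exact ⟨rfl, h4 j⟩
      · intro i hi
        exact dif_neg fun h => hi ⟨i, h⟩ rfl

/-! ## Heads on a circular tape -/

/-- The symbol at position `p ≤ |w|` of the circular list `⋆w`. -/
def cSym (w : List Bool) : ℕ → Option Bool
  | 0 => none
  | p + 1 => w[p]?

/-- The symbol of a linear tape that corresponds to a symbol of a circular list. -/
def toTape : Option Bool → TapeSym
  | none => .left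
  | some b => .letter b

theorem toTape_injective : Function.Injective toTape := by
  rintro (_ | a) (_ | b) h <;> simp_all [toTape]

theorem tapeAt_eq_toTape {w : List Bool} {p : ℕ} (hp : p ≤ w.length) :
    tapeAt w p = toTape (cSym w p) := by
  rcases p with _ | p
  · rfl
  · have : p < w.length := hp
    simp [tapeAt, cSym, this, toTape]

theorem cSym_eq_none {w : List Bool} {p : ℕ} (hp : p ≤ w.length) : cSym w p = none ↔ p = 0 := by
  rw [← tapeAt_eq_left, tapeAt_eq_toTape hp]
  exact (toTape_injective.eq_iff (b := none)).symm

/-- The position that follows `u` on a circular list of length `n + 1`. -/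
def cNext (n u : ℕ) : ℕ := if u = n then 0 else u + 1

/-- The instructions of automata on circular lists: a head `j`, the symbol that it leaves, the one
at which it arrives, and the direction of the movement. -/
abbrev CLab (ι : Type) : Type := ι × Option Bool × Option Bool × Bool

/-- The effect of an instruction on the position of the head that it concerns. -/
def cRel (w : List Bool) (a b : Option Bool) (fwd : Bool) (u v : ℕ) : Prop :=
  u ≤ w.length ∧ v ≤ w.length ∧ cSym w u = a ∧ cSym w v = b ∧
    bif fwd then v = cNext w.length u else u = cNext w.length v

/-- The effect of an instruction on the positions of the heads. -/
def cAct {ι : Type} [DecidableEq ι] (w : List Bool) (l : CLab ι) : (ι → ℕ) → (ι → ℕ) → Prop :=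
  locRel l.1 (cRel w l.2.1 l.2.2.1 l.2.2.2)

/-- The interpretation of the instructions of automata on circular lists. -/
abbrev cSem (ι : Type) [DecidableEq ι] (w : List Bool) : Sem (CLab ι) (ι → ℕ) (ι → ℕ) :=
  exactSem (cAct w)

/-- The words on which a program can reach its final state, for some initial positions of the heads
on the circular list. -/
def circLang {ι : Type} [DecidableEq ι] (M : Prog (CLab ι)) : Language Bool :=
  {w : List Bool | ∃ p p', (∀ j, p j ≤ w.length) ∧ M.Reach (cAct w) (M.start, p) (M.final, p')}

/-! ### Relations that concern one head -/

section Local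

variable {W Λ ι : Type} [DecidableEq ι] {act : W → Λ → (ι → ℕ) → (ι → ℕ) → Prop} {j : ι}
  {D D' : W → ℕ → Prop} {r r' : W → ℕ → ℕ → Prop}

/-- Some program implements the relation `r` on the values in `D` of the coordinate `j`. -/
def LocImpl (act : W → Λ → (ι → ℕ) → (ι → ℕ) → Prop) (j : ι) (D : W → ℕ → Prop)
    (r : W → ℕ → ℕ → Prop) : Prop :=
  Impl (fun w => exactSem (act w)) (fun w p => D w (p j)) fun w => locRel j (r w)

theorem locRel_apply {r : ℕ → ℕ → Prop} {p p' : ι → ℕ} (h : locRel j r p p') :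
    r (p j) (p' j) := by
  obtain ⟨v, h, rfl⟩ := h
  simpa using h

theorem LocImpl.congr (h : LocImpl act j D r) (hD : ∀ w u, D' w u → D w u)
    (hr : ∀ w u, D' w u → ∀ v, r w u v ↔ r' w u v) : LocImpl act j D' r' :=
  Impl.congr h (fun w _ hp => hD w _ hp) fun w _ hp _ =>
    exists_congr fun v => and_congr_left fun _ => hr w _ hp v

theorem LocImpl.seq (h : LocImpl act j D r) (hD : ∀ w u v, D w u → r w u v → D' w v)
    (h' : LocImpl act j D' r') : LocImpl act j D fun w => Relation.Comp (r w) (r' w) := by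
  refine (Impl.seq h (fun w _ _ hp hr => hD w _ _ hp (locRel_apply hr)) h').congr
    (fun _ _ h => h) fun w p _ p' => ⟨?_, ?_⟩
  · rintro ⟨_, ⟨v, hv, rfl⟩, v', hv', rfl⟩
    exact ⟨v', ⟨v, hv, by simpa using hv'⟩, by simp⟩
  · rintro ⟨v', ⟨v, hv, hv'⟩, rfl⟩
    exact ⟨_, ⟨v, hv, rfl⟩, v', by simpa using hv', by simp⟩

theorem LocImpl.star (h : LocImpl act j D r) (hD : ∀ w u v, D w u → r w u v → D w v) :
    LocImpl act j D fun w => Relation.ReflTransGen (r w) := by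
  refine (Impl.star h fun w _ _ hp hr => hD w _ _ hp (locRel_apply hr)).congr
    (fun _ _ h => h) fun w p _ p' => ⟨fun h => ?_, ?_⟩
  · induction h with
    | refl => exact ⟨p j, .refl, by simp⟩
    | tail _ h ih =>
      obtain ⟨v, hv, rfl⟩ := ih
      obtain ⟨v', hv', rfl⟩ := h
      exact ⟨v', hv.tail (by simpa using hv'), by simp⟩
  · rintro ⟨v, hv, rfl⟩
    induction hv with
    | refl => simpa using Relation.ReflTransGen.refl
    | tail _ h ih => exact ih.tail ⟨_, by simpa using h, by simp⟩

theorem LocImpl.iUnion {κ : Type} [Finite κ] {r : κ → W → ℕ → ℕ → Prop}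
    (h : ∀ i, LocImpl act j D (r i)) : LocImpl act j D fun w u v => ∃ i, r i w u v := by
  refine (Impl.iUnion h).congr (fun _ _ h => h) fun w p _ p' => ⟨?_, ?_⟩
  · rintro ⟨i, v, hv, rfl⟩
    exact ⟨v, ⟨i, hv⟩, rfl⟩
  · rintro ⟨v, ⟨i, hv⟩, rfl⟩
    exact ⟨i, v, hv, rfl⟩

theorem LocImpl.skip : LocImpl act j D fun _ => Eq :=
  Impl.skip.congr (fun _ _ h => h) fun w p _ p' => by simp [locRel, eq_comm]

theorem LocImpl.of_false (h : ∀ w u, D w u → ∀ v, ¬ r w u v) : LocImpl act j D r :=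
  (LocImpl.iUnion (κ := Empty) (r := fun _ _ _ _ => False) (fun i => i.elim)).congr (fun _ _ h => h)
    fun w u hu v => by simpa using h w u hu v

theorem locImpl_hRel {D : List Bool → ℕ → Prop} (S : Set TapeSym) (d : Dir) :
    LocImpl hAct j D fun w => hRel w S d :=
  Impl.act_exact (act := hAct) (j, S, d)

theorem locImpl_cRel {D : List Bool → ℕ → Prop} (a b : Option Bool) (fwd : Bool) :
    LocImpl cAct j D fun w => cRel w a b fwd :=
  Impl.act_exact (act := cAct) (j, a, b, fwd)

end Local

/-! ### Linear and circular tapes simulate each other -/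

theorem reflTransGen_hRel_left {w : List Bool} {u : ℕ} (hu : u ≤ w.length + 1) :
    Relation.ReflTransGen (hRel w univ .left) u 0 := by
  induction u with
  | zero => exact .refl
  | succ u ih => exact .head ⟨trivial, rfl, by omega⟩ (ih (by omega))

theorem reflTransGen_hRel_right {w : List Bool} {u : ℕ} :
    Relation.ReflTransGen (hRel w univ .right) 0 u ↔ u ≤ w.length + 1 := by
  constructor
  · intro h
    rcases h.cases_tail with rfl | ⟨_, -, h⟩
    · exact Nat.zero_le _
    · exact h.2.2
  · induction u with
    | zero => exact fun _ => .refl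
    | succ u ih => exact fun h => (ih (by omega)).tail ⟨trivial, rfl, h⟩

/-- Only a movement between the last position and 0 is not a movement on the linear tape. It is
replaced by a walk along the whole tape: the head moves an arbitrary number of times, and the test
for an end marker that follows lets only the right number pass. Elsewhere a movement and two tests
of symbols suffice. -/
theorem locImpl_cRel_linear {ι : Type} [DecidableEq ι] (j : ι) (a b : Option Bool) (fwd : Bool) :
    LocImpl hAct j (fun w u => u ≤ w.length) fun w => cRel w a b fwd := by
  have A := fun S d => locImpl_hRel (j := j) (D := fun _ _ => True) S d
  rcases fwd with _ | _
  · rcases a with _ | a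
    · refine ((A {.left} .stay).seq (fun _ _ _ _ _ => trivial) (((A univ .right).star
        fun _ _ _ _ _ => trivial).seq (fun _ _ _ _ _ => trivial) ((A {.right} .left).seq
        (fun _ _ _ _ _ => trivial) (A {toTape b} .stay)))).congr (fun _ _ _ => trivial)
        fun w u hu v => ⟨?_, ?_⟩
      · rintro ⟨_, ⟨h1, rfl, -⟩, x, h2, y, ⟨h3, rfl, h4⟩, h5, rfl, -⟩
        have h6 := tapeAt_eq_left.1 (mem_singleton_iff.1 h1)
        have h7 := tapeAt_eq_right.1 (mem_singleton_iff.1 h3)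
        subst h6
        have h8 := reflTransGen_hRel_right.1 h2
        obtain rfl : v = w.length := by omega
        refine ⟨hu, le_rfl, rfl, ?_, by simp [cNext]⟩
        rw [mem_singleton_iff, tapeAt_eq_toTape le_rfl] at h5
        exact toTape_injective h5
      · rintro ⟨-, h1, h2, h3, h4⟩
        obtain rfl := (cSym_eq_none hu).1 h2
        obtain rfl : v = w.length := by
          simp only [cNext, cond_false] at h4
          split at h4 <;> omega
        refine ⟨0, ⟨rfl, rfl, by omega⟩, w.length + 1, reflTransGen_hRel_right.2 le_rfl, w.length,
          ⟨tapeAt_eq_right.2 (by omega), rfl, by omega⟩, ?_, rfl, by omega⟩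
        rw [mem_singleton_iff, tapeAt_eq_toTape le_rfl, h3]
    · refine ((A {.letter a} .left).seq (fun _ _ _ _ _ => trivial) (A {toTape b} .stay)).congr
        (fun _ _ _ => trivial) fun w u hu v => ⟨?_, ?_⟩
      · rintro ⟨x, ⟨h1, rfl, h2⟩, h3, rfl, h4⟩
        have h1 : tapeAt w _ = toTape (some a) := h1
        rw [tapeAt_eq_toTape hu] at h1
        rw [mem_singleton_iff, tapeAt_eq_toTape (by omega)] at h3
        refine ⟨hu, by omega, toTape_injective h1, toTape_injective h3, ?_⟩
        have : v ≠ w.length := by omega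
        simp [cNext, this]
      · rintro ⟨-, h1, h2, h3, h4⟩
        have h5 : u ≠ 0 := fun h => by simp [h, cSym] at h2
        have h4 : u = cNext w.length v := h4
        have h6 : u = v + 1 := by
          unfold cNext at h4
          split at h4 <;> omega
        refine ⟨v, ⟨?_, h6, by omega⟩, ?_, rfl, by omega⟩
        · rw [tapeAt_eq_toTape hu, h2]; rfl
        · rw [tapeAt_eq_toTape h1, h3]; rfl
  · rcases b with _ | b
    · refine ((A {toTape a} .right).seq (fun _ _ _ _ _ => trivial) ((A {.right} .stay).seq
        (fun _ _ _ _ _ => trivial) (((A univ .left).star fun _ _ _ _ _ => trivial).seq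
        (fun _ _ _ _ _ => trivial) (A {.left} .stay)))).congr (fun _ _ _ => trivial)
        fun w u hu v => ⟨?_, ?_⟩
      · rintro ⟨_, ⟨h1, rfl, -⟩, _, ⟨h2, rfl, -⟩, x, -, h3, rfl, -⟩
        obtain rfl := tapeAt_eq_left.1 (mem_singleton_iff.1 h3)
        have h7 := tapeAt_eq_right.1 (mem_singleton_iff.1 h2)
        obtain rfl : u = w.length := by omega
        rw [mem_singleton_iff, tapeAt_eq_toTape hu] at h1
        exact ⟨hu, by omega, toTape_injective h1, rfl, by simp [cNext]⟩
      · rintro ⟨-, h1, h2, h3, h4⟩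
        obtain rfl := (cSym_eq_none h1).1 h3
        obtain rfl : u = w.length := by
          simp only [cNext, cond_true] at h4
          split at h4 <;> omega
        refine ⟨w.length + 1, ⟨?_, rfl, le_rfl⟩, _, ⟨tapeAt_eq_right.2 (by omega), rfl, le_rfl⟩, 0,
          reflTransGen_hRel_left le_rfl, rfl, rfl, by omega⟩
        rw [tapeAt_eq_toTape hu, h2]; rfl
    · refine ((A {toTape a} .right).seq (fun _ _ _ _ _ => trivial) (A {.letter b} .stay)).congr
        (fun _ _ _ => trivial) fun w u hu v => ⟨?_, ?_⟩
      · rintro ⟨x, ⟨h1, rfl, h2⟩, h3, rfl, h4⟩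
        have h3 : tapeAt w _ = toTape (some b) := h3
        have h5 : u + 1 ≤ w.length := by
          by_contra h
          rw [tapeAt_eq_right.2 (by omega)] at h3
          cases h3
        rw [tapeAt_eq_toTape h5] at h3
        rw [mem_singleton_iff, tapeAt_eq_toTape hu] at h1
        have : u ≠ w.length := by omega
        exact ⟨hu, h5, toTape_injective h1, toTape_injective h3, by simp [cNext, this]⟩
      · rintro ⟨-, h1, h2, h3, h4⟩
        have h5 : v ≠ 0 := fun h => by simp [h, cSym] at h3
        have h4 : v = cNext w.length u := h4
        have h6 : v = u + 1 := by
          unfold cNext at h4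
          split at h4 <;> omega
        refine ⟨v, ⟨?_, h6, by omega⟩, ?_, rfl, by omega⟩
        · rw [tapeAt_eq_toTape hu, h2]; rfl
        · rw [tapeAt_eq_toTape h1, h3]; rfl

/-- A program on the circular list is simulated by a program on the linear tape, which first moves
its heads to arbitrary positions. -/
theorem exists_headLang_eq_circLang {ι : Type} [DecidableEq ι] [Finite ι] (M : Prog (CLab ι)) :
    ∃ M' : Prog (HLab ι), headLang M' = circLang M := by
  have := M.finite_state
  let T := {x : M.State × CLab ι × M.State // M.trans x.1 (some x.2.1) x.2.2}
  let T₀ := {x : M.State × M.State // M.trans x.1 none x.2}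
  let src : ι ⊕ Unit ⊕ T ⊕ T₀ → Option M.State
    | .inl _ => none
    | .inr (.inl _) => none
    | .inr (.inr (.inl x)) => some x.1.1
    | .inr (.inr (.inr x)) => some x.1.1
  let dst : ι ⊕ Unit ⊕ T ⊕ T₀ → Option M.State
    | .inl _ => none
    | .inr (.inl _) => some M.start
    | .inr (.inr (.inl x)) => some x.1.2.2
    | .inr (.inr (.inr x)) => some x.1.2
  -- The loops `.inl j` at the initial vertex advance the heads to guessed positions of the circular
  -- list; the edge `.inr (.inl _)` ends this phase.
  let R : ι ⊕ Unit ⊕ T ⊕ T₀ → List Bool → (ι → ℕ) → (ι → ℕ) → Prop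
    | .inl j, w => locRel j fun u v => v = u + 1 ∧ v ≤ w.length
    | .inr (.inl _), _ => Eq
    | .inr (.inr (.inl x)), w => cAct w x.1.2.1
    | .inr (.inr (.inr _)), _ => Eq
  let V : List Bool → (ι → ℕ) → Prop := fun w p => ∀ j, p j ≤ w.length
  have hR : ∀ e, Impl (hSem ι) V (R e) := by
    rintro (j | _ | x | x)
    · have : LocImpl hAct j (fun w u => u ≤ w.length) fun w u v => v = u + 1 ∧ v ≤ w.length := by
        refine ((locImpl_hRel (D := fun _ _ => True) univ .right).seq (fun _ _ _ _ _ => trivial)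
          (locImpl_hRel {.right}ᶜ .stay)).congr (fun _ _ _ => trivial) fun w u hu v => ⟨?_, ?_⟩
        · rintro ⟨_, ⟨-, rfl, h1⟩, h2, rfl, -⟩
          have h2 : ¬ (tapeAt w _ = _) := h2
          rw [tapeAt_eq_right] at h2
          exact ⟨rfl, by omega⟩
        · rintro ⟨rfl, h⟩
          refine ⟨_, ⟨trivial, rfl, by omega⟩, fun h' => ?_, rfl, by omega⟩
          have := tapeAt_eq_right.1 (mem_singleton_iff.1 h')
          omega
      exact this.mono fun w p hp => hp j
    · exact Impl.skip
    · exact (locImpl_cRel_linear x.1.2.1.1 _ _ _).mono fun w p hp => hp _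
    · exact Impl.skip
  have hV : ∀ e w a a', V w a → R e w a a' → V w a' := by
    rintro (j | _ | x | x) w p p' hp h i
    · obtain ⟨v, ⟨-, h1⟩, rfl⟩ := h
      by_cases hi : i = j
      · subst hi; simpa using h1
      · simpa [hi] using hp i
    · have h : p = p' := h
      exact h ▸ hp i
    · obtain ⟨v, h1, rfl⟩ := h
      by_cases hi : i = x.1.2.1.1
      · subst hi; simpa using h1.2.1
      · simpa [hi] using hp i
    · have h : p = p' := h
      exact h ▸ hp i
  obtain ⟨M', hM'⟩ := Impl.graph (src := src) (dst := dst) (V := fun _ => V) hR hV none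
    (some M.final)
  refine ⟨M', ?_⟩
  ext w
  have hV0 : V w fun _ => 0 := fun _ => Nat.zero_le _
  refine (exists_congr fun p => hM'.reach_exact hV0).trans ⟨?_, ?_⟩
  · rintro ⟨p, hp⟩
    suffices ∀ x, Relation.ReflTransGen (GStep src dst fun e => R e w) (none, fun _ => 0) x →
        V w x.2 ∧ ∀ q, x.1 = some q → ∃ p, V w p ∧ M.Reach (cAct w) (M.start, p) (q, x.2) by
      obtain ⟨p', h1, h2⟩ := (this _ hp).2 _ rfl
      exact ⟨p', p, h1, h2⟩
    intro x hx
    induction hx with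
    | refl => exact ⟨hV0, by simp⟩
    | @tail y z _ h ih =>
      obtain ⟨e, h1, h2, h3⟩ := h
      refine ⟨hV e w _ _ ih.1 h3, ?_⟩
      rw [← h2]
      rcases e with j | _ | x | x
      · simp [dst]
      · rintro _ ⟨⟩
        have h3 : y.2 = z.2 := h3
        exact ⟨_, ih.1, h3 ▸ .refl⟩
      · rintro _ ⟨⟩
        obtain ⟨p, h4, h5⟩ := ih.2 _ h1.symm
        exact ⟨p, h4, h5.tail ⟨_, x.2, h3⟩⟩
      · rintro _ ⟨⟩
        obtain ⟨p, h4, h5⟩ := ih.2 _ h1.symm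
        exact ⟨p, h4, h5.tail ⟨_, x.2, h3⟩⟩
  · rintro ⟨p, p', hp, h⟩
    refine ⟨p', .trans (b := (none, p)) ?_ (.head (b := (some M.start, p))
      ⟨.inr (.inl ()), rfl, rfl, rfl⟩ ?_)⟩
    · have := Fintype.ofFinite ι
      -- Any positions are reached by single advances of single heads, by induction on their sum.
      suffices ∀ m, ∀ p : ι → ℕ, ∑ j, p j = m → V w p → Relation.ReflTransGen
          (GStep src dst fun e => R e w) (none, fun _ => 0) (none, p) from this _ p rfl hp
      intro m
      induction m with
      | zero =>
        intro p hm _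
        obtain rfl : p = fun _ => 0 := funext fun j => (by simpa using hm : ∀ j, p j = 0) j
        exact .refl
      | succ m ih =>
        intro p hm hp
        obtain ⟨j, hj⟩ : ∃ j, p j ≠ 0 := by
          by_contra! h
          simp [h] at hm
        have h1 := hp j
        refine (ih (Function.update p j (p j - 1)) ?_ fun i => ?_).tail
          ⟨.inl j, rfl, rfl, p j, ⟨?_, h1⟩, ?_⟩
        · rw [Finset.sum_update_of_mem (Finset.mem_univ j)]
          have := Finset.add_sum_erase _ p (Finset.mem_univ j)
          rw [Finset.sdiff_singleton_eq_erase]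
          omega
        · by_cases hi : i = j
          · subst hi; simp only [Function.update_self]; omega
          · simpa [hi] using hp i
        · simp only [Function.update_self]; omega
        · simp
    · suffices ∀ x y, M.Reach (cAct w) x y → Relation.ReflTransGen (GStep src dst fun e => R e w)
          (some x.1, x.2) (some y.1, y.2) from this _ _ h
      intro x y hxy
      induction hxy with
      | refl => exact .refl
      | @tail y z _ h ih =>
        obtain ⟨_ | l, h1, h2⟩ := h
        · exact ih.tail ⟨.inr (.inr (.inr ⟨(y.1, z.1), h1⟩)), rfl, rfl, h2⟩
        · exact ih.tail ⟨.inr (.inr (.inl ⟨(y.1, l, z.1), h1⟩)), rfl, rfl, h2⟩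

/-- The position on a linear tape that is represented by a position on a circular list and the
information whether the head is on the right end marker. -/
def unfold (n : ℕ) (b : Bool) (u : ℕ) : ℕ := bif b then n + 1 else u

/-- The right end marker is the position 0 with the flag set, so movements between n and n+1 use the
edge between n and 0 of the circle. Unflagged heads that move left or right do not cross this edge,
because the symbol on its far side is required to be a letter. An instruction on the circular list
names both symbols, whence the finite unions over those that fit `S`. Combinations of flags and
direction that no movement realises get the empty union. -/
theorem locImpl_hRel_circular {ι : Type} [DecidableEq ι] (j : ι) (S : Set TapeSym) (d : Dir)
    (b b' : Bool) :
    LocImpl cAct j (fun w u => u ≤ w.length ∧ (b = true → u = 0)) fun w u v =>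
      v ≤ w.length ∧ (b' = true → v = 0) ∧
        hRel w S d (unfold w.length b u) (unfold w.length b' v) := by
  rcases d with _ | _ | _
  · rcases b' with _ | _
    · rcases b with _ | _
      · refine (LocImpl.iUnion (κ := {x : Bool × Option Bool // toTape (some x.1) ∈ S}) fun x =>
          locImpl_cRel (j := j) (D := fun _ _ => True) (some x.1.1) x.1.2 false).congr
          (fun _ _ _ => trivial) fun w u hu v => ⟨?_, ?_⟩
        · rintro ⟨⟨⟨a, b⟩, hS⟩, -, h1, h2, h3, h4⟩
          have h5 : u ≠ 0 := fun h => by simp [h, cSym] at h2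
          simp only [cNext, cond_false] at h4
          refine ⟨h1, by simp, ?_, ?_, by simp [unfold]; omega⟩
          · simpa [unfold, tapeAt_eq_toTape hu.1, h2] using hS
          · simp only [unfold, cond_false, Dir.Moves]
            split at h4 <;> omega
        · rintro ⟨h1, -, h2, h3, h4⟩
          simp only [unfold, cond_false, Dir.Moves] at h2 h3 h4
          subst h3
          rw [tapeAt_eq_toTape hu.1] at h2
          have : w[v]? = some w[v] := by simp
          refine ⟨⟨(w[v], cSym w v), ?_⟩, hu.1, h1, ?_, rfl, ?_⟩
          · simpa [cSym, this] using h2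
          · simp [cSym]
          · have : v ≠ w.length := by omega
            simp [cNext, this]
      · refine (LocImpl.iUnion (κ := {x : Option Bool // TapeSym.right ∈ S}) fun x =>
          locImpl_cRel (j := j) (D := fun _ _ => True) none x.1 false).congr
          (fun _ _ _ => trivial) fun w u hu v => ⟨?_, ?_⟩
        · rintro ⟨⟨b, hS⟩, -, h1, h2, h3, h4⟩
          have h5 : u = 0 := hu.2 rfl
          simp only [cNext, cond_false] at h4
          refine ⟨h1, by simp, ?_, ?_, by simp [unfold]; omega⟩
          · simpa [unfold, tapeAt_eq_right.2 (Nat.lt_succ_self w.length)] using hS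
          · simp only [unfold, cond_false, cond_true, Dir.Moves]
            split at h4 <;> omega
        · rintro ⟨h1, -, h2, h3, h4⟩
          simp only [unfold, cond_false, cond_true, Dir.Moves] at h2 h3 h4
          rw [tapeAt_eq_right.2 (Nat.lt_succ_self w.length)] at h2
          obtain rfl : v = w.length := by omega
          obtain rfl : u = 0 := hu.2 rfl
          exact ⟨⟨cSym w w.length, h2⟩, by omega, h1, rfl, rfl, by simp [cNext]⟩
    · refine LocImpl.of_false ?_
      rintro w u hu v ⟨h1, -, -, h2, h3⟩
      rcases b with _ | _ <;> simp only [unfold, cond_false, cond_true, Dir.Moves] at h2 h3 <;> omega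
  · rcases b with _ | _ <;> rcases b' with _ | _
    -- A head on a circular list cannot stay: it moves forward and back, and its symbol is read on
    -- the way.
    · refine (LocImpl.iUnion (κ := {x : Option Bool × Option Bool // toTape x.1 ∈ S}) fun x =>
          (locImpl_cRel (j := j) (D := fun _ _ => True) x.1.1 x.1.2 true).seq
          (fun _ _ _ _ _ => trivial) (locImpl_cRel (D := fun _ _ => True) x.1.2 x.1.1 false)).congr
          (fun _ _ _ => trivial) fun w u hu v => ⟨?_, ?_⟩
      · rintro ⟨⟨⟨a, b⟩, hS⟩, x, ⟨-, h1, h2, -, h3⟩, -, h4, -, -, h5⟩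
        obtain rfl : v = u := by
          simp only [cNext, cond_false, cond_true] at h3 h5
          split at h3 <;> split at h5 <;> omega
        refine ⟨h4, by simp, ?_, rfl, by simp [unfold]; omega⟩
        simpa [unfold, tapeAt_eq_toTape hu.1, h2] using hS
      · rintro ⟨h1, -, h2, h3, -⟩
        simp only [unfold, cond_false, Dir.Moves] at h2 h3
        subst h3
        rw [tapeAt_eq_toTape h1] at h2
        have : cNext w.length v ≤ w.length := by unfold cNext; split <;> omega
        exact ⟨⟨(cSym w v, cSym w (cNext w.length v)), h2⟩, cNext w.length v,
          ⟨h1, this, rfl, rfl, rfl⟩, this, h1, rfl, rfl, rfl⟩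
    · refine LocImpl.of_false ?_
      rintro w u hu v ⟨h1, -, -, h2, h3⟩
      simp only [unfold, cond_false, cond_true, Dir.Moves] at h2 h3; omega
    · refine LocImpl.of_false ?_
      rintro w u hu v ⟨h1, -, -, h2, h3⟩
      simp only [unfold, cond_false, cond_true, Dir.Moves] at h2 h3; omega
    -- Whether `S` contains the right end marker does not depend on the configuration, so the test
    -- is decided when the program is built and no movement is needed.
    · refine (LocImpl.iUnion (κ := {x : Unit // TapeSym.right ∈ S}) fun x =>
          (LocImpl.skip (D := fun _ _ => True))).congr (fun _ _ _ => trivial)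
          fun w u hu v => ⟨?_, ?_⟩
      · rintro ⟨⟨-, hS⟩, rfl⟩
        refine ⟨hu.1, hu.2, ?_, rfl, le_rfl⟩
        simpa [unfold, tapeAt_eq_right.2 (Nat.lt_succ_self w.length)] using hS
      · rintro ⟨h1, h2, h3, -⟩
        simp only [unfold, cond_true, tapeAt_eq_right.2 (Nat.lt_succ_self w.length)] at h3
        exact ⟨⟨(), h3⟩, (hu.2 rfl).trans (h2 rfl).symm⟩
  · rcases b with _ | _
    · rcases b' with _ | _
      · refine (LocImpl.iUnion (κ := {x : Option Bool × Bool // toTape x.1 ∈ S}) fun x =>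
          locImpl_cRel (j := j) (D := fun _ _ => True) x.1.1 (some x.1.2) true).congr
          (fun _ _ _ => trivial) fun w u hu v => ⟨?_, ?_⟩
        · rintro ⟨⟨⟨a, b⟩, hS⟩, -, h1, h2, h3, h4⟩
          have h5 : v ≠ 0 := fun h => by simp [h, cSym] at h3
          simp only [cNext, cond_true] at h4
          refine ⟨h1, by simp, ?_, ?_, by simp [unfold]; omega⟩
          · simpa [unfold, tapeAt_eq_toTape hu.1, h2] using hS
          · simp only [unfold, cond_false, Dir.Moves]
            split at h4 <;> omega
        · rintro ⟨h1, -, h2, h3, h4⟩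
          simp only [unfold, cond_false, Dir.Moves] at h2 h3 h4
          subst h3
          rw [tapeAt_eq_toTape hu.1] at h2
          refine ⟨⟨(cSym w u, w[u]), h2⟩, hu.1, h1, rfl, ?_, ?_⟩
          · simp [cSym]
          · have : u ≠ w.length := by omega
            simp [cNext, this]
      · refine (LocImpl.iUnion (κ := {x : Option Bool // toTape x ∈ S}) fun x =>
          locImpl_cRel (j := j) (D := fun _ _ => True) x.1 none true).congr
          (fun _ _ _ => trivial) fun w u hu v => ⟨?_, ?_⟩
        · rintro ⟨⟨a, hS⟩, -, h1, h2, h3, h4⟩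
          have h5 := (cSym_eq_none h1).1 h3
          simp only [cNext, cond_true] at h4
          refine ⟨h1, fun _ => h5, ?_, ?_, by simp [unfold]⟩
          · simpa [unfold, tapeAt_eq_toTape hu.1, h2] using hS
          · simp only [unfold, cond_false, cond_true, Dir.Moves]
            split at h4 <;> omega
        · rintro ⟨h1, h5, h2, h3, h4⟩
          simp only [unfold, cond_false, cond_true, Dir.Moves] at h2 h3 h4
          obtain rfl : u = w.length := by omega
          obtain rfl := h5 rfl
          rw [tapeAt_eq_toTape hu.1] at h2
          exact ⟨⟨cSym w w.length, h2⟩, le_rfl, h1, rfl, rfl, by simp [cNext]⟩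
    · refine LocImpl.of_false ?_
      rintro w u hu v ⟨h1, -, -, h2, h3⟩
      rcases b' with _ | _ <;> simp only [unfold, cond_false, cond_true, Dir.Moves] at h2 h3 <;> omega

/-- A program on the linear tape is simulated by a program on the circular list, which records in
its state which heads are on the right end marker. -/
theorem exists_circular {ι : Type} [DecidableEq ι] [Finite ι] (M : Prog (HLab ι)) :
    ∃ M' : Prog (CLab ι), ∀ w p, (∀ j, p j ≤ w.length) →
      ((∃ p', M'.Reach (cAct w) (M'.start, p) (M'.final, p')) ↔
        ∃ p', M.Reach (hAct w) (M.start, p) (M.final, p')) := by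
  have := M.finite_state
  let T := {x : M.State × HLab ι × M.State // M.trans x.1 (some x.2.1) x.2.2}
  let T₀ := {x : M.State × M.State // M.trans x.1 none x.2}
  -- The Boolean next to a transition is the guess whether the moved head arrives on the right end
  -- marker; the function `ι → Bool` holds the flags of all heads.
  let E := ((T × Bool) ⊕ T₀ ⊕ Unit) × (ι → Bool)
  let S := Option (M.State × (ι → Bool))
  let src : E → S
    | (.inl (x, _), β) => some (x.1.1, β)
    | (.inr (.inl x), β) => some (x.1.1, β)
    | (.inr (.inr _), β) => some (M.final, β)
  let dst : E → S
    | (.inl (x, b), β) => some (x.1.2.2, Function.update β x.1.2.1.1 b)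
    | (.inr (.inl x), β) => some (x.1.2, β)
    | (.inr (.inr _), _) => none
  let R : E → List Bool → (ι → ℕ) → (ι → ℕ) → Prop
    | (.inl (x, b), β), w => locRel x.1.2.1.1 fun u v => v ≤ w.length ∧ (b = true → v = 0) ∧
        hRel w x.1.2.1.2.1 x.1.2.1.2.2 (unfold w.length (β x.1.2.1.1) u) (unfold w.length b v)
    | (.inr _, _), _ => Eq
  let V : S → List Bool → (ι → ℕ) → Prop := fun s w p =>
    ∀ x, s = some x → ∀ j, p j ≤ w.length ∧ (x.2 j = true → p j = 0)
  have hR : ∀ e, Impl (cSem ι) (V (src e)) (R e) := by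
    rintro ⟨⟨x, b⟩ | x | x, β⟩
    · exact (locImpl_hRel_circular x.1.2.1.1 x.1.2.1.2.1 x.1.2.1.2.2 (β x.1.2.1.1) b).mono
        fun w p hp => hp _ rfl x.1.2.1.1
    · exact Impl.skip
    · exact Impl.skip
  have hV : ∀ e w a a', V (src e) w a → R e w a a' → V (dst e) w a' := by
    rintro ⟨⟨x, b⟩ | x | x, β⟩ w p p' hp h y hy i
    · obtain rfl := Option.some.inj hy
      obtain ⟨v, ⟨h1, h2, -⟩, rfl⟩ := h
      by_cases hi : i = x.1.2.1.1
      · subst hi; simpa using ⟨h1, h2⟩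
      · simpa [hi] using hp _ rfl i
    · obtain rfl := Option.some.inj hy
      have h : p = p' := h
      exact h ▸ hp _ rfl i
    · cases hy
  obtain ⟨M', hM'⟩ := Impl.graph (src := src) (dst := dst) (V := V) hR hV
    (some (M.start, fun _ => false)) none
  refine ⟨M', fun w p hp => ?_⟩
  have hV0 : V (some (M.start, fun _ => false)) w p := by
    rintro _ ⟨⟩ j
    exact ⟨hp j, by simp⟩
  refine (exists_congr fun p' => hM'.reach_exact hV0).trans ⟨?_, ?_⟩
  · rintro ⟨p', h⟩
    suffices ∀ x, Relation.ReflTransGen (GStep src dst fun e => R e w)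
        (some (M.start, fun _ => false), p) x →
        match x with
        | (none, _) => ∃ p', M.Reach (hAct w) (M.start, p) (M.final, p')
        | (some (q, β), p') => M.Reach (hAct w) (M.start, p)
            (q, fun j => unfold w.length (β j) (p' j)) from this _ h
    intro x hx
    induction hx with
    | refl => exact .refl
    | @tail y z _ hs ih =>
      obtain ⟨y, p₁⟩ := y
      obtain ⟨z, p₂⟩ := z
      obtain ⟨⟨⟨x, b⟩ | x | x, β⟩, rfl, rfl, hs⟩ := hs
      · obtain ⟨v, ⟨-, -, h1⟩, h2⟩ := hs
        obtain rfl : p₂ = Function.update p₁ x.1.2.1.1 v := h2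
        refine ih.tail ⟨_, x.2, _, h1, funext fun i => ?_⟩
        simp only
        by_cases hi : i = x.1.2.1.1
        · subst hi; simp
        · simp [hi]
      · have hs : p₁ = p₂ := hs
        exact ih.tail ⟨_, x.2, by rw [hs]; rfl⟩
      · exact ⟨_, ih⟩
  · rintro ⟨p', h⟩
    suffices ∀ x, M.Reach (hAct w) (M.start, p) x → ∃ β p', x.2 = (fun j =>
        unfold w.length (β j) (p' j)) ∧ V (some (x.1, β)) w p' ∧ Relation.ReflTransGen
        (GStep src dst fun e => R e w) (some (M.start, fun _ => false), p) (some (x.1, β), p') by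
      obtain ⟨β, p₁, -, -, h2⟩ := this _ h
      exact ⟨p₁, h2.tail ⟨(.inr (.inr ()), β), rfl, rfl, rfl⟩⟩
    intro x hx
    induction hx with
    | refl => exact ⟨_, p, rfl, hV0, .refl⟩
    | @tail y z _ hs ih =>
      obtain ⟨β, p₁, h1, h2, h3⟩ := ih
      obtain ⟨_ | ⟨j, S, d⟩, h4, h5⟩ := hs
      · have h5 : y.2 = z.2 := h5
        refine ⟨β, p₁, h5 ▸ h1, ?_, h3.tail ⟨(.inr (.inl ⟨(y.1, z.1), h4⟩), β), rfl, rfl, rfl⟩⟩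
        rintro _ ⟨⟩
        exact h2 (y.1, β) rfl
      · obtain ⟨v, h5, h6⟩ := h5
        obtain ⟨b, u, rfl, h7, h8⟩ : ∃ b u, v = unfold w.length b u ∧ u ≤ w.length ∧
            (b = true → u = 0) := by
          by_cases hv : v = w.length + 1
          · exact ⟨true, 0, hv, Nat.zero_le _, fun _ => rfl⟩
          · exact ⟨false, v, rfl, by have := h5.2.2; omega, by simp⟩
        have hs : R (.inl (⟨(y.1, (j, S, d), z.1), h4⟩, b), β) w p₁ (Function.update p₁ j u) := by
          refine ⟨u, ⟨h7, h8, ?_⟩, rfl⟩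
          simpa only [h1] using h5
        refine ⟨Function.update β j b, Function.update p₁ j u, ?_, ?_,
          h3.tail ⟨(.inl (⟨(y.1, (j, S, d), z.1), h4⟩, b), β), rfl, rfl, hs⟩⟩
        · rw [h6, h1]
          funext i
          by_cases hi : i = j
          · subst hi; simp
          · simp [hi]
        · exact hV (.inl (⟨(y.1, (j, S, d), z.1), h4⟩, b), β) w _ _ h2 hs

/-! ## Returning to a point by address maps -/

/-- The point `x` is the image of `y` under a translation and an address map. -/
def Returns (x y : Space) : Prop := ∃ k l, x = transl k (addressMap l y)

theorem addressMap_append (l l' : List (ℕ ⊕ ℕ)) (x : Space) :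
    addressMap (l ++ l') x = addressMap l (addressMap l' x) := by
  simp only [addressMap, List.map_append, List.prod_append]
  rfl

@[simp]
theorem addressMap_nil (x : Space) : addressMap [] x = x := rfl

theorem addressMap_cons (a : ℕ ⊕ ℕ) (l : List (ℕ ⊕ ℕ)) (x : Space) :
    addressMap (a :: l) x =
      (Sum.elim (fun n : ℕ => rotate (1 / (n + 1))) swap a : Function.End Space)
        (addressMap l x) := rfl

theorem addressMap_transl (l : List (ℕ ⊕ ℕ)) (k : ℤ) (x : Space) :
    addressMap l (transl k x) = transl k (addressMap l x) := by
  induction l with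
  | nil => rfl
  | cons a l ih =>
    rw [addressMap_cons, addressMap_cons, ih]
    cases a <;> rfl

theorem Returns.trans {x y z : Space} (h : Returns x y) (h' : Returns y z) : Returns x z := by
  obtain ⟨k, l, rfl⟩ := h
  obtain ⟨k', l', rfl⟩ := h'
  refine ⟨k + k', l ++ l', ?_⟩
  rw [addressMap_transl, addressMap_append]
  refine Prod.ext ?_ rfl
  simp only [transl]; ring

theorem Returns.refl (x : Space) : Returns x x := ⟨0, [], by simp [transl]⟩

theorem returns_transl (k : ℤ) (x : Space) : Returns x (transl k x) :=
  ⟨-k, [], by simp [transl]⟩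

theorem returns_swap (j : ℕ) (x : Space) : Returns x (swap j x) :=
  ⟨0, [.inr j], by simp [transl, addressMap_cons, swap]⟩

/-- The generators are invertible by means of the test: exchanges of coordinates are involutions,
and translations commute with address maps, so that they collect into a single one. This is why Γ
contains every s_j. -/
theorem returns_microcosm {i : ℕ∞} {f : Function.End Space} (hf : f ∈ microcosm i) (x : Space) :
    Returns x (f x) := by
  induction hf using Submonoid.closure_induction generalizing x with
  | mem f hf =>
    obtain ⟨k, rfl⟩ | ⟨j, -, rfl⟩ := hf
    · exact returns_transl k x
    · exact returns_swap j x
  | one => exact .refl x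
  | mul f g _ _ hf hg => exact (hg x).trans (hf (g x))

theorem rot_add (r s : ℝ) (x : unitInterval) : rot r (rot s x) = rot (s + r) x := by
  by_cases hx : x = 1
  · simp [rot, hx]
  · have h2 : (⟨Int.fract ((x : ℝ) + s), Int.fract_nonneg _, (Int.fract_lt_one _).le⟩ :
        unitInterval) ≠ 1 := fun h =>
      (Int.fract_lt_one ((x : ℝ) + s)).ne (congrArg Subtype.val h)
    simp only [rot, hx, if_false, h2]
    apply Subtype.ext
    change Int.fract (Int.fract ((x : ℝ) + s) + r) = Int.fract (x + (s + r))
    rw [Int.fract_eq_fract]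
    exact ⟨-⌊(x : ℝ) + s⌋, by rw [Int.fract]; push_cast; ring⟩

theorem rotate_add (r s : ℝ) (x : Space) : rotate r (rotate s x) = rotate (s + r) x := by
  refine Prod.ext rfl (funext fun l => ?_)
  by_cases hl : l = 0
  · simpa [rotate, hl] using rot_add r s (x.2 0)
  · simp [rotate, hl]

theorem rotate_int (m : ℤ) (x : Space) : rotate m x = x := by
  refine Prod.ext rfl (funext fun l => ?_)
  by_cases hl : l = 0
  · subst hl
    have h : ∀ y : unitInterval, rot m y = y := by
      intro y
      unfold rot
      split_ifs with hy
      · exact hy.symm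
      · have h1 : (y : ℝ) < 1 := lt_of_le_of_ne y.2.2 (fun h => hy (Subtype.ext h))
        apply Subtype.ext
        change Int.fract ((y : ℝ) + m) = y
        rw [Int.fract_add_intCast, Int.fract_eq_self.2 ⟨y.2.1, h1⟩]
    simp [rotate, h]
  · simp [rotate, hl]

theorem addressMap_replicate (n m : ℕ) (x : Space) :
    addressMap (List.replicate m (.inl n)) x = rotate (m * (1 / (n + 1))) x := by
  induction m with
  | zero =>
    have := rotate_int 0 x
    simpa using this.symm
  | succ m ih =>
    rw [List.replicate_succ, addressMap_cons, ih]
    refine (rotate_add _ _ x).trans ?_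
    congr 1
    push_cast; ring

/-- A rotation by 1/(n+1) has order n+1, so n further rotations undo it; Γ therefore needs no
rotations by negative angles. -/
theorem returns_rotate (n : ℕ) (x : Space) : Returns x (rotate (1 / (n + 1)) x) := by
  refine ⟨0, List.replicate n (.inl n), ?_⟩
  rw [addressMap_replicate, rotate_add]
  have h : (1 / (n + 1) + n * (1 / (n + 1)) : ℝ) = ((1 : ℤ) : ℝ) := by
    have : (n : ℝ) + 1 ≠ 0 := by positivity
    field_simp
    push_cast; ring
  rw [h, rotate_int]
  simp [transl]

theorem returns_rotate_neg (n : ℕ) (x : Space) : Returns x (rotate (-(1 / (n + 1))) x) := by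
  refine ⟨0, [.inl n], ?_⟩
  have : addressMap [.inl n] (rotate (-(1 / (n + 1))) x) = x := by
    refine (rotate_add _ _ x).trans ?_
    have := rotate_int 0 x
    simpa using this
  rw [this]
  simp [transl]

/-- Γ contains the rotations by 1/m for all m because one and the same test has to return along the
edges of words of every length. -/
theorem returns_expWord {w : List Bool} {x y : Space} (h : (expWord w).Step x y) :
    Returns x y := by
  obtain ⟨⟨q, p, _ | _⟩, -, rfl⟩ := h
  · exact (returns_rotate_neg w.length x).trans (returns_transl _ _)
  · exact (returns_rotate w.length x).trans (returns_transl _ _)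

/-! ## Alternating paths -/

namespace Graphing

/-- Alternately follow an edge of `F` (phase `false`) and an edge of `G` (phase `true`). -/
def PhaseStep (F G : Graphing) (a b : Bool × Space) : Prop :=
  b.1 = !a.1 ∧ bif a.1 then G.Step a.2 b.2 else F.Step a.2 b.2

theorem phaseStep_edge (F G : Graphing) (e : F.Edge ⊕ G.Edge) (x : Space)
    (hx : x ∈ edgeSource F G e) :
    PhaseStep F G (e.isRight, x) (!e.isRight, edgeMap F G e x) := by
  rcases e with e | e
  · exact ⟨rfl, e, hx, rfl⟩
  · exact ⟨rfl, e, hx, rfl⟩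

theorem transGen_of_path (F G : Graphing) (e : F.Edge ⊕ G.Edge) (l : List (F.Edge ⊕ G.Edge))
    (hl : (e :: l).IsChain fun a b => a.isLeft ≠ b.isLeft) (x : Space)
    (hx : x ∈ pathDom F G (e :: l)) :
    ∃ b, Relation.TransGen (PhaseStep F G) (e.isRight, x) (b, pathMap F G (e :: l) x) := by
  induction l generalizing e x with
  | nil => exact ⟨_, .single (phaseStep_edge F G e x hx.1)⟩
  | cons e' l ih =>
    obtain ⟨h1, h2⟩ := List.isChain_cons_cons.1 hl
    obtain ⟨b, hb⟩ := ih e' h2 _ hx.2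
    refine ⟨b, .head (phaseStep_edge F G e x hx.1) ?_⟩
    have : (!e.isRight) = e'.isRight := by cases e <;> cases e' <;> simp_all
    rw [this]; exact hb

theorem exists_path (F G : Graphing) {a b : Bool × Space}
    (h : Relation.TransGen (PhaseStep F G) a b) :
    ∃ e l, (e :: l).IsChain (fun a b => a.isLeft ≠ b.isLeft) ∧ e.isRight = a.1 ∧
      a.2 ∈ pathDom F G (e :: l) ∧ pathMap F G (e :: l) a.2 = b.2 := by
  have key : ∀ a b : Bool × Space, PhaseStep F G a b → ∃ e : F.Edge ⊕ G.Edge, e.isRight = a.1 ∧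
      a.2 ∈ edgeSource F G e ∧ edgeMap F G e a.2 = b.2 := by
    rintro ⟨_ | _, x⟩ b ⟨-, e, h1, h2⟩
    · exact ⟨.inl e, rfl, h1, h2⟩
    · exact ⟨.inr e, rfl, h1, h2⟩
  induction h using Relation.TransGen.head_induction_on with
  | single h =>
    obtain ⟨e, h1, h2, h3⟩ := key _ _ h
    exact ⟨e, [], by simp, h1, ⟨h2, trivial⟩, h3⟩
  | @head a c h _ ih =>
    obtain ⟨e, h1, h2, h3⟩ := key _ _ h
    obtain ⟨e', l, h4, h5, h6, h7⟩ := ih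
    refine ⟨e, e' :: l, List.isChain_cons_cons.2 ⟨?_, h4⟩, h1, ⟨h2, ?_⟩, ?_⟩
    · have : e'.isRight = !e.isRight := by rw [h5, h.1, h1]
      cases e <;> cases e' <;> simp_all
    · change edgeMap F G e a.2 ∈ pathDom F G (e' :: l)
      rw [h3]; exact h6
    · change pathMap F G (e' :: l) (edgeMap F G e a.2) = _
      rw [h3]; exact h7

theorem Step.mem_carrier {F : Graphing} {x y : Space} (h : F.Step x y) : x ∈ F.carrier := by
  obtain ⟨e, h, -⟩ := h
  exact F.source_subset e h

theorem Step.mem_carrier_right {F : Graphing} {x y : Space} (h : F.Step x y) : y ∈ F.carrier := by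
  obtain ⟨e, h, rfl⟩ := h
  exact F.target_subset e ⟨x, h, rfl⟩

end Graphing

theorem disjoint_carriers {x : Space} (hx : x ∈ boolCarrier) : x ∉ listCarrier := by
  intro h
  simp only [boolCarrier, listCarrier, mem_ofPred_eq, acc, rej] at hx h
  omega

open scoped symmDiff in
theorem symmDiff_carriers : (listCarrier ∪ boolCarrier) ∆ listCarrier = boolCarrier := by
  ext x
  have := @disjoint_carriers x
  simp only [mem_symmDiff, mem_union]
  by_cases h : x ∈ boolCarrier <;> simp [h, this]

-- The carriers of words and of booleans are disjoint. A path that begins and ends at boolean points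
-- must therefore begin and end with an edge of `P`, which fixes the phases: `false` before the
-- first edge and `true` after the last one.
open Graphing in
theorem exec_step_iff {P : Graphing} (hP : P.carrier = listCarrier ∪ boolCarrier) (w : List Bool)
    {x y : Space} : (exec P (expWord w)).Step x y ↔ x ∈ boolCarrier ∧ y ∈ boolCarrier ∧
      Relation.TransGen (PhaseStep P (expWord w)) (false, x) (true, y) := by
  have hc : (exec P (expWord w)).carrier = boolCarrier := by
    rw [← symmDiff_carriers, ← hP]; rfl
  constructor
  · intro h
    have hx := hc ▸ h.mem_carrier
    have hy := hc ▸ h.mem_carrier_right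
    obtain ⟨⟨l, hl, hl'⟩, ⟨h1, -⟩, rfl⟩ := h
    obtain ⟨e, l, rfl⟩ := List.exists_cons_of_ne_nil hl
    obtain ⟨b, hb⟩ := transGen_of_path _ _ e l hl' x h1
    have he : e.isRight = false := by
      rcases e with e | e
      · rfl
      · exact absurd ((expWord w).source_subset e h1.1) (disjoint_carriers hx)
    have hb' : b = true := by
      obtain ⟨⟨c, z⟩, -, h2, h3⟩ := Relation.TransGen.tail'_iff.1 hb
      rcases c with _ | _
      · exact h2
      · exact absurd h3.mem_carrier_right (disjoint_carriers hy)
    rw [he, hb'] at hb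
    exact ⟨hx, hy, hb⟩
  · rintro ⟨hx, hy, h⟩
    obtain ⟨e, l, h1, -, h3, h4⟩ := exists_path _ _ h
    refine ⟨⟨e :: l, by simp, h1⟩, ⟨h3, ?_, ?_⟩, h4⟩
    · change x ∈ (exec P (expWord w)).carrier
      rw [hc]; exact hx
    · change pathMap _ _ _ x ∈ (exec P (expWord w)).carrier
      rw [hc, h4]; exact hy

/-! ## Discretisation -/

/-- A description of the edges of a graphing in terms of the numbers of the cells and of the first
`k + 1` coordinates of the cube. -/
structure CellData (P : Graphing) (k : ℕ) where
  cells : P.Edge → Finset ℤ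
  shift : P.Edge → ℤ
  perm : P.Edge → Equiv.Perm (Fin (k + 1))
  mem_source : ∀ e x, x ∈ P.source e ↔ x.1 ∈ cells e
  map_fst : ∀ e, ∀ x ∈ P.source e, (P.map e x).1 = x.1 + shift e
  map_snd : ∀ e, ∀ x ∈ P.source e, ∀ j : Fin (k + 1), (P.map e x).2 j = x.2 (perm e j)

/-- The cell of a point, and the numbers of the pieces of the unit interval that contain its first
`k + 1` coordinates. -/
def disc (w : List Bool) (k : ℕ) (x : Space) : ℤ × (Fin (k + 1) → ℕ) :=
  (x.1, fun j => ⌊((w.length : ℝ) + 1) * (x.2 j : ℝ)⌋₊)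

/-- The discretisation of the edges of the representation of a word. -/
def WordStep (w : List Bool) {k : ℕ} (c c' : ℤ × (Fin (k + 1) → ℕ)) : Prop :=
  ∃ q a b fwd, c.1 = vertex q a fwd ∧ c'.1 = vertex q b (!fwd) ∧
    locRel 0 (cRel w a b fwd) c.2 c'.2

/-- The discretisation of the edges of a graphing. -/
def CellData.Step {P : Graphing} {k : ℕ} (D : CellData P k) (c c' : ℤ × (Fin (k + 1) → ℕ)) : Prop :=
  ∃ e, c.1 ∈ D.cells e ∧ c'.1 = c.1 + D.shift e ∧ ∀ j, c'.2 j = c.2 (D.perm e j)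

/-- Alternating steps of the discretisations. -/
def CellData.PhaseStep {P : Graphing} {k : ℕ} (D : CellData P k) (w : List Bool)
    (a b : Bool × ℤ × (Fin (k + 1) → ℕ)) : Prop :=
  b.1 = !a.1 ∧ bif a.1 then WordStep w a.2 b.2 else D.Step a.2 b.2

theorem CellData.step_disc {P : Graphing} {k : ℕ} (D : CellData P k) (w : List Bool) {x y : Space}
    (h : P.Step x y) : D.Step (disc w k x) (disc w k y) := by
  obtain ⟨e, h, rfl⟩ := h
  exact ⟨e, (D.mem_source e x).1 h, D.map_fst e x h, fun j => by simp [disc, D.map_snd e x h]⟩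

theorem CellData.exists_step {P : Graphing} {k : ℕ} (D : CellData P k) (w : List Bool) {x : Space}
    {c : ℤ × (Fin (k + 1) → ℕ)} (h : D.Step (disc w k x) c) : ∃ y, P.Step x y ∧ disc w k y = c := by
  obtain ⟨e, h1, h2, h3⟩ := h
  have hx := (D.mem_source e x).2 h1
  exact ⟨P.map e x, ⟨e, hx, rfl⟩, Prod.ext ((D.map_fst e x hx).trans h2.symm)
    (funext fun j => by simp [disc, D.map_snd e x hx, h3])⟩

/-! ### The edges of a word move the first coordinate from piece to piece -/

theorem cSym_eq_symbols (w : List Bool) (p : Fin (w.length + 1)) : cSym w p = symbols w p := by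
  refine Fin.cases rfl (fun j => ?_) p
  simp [cSym, symbols]

theorem val_add_one_eq_cNext {n : ℕ} (p : Fin (n + 1)) : ((p + 1 : Fin (n + 1)) : ℕ) = cNext n p := by
  rw [Fin.val_add_one, cNext]
  simp [Fin.ext_iff]

theorem mem_piece_iff {w : List Bool} {n : ℤ} {p : ℕ} {x : Space} :
    x ∈ piece (w.length + 1) n p ↔ x.1 = n ∧ ⌊((w.length : ℝ) + 1) * (x.2 0 : ℝ)⌋₊ = p := by
  have h : (0 : ℝ) < (w.length : ℝ) + 1 := by positivity
  have h1 : (0 : ℝ) ≤ x.2 0 := (x.2 0).2.1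
  rw [Nat.floor_eq_iff (by positivity)]
  change (_ ∧ _ ∧ _) ↔ _
  push_cast
  rw [div_le_iff₀ h, lt_div_iff₀ h, mul_comm]

/-- From the last piece the sum exceeds 1 and the fractional part leads back to the first one. The
bound `hu` excludes the endpoint 1, whose floor would be n+1 and which the rotation fixes. -/
theorem floor_rot {n u : ℕ} {x : unitInterval} (hx : ⌊((n : ℝ) + 1) * (x : ℝ)⌋₊ = u) (hu : u ≤ n) :
    ⌊((n : ℝ) + 1) * (rot (1 / (n + 1)) x : ℝ)⌋₊ = cNext n u := by
  have h : (0 : ℝ) < (n : ℝ) + 1 := by positivity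
  have h0 : (0 : ℝ) ≤ x := x.2.1
  rw [Nat.floor_eq_iff (by positivity)] at hx
  have hu' : (u : ℝ) ≤ n := by exact_mod_cast hu
  have h1 : (x : ℝ) < 1 := by nlinarith
  have hx1 : x ≠ 1 := fun h => by simp [h] at h1
  have h2 : ((n : ℝ) + 1) * (1 / (n + 1)) = 1 := by field_simp
  have h3 : (0 : ℝ) < 1 / ((n : ℝ) + 1) := by positivity
  rw [Nat.floor_eq_iff (mul_nonneg h.le (rot _ x).2.1), rot, if_neg hx1]
  unfold cNext
  split_ifs with hn
  · subst hn
    have : Int.fract ((x : ℝ) + 1 / (u + 1)) = x + 1 / (u + 1) - 1 := by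
      rw [Int.fract_eq_iff]
      refine ⟨by nlinarith, by nlinarith, 1, by push_cast; ring⟩
    simp only [this]
    push_cast
    constructor <;> nlinarith
  · have hn : (u : ℝ) + 1 ≤ n := by exact_mod_cast (by omega : u + 1 ≤ n)
    have : Int.fract ((x : ℝ) + 1 / (n + 1)) = x + 1 / (n + 1) := by
      rw [Int.fract_eq_self]
      refine ⟨by positivity, by nlinarith⟩
    simp only [this]
    push_cast
    constructor <;> nlinarith

theorem floor_rot_neg {n v : ℕ} {x : unitInterval}
    (hx : ⌊((n : ℝ) + 1) * (x : ℝ)⌋₊ = cNext n v) (hv : v ≤ n) :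
    ⌊((n : ℝ) + 1) * (rot (-(1 / (n + 1))) x : ℝ)⌋₊ = v := by
  have h : (0 : ℝ) < (n : ℝ) + 1 := by positivity
  have h0 : (0 : ℝ) ≤ x := x.2.1
  rw [Nat.floor_eq_iff (by positivity)] at hx
  have hv' : (v : ℝ) ≤ n := by exact_mod_cast hv
  have h2 : ((n : ℝ) + 1) * (1 / (n + 1)) = 1 := by field_simp
  have h3 : (0 : ℝ) < 1 / ((n : ℝ) + 1) := by positivity
  have hc : cNext n v ≤ n := by unfold cNext; split <;> omega
  have hc : ((cNext n v : ℕ) : ℝ) ≤ n := by exact_mod_cast hc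
  have h1 : (x : ℝ) < 1 := by nlinarith
  have hx1 : x ≠ 1 := fun h => by simp [h] at h1
  rw [Nat.floor_eq_iff (mul_nonneg h.le (rot _ x).2.1), rot, if_neg hx1]
  unfold cNext at hx
  split_ifs at hx with hn
  · subst hn
    push_cast at hx
    have : Int.fract ((x : ℝ) + -(1 / (v + 1))) = x + -(1 / (v + 1)) + 1 := by
      rw [Int.fract_eq_iff]
      refine ⟨by nlinarith, by nlinarith, -1, by push_cast; ring⟩
    simp only [this]
    constructor <;> nlinarith
  · push_cast at hx
    have : Int.fract ((x : ℝ) + -(1 / (n + 1))) = x + -(1 / (n + 1)) := by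
      rw [Int.fract_eq_self]
      refine ⟨by nlinarith, by nlinarith⟩
    simp only [this]
    constructor <;> nlinarith

theorem disc_transl_rotate (w : List Bool) (k : ℕ) (m : ℤ) (r : ℝ) (x : Space) :
    disc w k (transl m (rotate r x)) = (x.1 + m, Function.update (disc w k x).2 0
      ⌊((w.length : ℝ) + 1) * (rot r (x.2 0) : ℝ)⌋₊) := by
  refine Prod.ext rfl (funext fun j => ?_)
  by_cases hj : j = 0
  · subst hj; simp [disc, transl, rotate]
  · have : (j : ℕ) ≠ 0 := fun h => hj (Fin.ext h)
    simp [disc, transl, rotate, hj]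

theorem wordStep_disc {w : List Bool} {k : ℕ} {x y : Space} (h : (expWord w).Step x y) :
    WordStep w (disc w k x) (disc w k y) := by
  obtain ⟨⟨q, p, _ | _⟩, h, rfl⟩ := h
  · obtain ⟨h1, h2⟩ := mem_piece_iff.1 h
    have h4 : cSym w (cNext w.length p) = symbols w (p + 1) := by
      rw [← cSym_eq_symbols, val_add_one_eq_cNext]
    rw [val_add_one_eq_cNext] at h2
    refine ⟨q, symbols w (p + 1), symbols w p, false, h1, ?_, ?_⟩
    · change x.1 + (_ - _) = _
      rw [h1]; simp
    · refine ⟨p, ⟨?_, by omega, ?_, cSym_eq_symbols w p, h2⟩, ?_⟩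
      · change ⌊_⌋₊ ≤ _
        simp only [Fin.val_zero, h2, cNext]
        have := p.2
        split <;> omega
      · change cSym w ⌊_⌋₊ = _
        rw [Fin.val_zero, h2, h4]
      · rw [← floor_rot_neg h2 (by omega)]
        exact congrArg Prod.snd (disc_transl_rotate w k _ _ x)
  · obtain ⟨h1, h2⟩ := mem_piece_iff.1 h
    refine ⟨q, symbols w p, symbols w (p + 1), true, h1, ?_, ?_⟩
    · change x.1 + (_ - _) = _
      rw [h1]; simp
    · refine ⟨(p + 1 : Fin _), ⟨?_, Nat.le_of_lt_succ (p + 1).2, ?_, cSym_eq_symbols w _, ?_⟩, ?_⟩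
      · change ⌊_⌋₊ ≤ _
        simp only [Fin.val_zero, h2]
        omega
      · change cSym w ⌊_⌋₊ = _
        rw [Fin.val_zero, h2, cSym_eq_symbols]
      · change _ = cNext _ ⌊_⌋₊
        rw [Fin.val_zero, h2, val_add_one_eq_cNext]
      · rw [val_add_one_eq_cNext, ← floor_rot h2 (by omega)]
        exact congrArg Prod.snd (disc_transl_rotate w k _ _ x)

theorem exists_wordStep {w : List Bool} {k : ℕ} {x : Space} {c : ℤ × (Fin (k + 1) → ℕ)}
    (h : WordStep w (disc w k x) c) : ∃ y, (expWord w).Step x y ∧ disc w k y = c := by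
  obtain ⟨q, a, b, fwd, h1, h2, v, ⟨h3, h4, rfl, rfl, h5⟩, h6⟩ := h
  have hsym : ∀ u, u ≤ w.length → ∃ p : Fin (w.length + 1), (p : ℕ) = u ∧
      symbols w p = cSym w u ∧ symbols w (p + 1) = cSym w (cNext w.length u) := by
    intro u hu
    refine ⟨⟨u, by omega⟩, rfl, (cSym_eq_symbols w ⟨u, by omega⟩).symm, ?_⟩
    rw [← cSym_eq_symbols, val_add_one_eq_cNext]
  set u := (disc w k x).2 0 with hu
  have hu' : ⌊((w.length : ℝ) + 1) * (x.2 0 : ℝ)⌋₊ = u := rfl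
  rcases fwd with _ | _
  · have h5 : u = cNext w.length v := h5
    obtain ⟨p, h7, h8, h9⟩ := hsym v h4
    have hx : x ∈ (expWord w).source (q, p, false) := by
      refine mem_piece_iff.2 ⟨?_, ?_⟩
      · rw [h9, ← h5]; exact h1
      · rw [val_add_one_eq_cNext, h7, ← h5, hu']
    refine ⟨_, ⟨_, hx, rfl⟩, (disc_transl_rotate w k _ _ x).trans (Prod.ext ?_ ?_)⟩
    · have h1 : x.1 = _ := h1
      change x.1 + (_ - _) = _
      rw [h9, ← h5, h8, h1, h2]; simp
    · rw [h6, floor_rot_neg (hu'.trans h5) h4]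
  · have h5 : v = cNext w.length u := h5
    obtain ⟨p, h7, h8, h9⟩ := hsym u h3
    have hx : x ∈ (expWord w).source (q, p, true) := by
      refine mem_piece_iff.2 ⟨?_, ?_⟩
      · rw [h8]; exact h1
      · rw [h7, hu']
    refine ⟨_, ⟨_, hx, rfl⟩, (disc_transl_rotate w k _ _ x).trans (Prod.ext ?_ ?_)⟩
    · have h1 : x.1 = _ := h1
      change x.1 + (_ - _) = _
      rw [h9, ← h5, h8, h1, h2]; simp
    · rw [h6, floor_rot hu' h3, h5]

theorem CellData.phaseStep_disc {P : Graphing} {k : ℕ} (D : CellData P k) (w : List Bool)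
    {a b : Bool × Space} (h : P.PhaseStep (expWord w) a b) :
    D.PhaseStep w (a.1, disc w k a.2) (b.1, disc w k b.2) := by
  obtain ⟨_ | _, x⟩ := a
  · exact ⟨h.1, D.step_disc w h.2⟩
  · exact ⟨h.1, wordStep_disc h.2⟩

/-- Whether an edge applies, and to which box it leads, can be read off from the box of a point. So
a discretised path can be followed from every point of its initial box; this is what makes the set
of cycle points non-null. -/
theorem CellData.exists_phaseStep {P : Graphing} {k : ℕ} (D : CellData P k) (w : List Bool)
    {a : Bool × Space} {c : Bool × ℤ × (Fin (k + 1) → ℕ)}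
    (h : D.PhaseStep w (a.1, disc w k a.2) c) :
    ∃ y, P.PhaseStep (expWord w) a (c.1, y) ∧ disc w k y = c.2 := by
  obtain ⟨_ | _, x⟩ := a
  · obtain ⟨y, h1, h2⟩ := D.exists_step w h.2
    exact ⟨y, ⟨h.1, h1⟩, h2⟩
  · obtain ⟨y, h1, h2⟩ := exists_wordStep h.2
    exact ⟨y, ⟨h.1, h1⟩, h2⟩

/-! ## The measurement of an execution with a test -/

/-- The points none of whose coordinates is `1`. -/
def generic : Set Space := {x | ∀ j, x.2 j ≠ 1}

theorem vol_compl_generic : vol genericᶜ = 0 := by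
  have : genericᶜ = ⋃ j : ℕ, (univ : Set ℤ) ×ˢ ((fun x : ℕ → unitInterval => x j) ⁻¹' {1}) := by
    ext x
    simp [generic]
  rw [this, measure_iUnion_null_iff]
  intro j
  rw [vol, Measure.prod_prod, (measurePreserving_eval_infinitePi (fun _ : ℕ =>
    (volume : Measure unitInterval)) j).measure_preimage (by measurability)]
  simp

theorem rot_ne_one (r : ℝ) {x : unitInterval} (hx : x ≠ 1) : rot r x ≠ 1 := by
  rw [rot, if_neg hx]
  exact fun h => (Int.fract_lt_one ((x : ℝ) + r)).ne (congrArg Subtype.val h)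

theorem addressMap_mem_generic (l : List (ℕ ⊕ ℕ)) {x : Space} (hx : x ∈ generic) :
    addressMap l x ∈ generic := by
  induction l with
  | nil => exact hx
  | cons a l ih =>
    rw [addressMap_cons]
    rcases a with n | j
    · intro i
      change (if i = 0 then rot _ ((addressMap l x).2 i) else (addressMap l x).2 i) ≠ 1
      split_ifs
      · exact rot_ne_one _ (ih i)
      · exact ih i
    · exact fun i => ih _

theorem volume_Ico_ne_zero {N p : ℕ} (hp : p < N) :
    (volume : Measure unitInterval) {y | (p : ℝ) / N ≤ y ∧ (y : ℝ) < (p + 1 : ℝ) / N} ≠ 0 := by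
  have hN : (0 : ℝ) < N := by exact_mod_cast (by omega : 0 < N)
  have h : {y : unitInterval | (p : ℝ) / N ≤ y ∧ (y : ℝ) < (p + 1 : ℝ) / N} =
      Subtype.val ⁻¹' Ico ((p : ℝ) / N) ((p + 1 : ℝ) / N) := rfl
  rw [h, unitInterval.measurePreserving_coe.measure_preimage measurableSet_Ico.nullMeasurableSet,
    Measure.restrict_apply measurableSet_Ico, inter_eq_self_of_subset_left, Real.volume_Ico]
  · rw [← sub_div]
    simp only [add_sub_cancel_left, ne_eq, ENNReal.ofReal_eq_zero, not_le]
    positivity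
  · intro y hy
    have hp' : (p : ℝ) + 1 ≤ N := by exact_mod_cast hp
    exact ⟨le_trans (by positivity) hy.1, hy.2.le.trans ((div_le_one hN).2 hp')⟩

/-- The box contains a product of `k + 1` intervals of length 1/(n+1) with full factors in all other
coordinates, so finitely many positive factors determine its measure. -/
theorem vol_disc_ne_zero (w : List Bool) (k : ℕ) (n : ℤ) (p : Fin (k + 1) → ℕ)
    (hp : ∀ j, p j ≤ w.length) : vol {x | disc w k x = (n, p)} ≠ 0 := by
  let N := w.length + 1
  let p' : ℕ → ℕ := fun j => if h : j < k + 1 then p ⟨j, h⟩ else 0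
  let t : ℕ → Set unitInterval := fun j => {y | (p' j : ℝ) / N ≤ y ∧ (y : ℝ) < (p' j + 1 : ℝ) / N}
  have hsub : ({n} : Set ℤ) ×ˢ (Set.pi (Finset.range (k + 1)) t) ⊆ {x | disc w k x = (n, p)} := by
    rintro x ⟨hx, hx'⟩
    refine Prod.ext hx (funext fun j => ?_)
    obtain ⟨h1, h2⟩ := hx' j (by simp; omega)
    have hp' : p' j = p j := dif_pos j.2
    have h : (0 : ℝ) < (w.length : ℝ) + 1 := by positivity
    have h3 : (0 : ℝ) ≤ x.2 j := (x.2 j).2.1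
    rw [hp', div_le_iff₀ (by positivity)] at h1
    rw [hp', lt_div_iff₀ (by positivity)] at h2
    change ⌊_⌋₊ = _
    rw [Nat.floor_eq_iff (by positivity)]
    simp only [N] at h1 h2
    push_cast at h1 h2
    rw [mul_comm]
    exact ⟨h1, h2⟩
  refine fun h => absurd (measure_mono_null hsub h) ?_
  rw [vol, Measure.prod_prod, Measure.infinitePi_pi, Measure.count_singleton, one_mul,
    ← ne_eq, Finset.prod_ne_zero_iff]
  · intro j _
    refine volume_Ico_ne_zero ?_
    simp only [p', N]
    split_ifs with h
    · exact Nat.lt_succ_of_le (hp _)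
    · omega
  · intro j _
    exact measurable_subtype_coe
      (measurableSet_Ico (a := (p' j : ℝ) / N) (b := (p' j + 1 : ℝ) / N))

theorem vol_boolCarrier_lt_top : vol boolCarrier < ⊤ := by
  have : boolCarrier = ({acc, rej} : Set ℤ) ×ˢ univ := by
    ext x
    simp [boolCarrier]
  rw [this, vol, Measure.prod_prod, measure_univ, mul_one]
  exact Measure.count_apply_lt_top.2 (by simp)

open Graphing in
theorem cyclePoints_subset (F G : Graphing) : cyclePoints F G ⊆ F.carrier ∩ G.carrier := by
  have key : ∀ F G : Graphing, ∀ x, Relation.TransGen (Relation.Comp F.Step G.Step) x x →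
      x ∈ F.carrier ∩ G.carrier := by
    intro F G x h
    obtain ⟨_, ⟨_, h1, -⟩, -⟩ := Relation.TransGen.head'_iff.1 h
    obtain ⟨_, -, ⟨_, -, h2⟩⟩ := Relation.TransGen.tail'_iff.1 h
    exact ⟨h1.mem_carrier, h2.mem_carrier_right⟩
  rintro x (h | h)
  · exact key F G x h
  · exact (key G F x h).symm

-- A cycle stays in the common carrier, which consists of two unit cells. Hence the value ∞ never
-- decides orthogonality.
open Graphing in
theorem meas_exec_lt_top {P : Graphing} (w : List Bool) (s : ℤ) (hs : s = acc ∨ s = rej) :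
    meas (exec P (expWord w)) (returnGraphing s hs) < ⊤ :=
  (measure_mono ((cyclePoints_subset _ _).trans inter_subset_right)).trans_lt vol_boolCarrier_lt_top

open Graphing in
/-- The measurement of the execution of a program and a word with a test does not vanish if and
only if some discretised alternating path leads from the cell "accept" to the cell `s`. -/
theorem meas_exec_ne_zero_iff {P : Graphing} (hP : P.carrier = listCarrier ∪ boolCarrier) {i : ℕ∞}
    (hi : P.IsIn (microcosm i)) {k : ℕ} (D : CellData P k) (w : List Bool) (s : ℤ)
    (hs : s = acc ∨ s = rej) :
    meas (exec P (expWord w)) (returnGraphing s hs) ≠ 0 ↔ ∃ p p', (∀ j, p j ≤ w.length) ∧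
      Relation.TransGen (D.PhaseStep w) (false, acc, p) (true, s, p') := by
  set F := exec P (expWord w)
  set T := returnGraphing s hs
  have hT : ∀ x y, T.Step x y → x.1 = s ∧ y.1 = acc ∧ ∃ l, y = transl (acc - s) (addressMap l x) := by
    rintro x y ⟨(l : List (ℕ ⊕ ℕ)), h, rfl⟩
    have h : x.1 = s := h
    refine ⟨h, ?_, l, rfl⟩
    change (addressMap l x).1 + (acc - s) = acc
    rw [addressMap_fst, h]; ring
  have hD : ∀ a b, Relation.TransGen (P.PhaseStep (expWord w)) a b →
      Relation.TransGen (D.PhaseStep w) (a.1, disc w k a.2) (b.1, disc w k b.2) := by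
    intro a b h
    induction h with
    | single h => exact .single (D.phaseStep_disc w h)
    | tail _ h ih => exact ih.tail (D.phaseStep_disc w h)
  -- A coordinate 1 would be assigned to the piece n+1, which is no position of the list; off this
  -- null set the discretisation is legitimate.
  have hgen : ∀ x ∈ generic, ∀ j, (disc w k x).2 j ≤ w.length := by
    intro x hx j
    have h1 : (x.2 j : ℝ) < 1 := lt_of_le_of_ne (x.2 j).2.2 fun h => hx j (Subtype.ext h)
    have h0 : (0 : ℝ) ≤ x.2 j := (x.2 j).2.1
    have h : (0 : ℝ) < (w.length : ℝ) + 1 := by positivity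
    rw [← Nat.lt_succ_iff]
    change ⌊_⌋₊ < _
    rw [Nat.floor_lt (by positivity)]
    push_cast
    nlinarith
  constructor
  · intro h
    by_contra hno
    push Not at hno
    -- Without a discretised path, no edge of the execution leads from a generic point of accept to
    -- the cell `s`, so that every cycle point has a coordinate 1.
    have hstep : ∀ x y, x ∈ generic → x.1 = acc → y.1 = s → F.Step x y → False := by
      intro x y hx hxa hys hxy
      obtain ⟨-, -, h⟩ := (exec_step_iff hP w).1 hxy
      refine hno (disc w k x).2 (disc w k y).2 (hgen x hx) ?_
      have := hD _ _ h
      rw [show disc w k x = (acc, (disc w k x).2) from Prod.ext hxa rfl,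
        show disc w k y = (s, (disc w k y).2) from Prod.ext hys rfl] at this
      exact this
    refine h (measure_mono_null ?_ vol_compl_generic)
    rintro x (hx | hx) hxg
    · obtain ⟨_, -, ⟨_, -, h2⟩⟩ := Relation.TransGen.tail'_iff.1 hx
      obtain ⟨_, ⟨y, h3, h4⟩, -⟩ := Relation.TransGen.head'_iff.1 hx
      exact hstep x y hxg (hT _ _ h2).2.1 (hT _ _ h4).1 h3
    -- Here the cycle begins with an edge of the test. Its endpoint lies in accept and is still
    -- generic, since address maps preserve this. The point `z` that the execution reaches next lies
    -- in `s`: either it closes the cycle or another edge of the test starts there.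
    · obtain ⟨z, ⟨y, h3, h4⟩, h5⟩ := Relation.TransGen.head'_iff.1 hx
      obtain ⟨h6, h7, l, rfl⟩ := hT _ _ h3
      refine hstep _ z ?_ h7 ?_ h4
      · exact fun j => addressMap_mem_generic l hxg j
      · rcases h5.cases_head with rfl | ⟨_, ⟨_, h8, -⟩, -⟩
        · exact h6
        · exact (hT _ _ h8).1
  · rintro ⟨p, p', hp, h⟩ h0
    -- It suffices that every point of the initial box lies on a cycle: the lifted path, followed by
    -- one edge of the test.
    refine vol_disc_ne_zero w k acc p hp (measure_mono_null ?_ h0)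
    intro x hx
    have hx : disc w k x = (acc, p) := hx
    have key : ∀ c, Relation.TransGen (D.PhaseStep w) (false, acc, p) c → ∃ y,
        Relation.TransGen (P.PhaseStep (expWord w)) (false, x) (c.1, y) ∧ disc w k y = c.2 := by
      intro c hc
      induction hc with
      | single h =>
        rw [← hx] at h
        obtain ⟨y, h1, h2⟩ := D.exists_phaseStep w (a := (false, x)) h
        exact ⟨y, .single h1, h2⟩
      | @tail b c _ h ih =>
        obtain ⟨y, h1, h2⟩ := ih
        obtain ⟨z, h3, h4⟩ := D.exists_phaseStep w (a := (b.1, y)) (by rw [h2]; exact h)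
        exact ⟨z, h1.tail h3, h4⟩
    have hret : ∀ a b, Relation.TransGen (P.PhaseStep (expWord w)) a b → Returns a.2 b.2 := by
      have h1 : ∀ a b, P.PhaseStep (expWord w) a b → Returns a.2 b.2 := by
        rintro ⟨_ | _, a⟩ b ⟨-, h⟩
        · obtain ⟨e, h1, h2⟩ := h
          obtain ⟨f, hf, hef⟩ := hi e
          rw [← h2, hef h1]
          exact returns_microcosm hf a
        · exact returns_expWord h
      intro a b h
      induction h with
      | single h => exact h1 _ _ h
      | tail _ h ih => exact ih.trans (h1 _ _ h)
    obtain ⟨y, hy, hdy⟩ := key _ h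
    obtain ⟨m, l, hl⟩ := hret _ _ hy
    have hl : x = transl m (addressMap l y) := hl
    have hxa : x.1 = acc := congrArg Prod.fst hx
    have hys : y.1 = s := congrArg Prod.fst hdy
    -- Address maps do not change the cell, so the translation in the returning map is forced to be
    -- the one that the edges of the test use.
    have hm : m = acc - s := by
      have := congrArg Prod.fst hl
      change x.1 = (addressMap l y).1 + m at this
      rw [addressMap_fst, hxa, hys] at this
      omega
    have h1 : F.Step x y := (exec_step_iff hP w).2 ⟨.inl hxa, by
      change y.1 = acc ∨ y.1 = rej
      rwa [hys], hy⟩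
    have h2 : T.Step y x := by
      refine ⟨l, hys, ?_⟩
      rw [hl, hm]; rfl
    exact .inl (.single ⟨y, h1, h2⟩)

theorem mem_lang_testNL_iff {P : Graphing} (w : List Bool) :
    w ∈ lang P testNL ↔
      Graphing.meas (Graphing.exec P (expWord w)) (returnGraphing acc (.inl rfl)) ≠ 0 := by
  have h := (meas_exec_lt_top (P := P) w acc (.inl rfl)).ne
  constructor
  · intro hw h0
    exact (hw _ rfl).1 (by simp [h0])
  · rintro h0 _ rfl
    constructor
    · simpa using h0
    · simpa using h

/-- The wagers range over all non-zero reals: a positive measurement m is cancelled by the wager -m,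
whereas the measurement 0 leaves every wager non-zero. -/
theorem mem_lang_testCoNL_iff {P : Graphing} (w : List Bool) :
    w ∈ lang P testCoNL ↔
      Graphing.meas (Graphing.exec P (expWord w)) (returnGraphing rej (.inr rfl)) = 0 := by
  have h := (meas_exec_lt_top (P := P) w rej (.inr rfl)).ne
  generalize hm : Graphing.meas (Graphing.exec P (expWord w)) (returnGraphing rej (.inr rfl)) = m at *
  lift m to NNReal using h
  have hc : (((m : NNReal) : ENNReal) : EReal) = ((m : ℝ) : EReal) := rfl
  constructor
  · intro hw
    by_contra h0
    have h0 : (m : ℝ) ≠ 0 := by simpa using h0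
    refine (hw _ ⟨-m, by simpa using h0, rfl⟩).1 ?_
    rw [hm, hc, ← EReal.coe_add]
    simp
  · rintro h0 _ ⟨ζ, hζ, rfl⟩
    constructor
    · change (ζ : EReal) + _ ≠ 0
      rw [hm, h0]
      simpa using hζ
    · change (ζ : EReal) + _ ≠ ⊤
      rw [hm, hc, ← EReal.coe_add]
      exact EReal.coe_ne_top _

/-! ## From graphings to programs on circular lists -/

/-- All elements are a translation of the cells together with a permutation of coordinates. The
bound `N` matters for i = ∞, where each single element still involves finitely many coordinates
only. -/
theorem exists_perm_of_mem_microcosm {i : ℕ∞} (hi : 1 ≤ i) {f : Function.End Space}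
    (hf : f ∈ microcosm i) : ∃ (m : ℤ) (σ : Equiv.Perm ℕ) (N : ℕ), ((N + 1 : ℕ) : ℕ∞) ≤ i ∧
      (∀ l, N < l → σ l = l) ∧ ∀ x : Space, f x = (x.1 + m, fun l => x.2 (σ l)) := by
  induction hf using Submonoid.closure_induction with
  | mem f hf =>
    obtain ⟨k, rfl⟩ | ⟨j, ⟨-, hj⟩, rfl⟩ := hf
    · exact ⟨k, 1, 0, by simpa using hi, fun _ _ => rfl, fun _ => rfl⟩
    · refine ⟨0, Equiv.swap 0 j, j, ?_, fun l hl => ?_, fun x => by simp [swap]⟩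
      · push_cast
        exact Order.add_one_le_of_lt hj
      · exact Equiv.swap_apply_of_ne_of_ne (by omega) (by omega)
  | one => exact ⟨0, 1, 0, by simpa using hi, fun _ _ => rfl, fun x => by simp; rfl⟩
  | mul f g _ _ hf hg =>
    obtain ⟨m, σ, N, h1, h2, h3⟩ := hf
    obtain ⟨m', σ', N', h1', h2', h3'⟩ := hg
    -- Coordinates are pulled back, hence the permutations compose in the reverse order.
    refine ⟨m' + m, σ' * σ, max N N', ?_, fun l hl => ?_, fun x => ?_⟩
    · rcases max_choice N N' with h | h <;> rwa [h]
    · rw [Equiv.Perm.mul_apply, h2 l (by omega), h2' l (by omega)]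
    · change f (g x) = _
      rw [h3, h3', add_assoc]; rfl

theorem exists_perm_fin {k : ℕ} (σ : Equiv.Perm ℕ) (h : ∀ l, k < l → σ l = l) :
    ∃ τ : Equiv.Perm (Fin (k + 1)), ∀ j, (τ j : ℕ) = σ j := by
  have h1 : ∀ l, l ≤ k → σ l ≤ k := by
    intro l hl
    by_contra! h'
    have := σ.injective (h _ h')
    omega
  let g : Fin (k + 1) → Fin (k + 1) := fun j => ⟨σ j, Nat.lt_succ_of_le (h1 j (by omega))⟩
  have hg : Function.Injective g := fun a b hab => Fin.ext (σ.injective (congrArg Fin.val hab))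
  exact ⟨Equiv.ofBijective g (Finite.injective_iff_bijective.1 hg), fun j => rfl⟩

/-- Finiteness is used twice: sources that are unions of cells make the edges visible to the
discretisation, and finitely many edges share one bound on the coordinates that they permute. This
bound is the number of heads. -/
theorem exists_cellData {i : ℕ∞} (hi : 1 ≤ i) {P : Graphing} (hP : P.IsIn (microcosm i))
    (hfin : P.IsFinite) : ∃ k : ℕ, ((k + 1 : ℕ) : ℕ∞) ≤ i ∧ Nonempty (CellData P k) := by
  obtain ⟨hE, hA⟩ := hfin
  choose A hA using hA
  choose f hf hPf using hP
  choose m σ N h1 h2 h3 using fun e => exists_perm_of_mem_microcosm hi (hf e)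
  obtain ⟨k, hk, hN⟩ : ∃ k : ℕ, ((k + 1 : ℕ) : ℕ∞) ≤ i ∧ ∀ e, N e ≤ k := by
    rcases isEmpty_or_nonempty P.Edge with h | h
    · exact ⟨0, by simpa using hi, fun e => h.elim e⟩
    · obtain ⟨e, he⟩ := Finite.exists_max N
      exact ⟨N e, h1 e, he⟩
  choose τ hτ using fun e => exists_perm_fin (k := k) (σ e) fun l hl =>
    h2 e l ((hN e).trans_lt hl)
  refine ⟨k, hk, ⟨A, m, τ, fun e x => ?_, fun e x hx => ?_, fun e x hx j => ?_⟩⟩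
  · rw [hA e]
    simp [Graphing.cell]
  · rw [hPf e hx, h3]
  · rw [hPf e hx, h3, hτ]

/-- The cells that an alternating path can enter by an edge of a word. -/
def CellData.nearCells {P : Graphing} {k : ℕ} (D : CellData P k) : Set ℤ :=
  insert acc (⋃ e, ⋃ m ∈ D.cells e, Icc (m + D.shift e - 8) (m + D.shift e + 8))

theorem CellData.finite_nearCells {P : Graphing} [Finite P.Edge] {k : ℕ} (D : CellData P k) :
    D.nearCells.Finite := by
  refine (finite_iUnion fun e => ?_).insert _
  exact (D.cells e).finite_toSet.biUnion fun m _ => finite_Icc _ _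

theorem vertex_sub_le (q : ℤ) (a b : Option Bool) (o o' : Bool) :
    vertex q a o - 8 ≤ vertex q b o' ∧ vertex q b o' ≤ vertex q a o + 8 := by
  have h : ∀ a, 0 ≤ symIdx a ∧ symIdx a ≤ 2 := by
    rintro (_ | _ | _) <;> simp [symIdx]
  have h1 := h a
  have h2 := h b
  unfold vertex
  cases o <;> cases o' <;> simp <;> omega

/-- The program on circular lists that follows the alternating paths to the cell `s`. -/
def CellData.prog {P : Graphing} [Finite P.Edge] {k : ℕ} (D : CellData P k) (s : ℤ) :
    Prog (CLab (Fin (k + 1))) where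
  -- A program cannot exchange its heads. The permutation records which head currently plays the
  -- part of each coordinate, so that the word moves the head `π 0`. Finitely many cells suffice
  -- because an edge of a word stays in one block of eight.
  State := Option (D.nearCells × Equiv.Perm (Fin (k + 1)))
  finite_state := by
    have := D.finite_nearCells.to_subtype
    infer_instance
  start := some (⟨acc, mem_insert _ _⟩, 1)
  final := none
  trans
    -- One transition joins an edge of `P` to the edge of the word that follows it; the former
    -- determines the cell in between, and the numbers of the two cells give the instruction.
    | some (n, π), l, some (n', π') => ∃ e q a b fwd, l = some (π' 0, a, b, fwd) ∧
        n.1 ∈ D.cells e ∧ n.1 + D.shift e = vertex q a fwd ∧ n'.1 = vertex q b (!fwd) ∧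
        π' = π * D.perm e
    | some (n, _), l, none => l = none ∧ ∃ e, n.1 ∈ D.cells e ∧ n.1 + D.shift e = s
    | none, _, _ => False

theorem CellData.mem_circLang_prog {P : Graphing} [Finite P.Edge] {k : ℕ} (D : CellData P k)
    (s : ℤ) (w : List Bool) : w ∈ circLang (D.prog s) ↔ ∃ p p', (∀ j, p j ≤ w.length) ∧
      Relation.TransGen (D.PhaseStep w) (false, acc, p) (true, s, p') := by
  constructor
  · rintro ⟨p, p', hp, h⟩
    suffices ∀ x, (D.prog s).Reach (cAct w) ((D.prog s).start, p) x →
        match x with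
        | (some (n, π), P) => Relation.ReflTransGen (D.PhaseStep w) (false, acc, p)
            (false, n, fun j => P (π j))
        | (none, _) => ∃ p', Relation.TransGen (D.PhaseStep w) (false, acc, p) (true, s, p') by
      obtain ⟨p', h'⟩ := this _ h
      exact ⟨p, p', hp, h'⟩
    intro x hx
    induction hx with
    | refl => exact .refl
    | @tail x y _ h ih =>
      obtain ⟨l, h1, h2⟩ := h
      obtain ⟨_ | ⟨n, π⟩, P₁⟩ := x
      · exact h1.elim
      obtain ⟨_ | ⟨n', π'⟩, P₂⟩ := y
      · obtain ⟨rfl, e, h3, h4⟩ := h1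
        refine ⟨fun j => P₁ (π (D.perm e j)), .tail' ih ⟨rfl, e, h3, h4.symm, fun j => rfl⟩⟩
      · obtain ⟨e, q, a, b, fwd, rfl, h3, h4, h5, h6⟩ := h1
        have hs : D.PhaseStep w (false, n, fun j => P₁ (π j))
            (true, n + D.shift e, fun j => P₁ (π' j)) :=
          ⟨rfl, e, h3, rfl, fun j => by rw [h6]; rfl⟩
        refine (ih.tail hs).tail ⟨rfl, q, a, b, fwd, h4, h5, ?_⟩
        obtain ⟨v, h7, h8⟩ := h2
        have h8 : P₂ = Function.update P₁ (π' 0) v := h8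
        refine ⟨v, h7, ?_⟩
        rw [h8]
        exact Function.update_comp_eq_of_injective _ π'.injective _ _
  · rintro ⟨p, p', hp, h⟩
    suffices ∀ x, Relation.ReflTransGen (D.PhaseStep w) (false, acc, p) x →
        match x with
        | (false, n, c) => ∃ hn π P, c = (fun j => P (π j)) ∧
            (D.prog s).Reach (cAct w) ((D.prog s).start, p)
              (some (⟨n, hn⟩, (π : Equiv.Perm (Fin (k + 1)))), P)
        | (true, n, c) => ∃ n₀ π P e, c = (fun j => P ((π * D.perm e) j)) ∧ n₀.1 ∈ D.cells e ∧
            n = n₀.1 + D.shift e ∧ (D.prog s).Reach (cAct w) ((D.prog s).start, p)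
              (some (n₀, (π : Equiv.Perm (Fin (k + 1)))), P) by
      obtain ⟨n₀, π, P₁, e, -, h1, h2, h3⟩ := this _ h.to_reflTransGen
      exact ⟨p, P₁, hp, h3.tail ⟨none, ⟨rfl, e, h1, h2.symm⟩, rfl⟩⟩
    intro x hx
    induction hx with
    | refl => exact ⟨mem_insert _ _, 1, p, rfl, .refl⟩
    | @tail x y _ h ih =>
      obtain ⟨_ | _, n, c⟩ := x
      · obtain ⟨b, n', c'⟩ := y
        obtain ⟨rfl, e, h1, h2, h3⟩ := h
        obtain ⟨hn, π, P₁, rfl, h4⟩ := ih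
        exact ⟨⟨n, hn⟩, π, P₁, e, funext h3, h1, h2, h4⟩
      · obtain ⟨b, n', c'⟩ := y
        obtain ⟨rfl, q, a, b, fwd, h1, h2, v, h3, h4⟩ := h
        obtain ⟨n₀, π, P₁, e, rfl, h5, h6, h7⟩ := ih
        have h1 : n = vertex q a fwd := h1
        have h2 : n' = vertex q b (!fwd) := h2
        have h4 : c' = Function.update (fun j => P₁ ((π * D.perm e) j)) 0 v := h4
        have hn : n' ∈ D.nearCells := by
          refine .inr (mem_iUnion.2 ⟨e, mem_iUnion₂.2 ⟨n₀.1, h5, ?_⟩⟩)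
          rw [← h6, h1, h2]
          exact vertex_sub_le _ _ _ _ _
        refine ⟨hn, π * D.perm e, Function.update P₁ ((π * D.perm e) 0) v, ?_, h7.tail
          ⟨some ((π * D.perm e) 0, a, b, fwd), ⟨e, q, a, b, fwd, rfl, h5, h6.symm.trans h1, h2, rfl⟩,
            v, h3, rfl⟩⟩
        rw [h4]
        exact (Function.update_comp_eq_of_injective _ (π * D.perm e).injective _ _).symm

/-! ## Graphings of type `!List ⊸ NBool` -/

/-- Graphings all of whose edges start in the cell "accept" are booleans. -/
theorem mem_nBool {F : Graphing} (hF : F.carrier = boolCarrier)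
    (h : ∀ e, F.source e ⊆ Graphing.cell acc) : F ∈ nBool := by
  refine ⟨hF, fun t _ ht' => ?_⟩
  have hm : ∀ s : ℤ, MeasurableSet (Graphing.cell s) := fun s =>
    measurable_fst (measurableSet_singleton s)
  -- Each edge is cut in two according to the cell in which it ends. The result satisfies the
  -- definition of `boolSets` and has the same steps, hence the same measurement against every
  -- graphing.
  let F' : Graphing :=
    { carrier := F.carrier
      measurableSet_carrier := F.measurableSet_carrier
      Edge := F.Edge × Bool
      countable_edge := by
        have := F.countable_edge
        infer_instance
      map := fun e => F.map e.1
      map_mem := fun e => F.map_mem e.1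
      source := fun e => F.source e.1 ∩ F.map e.1 ⁻¹' Graphing.cell (bif e.2 then acc else rej)
      measurableSet_source := fun e =>
        (F.measurableSet_source e.1).inter ((F.map_mem e.1).1.1 (hm _))
      source_subset := fun e => inter_subset_left.trans (F.source_subset e.1)
      target_subset := fun e => (image_mono inter_subset_left).trans (F.target_subset e.1) }
  have hF' : F' ∈ boolSets := by
    refine ⟨hF, fun e => ⟨inter_subset_left.trans (h e.1), ?_⟩⟩
    obtain ⟨e, _ | _⟩ := e
    · right
      rintro _ ⟨x, hx, rfl⟩
      exact hx.2
    · left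
      rintro _ ⟨x, hx, rfl⟩
      exact hx.2
  have hstep : F'.Step = F.Step := by
    funext x y
    refine propext ⟨?_, ?_⟩
    · rintro ⟨e, hx, rfl⟩
      exact ⟨e.1, hx.1, rfl⟩
    · rintro ⟨e, hx, rfl⟩
      have : F.map e x ∈ boolCarrier := hF ▸ F.target_subset e ⟨x, hx, rfl⟩
      rcases this with h | h
      · exact ⟨(e, true), ⟨hx, h⟩, rfl⟩
      · exact ⟨(e, false), ⟨hx, h⟩, rfl⟩
  have := ht' F' hF'
  unfold Orth Graphing.meas Graphing.cyclePoints at this ⊢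
  rwa [hstep] at this

/-- A path of the execution that starts at a boolean point starts with an edge of `P`, because `F`
has no edges there. Hence it starts in accept, and the execution is a boolean by `mem_nBool`,
whatever the edges of `F` are. -/
theorem mem_lolli {P : Graphing} (hP : P.carrier = listCarrier ∪ boolCarrier)
    (h : ∀ e, ∀ x ∈ P.source e, x.1 ≠ rej) : P ∈ lolli listCarrier expList boolCarrier nBool := by
  refine ⟨hP, fun F hF => ?_⟩
  have hF : F.carrier = listCarrier := hF.1
  have hc : (Graphing.exec P F).carrier = boolCarrier := by
    rw [← symmDiff_carriers, ← hP, ← hF]; rfl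
  refine mem_nBool hc ?_
  rintro ⟨l, hl, hl'⟩ x hx
  have hxb : x ∈ boolCarrier := hc ▸ (Graphing.exec P F).source_subset _ hx
  obtain ⟨e, l, rfl⟩ := List.exists_cons_of_ne_nil hl
  have he := hx.1.1
  rcases e with e | e
  · exact hxb.resolve_right (h e x he)
  · exact absurd (hF ▸ F.source_subset e he) (disjoint_carriers hxb)

/-! ## From programs on circular lists to graphings -/

theorem symIdx_injective : Function.Injective symIdx := by
  rintro (_ | _ | _) (_ | _ | _) h <;> simp_all [symIdx]

theorem vertex_injective {q q' : ℤ} {a a' : Option Bool} {o o' : Bool}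
    (h : vertex q a o = vertex q' a' o') : q = q' ∧ a = a' ∧ o = o' := by
  have hs : ∀ a, 0 ≤ symIdx a ∧ symIdx a ≤ 2 := by
    rintro (_ | _ | _) <;> simp [symIdx]
  have h1 := hs a
  have h2 := hs a'
  unfold vertex at h
  have ho : o = o' := by
    cases o <;> cases o' <;> simp at h ⊢ <;> omega
  subst ho
  have hq : q = q' := by
    cases o <;> simp at h <;> omega
  subst hq
  exact ⟨rfl, symIdx_injective (by omega), rfl⟩

theorem vertex_ne_acc (q : ℤ) (a : Option Bool) (o : Bool) : vertex q a o ≠ acc := by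
  intro h
  have := vertex_mod q a o
  rw [h] at this
  simp [acc] at this

theorem vertex_ne_rej (q : ℤ) (a : Option Bool) (o : Bool) : vertex q a o ≠ rej := by
  intro h
  have := vertex_mod q a o
  rw [h] at this
  simp [rej] at this

theorem swap_mem_microcosm {i : ℕ∞} {j : ℕ} (hj : (j : ℕ∞) < i) : swap j ∈ microcosm i := by
  rcases Nat.eq_zero_or_pos j with rfl | h
  · have : swap 0 = 1 := by
      funext x
      simp only [swap, Equiv.swap_self, Equiv.refl_apply]
      rfl
    rw [this]
    exact one_mem _
  · exact Submonoid.subset_closure (.inr ⟨j, ⟨h, hj⟩, rfl⟩)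

theorem val_swap_zero {k : ℕ} (a j : Fin (k + 1)) :
    ((Equiv.swap 0 a j : Fin (k + 1)) : ℕ) = Equiv.swap 0 (a : ℕ) j := by
  simp only [Equiv.swap_apply_def, Fin.ext_iff, Fin.val_zero]
  split_ifs <;> rfl

namespace Prog

variable {k : ℕ} (M : Prog (CLab (Fin (k + 1))))

/-- The labelled transitions of a program. -/
abbrev LTrans : Type :=
  {x : M.State × CLab (Fin (k + 1)) × M.State // M.trans x.1 (some x.2.1) x.2.2}

instance : Finite M.LTrans := by
  have := M.finite_state
  infer_instance

/-- A numbering of the labelled transitions. -/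
def number (t : M.LTrans) : ℤ := (Finite.equivFin M.LTrans t : ℕ)

theorem number_injective : Function.Injective M.number := fun a b h =>
  (Finite.equivFin M.LTrans).injective (Fin.ext (by simpa [number] using h))

/-- The state in which a computation starts (`none`) or which it reaches by a transition. -/
def dst : Option M.LTrans → M.State
  | none => M.start
  | some t => t.1.2.2

/-- The state in which a computation ends (`none`) or which it leaves by a transition. -/
def src : Option M.LTrans → M.State
  | none => M.final
  | some t => t.1.1

/-- The head that a transition moves. -/
def head : Option M.LTrans → Fin (k + 1)
  | none => 0
  | some t => t.1.2.1.1

/-- The cell that is reached by the movement of a transition. -/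
def endCell : Option M.LTrans → ℤ
  | none => acc
  | some t => vertex (M.number t) t.1.2.1.2.2.1 (!t.1.2.1.2.2.2)

/-- The cell in which the movement of a transition begins. -/
def beginCell (s : ℤ) : Option M.LTrans → ℤ
  | none => s
  | some t => vertex (M.number t) t.1.2.1.2.1 t.1.2.1.2.2.2

theorem endCell_injective : Function.Injective M.endCell := by
  rintro (_ | t) (_ | t') h
  · rfl
  · exact absurd h.symm (vertex_ne_acc _ _ _)
  · exact absurd h (vertex_ne_acc _ _ _)
  · rw [M.number_injective (vertex_injective h).1]

theorem endCell_mem (t : Option M.LTrans) (x : Space) (hx : x.1 = M.endCell t) :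
    x ∈ listCarrier ∪ boolCarrier := by
  rcases t with _ | t
  · exact .inr (.inl hx)
  · left
    change x.1 % 8 < 6
    rw [hx]
    exact vertex_mod _ _ _

theorem beginCell_mem {s : ℤ} (hs : s = acc ∨ s = rej) (t : Option M.LTrans) (x : Space)
    (hx : x.1 = M.beginCell s t) : x ∈ listCarrier ∪ boolCarrier := by
  rcases t with _ | t
  · right
    change x.1 = acc ∨ x.1 = rej
    rwa [hx]
  · left
    change x.1 % 8 < 6
    rw [hx]
    exact vertex_mod _ _ _

/-- The relation between states given by the silent moves. -/
def Silent : M.State → M.State → Prop := Relation.ReflTransGen fun q q' => M.trans q none q'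

/-- The graphing that represents a program on circular lists: each of the labelled transitions has
its own copy of the vertices, and the edges lead from the transitions to those that can follow. -/
def toGraphing (s : ℤ) (hs : s = acc ∨ s = rej) : Graphing where
  carrier := listCarrier ∪ boolCarrier
  measurableSet_carrier := measurable_fst
    (.of_discrete (s := {n : ℤ | n % 8 < 6} ∪ {n : ℤ | n = acc ∨ n = rej}))
  Edge := {x : Option M.LTrans × Option M.LTrans // M.Silent (M.dst x.1) (M.src x.2)}
  countable_edge := Finite.to_countable
  -- Between two instructions all heads are in their own coordinates. The edge first takes the head
  -- of the past transition out of the first coordinate and then brings that of the next one there.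
  -- The value `none` stands for the start or the end, where `head` is 0 and the exchange is
  -- trivial.
  map e := transl (M.beginCell s e.1.2 - M.endCell e.1.1) *
    (swap (M.head e.1.2) * swap (M.head e.1.1))
  map_mem _ := ambient.mul_mem (transl_mem_ambient _)
    (ambient.mul_mem (swap_mem_ambient _) (swap_mem_ambient _))
  source e := Graphing.cell (M.endCell e.1.1)
  measurableSet_source _ := measurable_fst (measurableSet_singleton _)
  source_subset e x hx := M.endCell_mem e.1.1 x hx
  target_subset := by
    rintro e _ ⟨x, hx, rfl⟩
    refine M.beginCell_mem hs e.1.2 _ ?_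
    change x.1 + _ = _
    rw [show x.1 = _ from hx]
    ring

theorem toGraphing_mem_programs {i : ℕ∞} (hi : ((k + 1 : ℕ) : ℕ∞) ≤ i) (s : ℤ)
    (hs : s = acc ∨ s = rej) : M.toGraphing s hs ∈ programs (microcosm i) := by
  have hj : ∀ j : Fin (k + 1), swap j ∈ microcosm i := fun j =>
    swap_mem_microcosm (lt_of_lt_of_le (by exact_mod_cast j.2) hi)
  refine ⟨fun e => ⟨_, ?_, fun _ _ => rfl⟩, ⟨?_, fun e => ⟨{M.endCell e.1.1}, ?_⟩⟩,
    mem_lolli rfl ?_⟩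
  · exact mul_mem (Submonoid.subset_closure (.inl ⟨_, rfl⟩)) (mul_mem (hj _) (hj _))
  · change Finite {x : Option M.LTrans × Option M.LTrans // _}
    infer_instance
  · simp [toGraphing]
  · rintro ⟨⟨_ | t, b⟩, h⟩ x hx
    · have hx : x.1 = acc := hx
      rw [hx]
      simp [acc, rej]
    · have hx : x.1 = vertex _ _ _ := hx
      rw [hx]
      exact vertex_ne_rej _ _ _

/-- The edges of the graphing that represents a program. -/
def cellData (s : ℤ) (hs : s = acc ∨ s = rej) : CellData (M.toGraphing s hs) k where
  cells e := {M.endCell e.1.1}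
  shift e := M.beginCell s e.1.2 - M.endCell e.1.1
  perm e := Equiv.swap 0 (M.head e.1.1) * Equiv.swap 0 (M.head e.1.2)
  mem_source e x := by
    rw [Finset.mem_singleton]; rfl
  map_fst _ _ _ := rfl
  map_snd e x _ j := by
    rw [Equiv.Perm.mul_apply, val_swap_zero, val_swap_zero]
    rfl

/-- Edges of a word never change the number of a copy, so this number remembers the transition under
way. In the copy of a transition, the cell of departure fixes the symbol that is left and the
direction; among the possible arrivals, only the one with the prescribed symbol is a cell from which
the graphing continues. -/
theorem mem_circLang_iff (s : ℤ) (hs : s = acc ∨ s = rej) (w : List Bool) :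
    w ∈ circLang M ↔ ∃ p p', (∀ j, p j ≤ w.length) ∧
      Relation.TransGen ((M.cellData s hs).PhaseStep w) (false, acc, p) (true, s, p') := by
  have hsilent : ∀ p q q', M.Silent q q' → M.Reach (cAct w) (q, p) (q', p) := by
    intro p q q' h
    induction h with
    | refl => exact .refl
    | tail _ h ih => exact ih.tail ⟨none, h, rfl⟩
  constructor
  · rintro ⟨p, p', hp, h⟩
    have hstep : ∀ a b (P : Fin (k + 1) → ℕ), M.Silent (M.dst a) (M.src b) → (M.cellData s hs).PhaseStep w
        (false, M.endCell a, fun j => P (Equiv.swap 0 (M.head a) j))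
        (true, M.beginCell s b, fun j => P (Equiv.swap 0 (M.head b) j)) := by
      intro a b P h
      refine ⟨rfl, ⟨(a, b), h⟩, Finset.mem_singleton_self _, ?_, fun j => ?_⟩
      · change _ = M.endCell a + (M.beginCell s b - M.endCell a)
        ring
      · change _ = P (Equiv.swap 0 (M.head a) ((Equiv.swap 0 (M.head a) *
          Equiv.swap 0 (M.head b)) j))
        rw [Equiv.Perm.mul_apply, Equiv.swap_apply_self]
    suffices ∀ x, M.Reach (cAct w) (M.start, p) x → ∃ a, M.Silent (M.dst a) x.1 ∧
        Relation.ReflTransGen ((M.cellData s hs).PhaseStep w) (false, acc, p)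
          (false, M.endCell a, fun j => x.2 (Equiv.swap 0 (M.head a) j)) by
      obtain ⟨a, h1, h2⟩ := this _ h
      exact ⟨p, _, hp, .tail' h2 (hstep a none p' h1)⟩
    intro x hx
    induction hx with
    | refl =>
      refine ⟨none, .refl, ?_⟩
      have : (fun j => p (Equiv.swap 0 (M.head none) j)) = p := by simp [head]
      simp only [this]
      exact .refl
    | @tail y z _ h ih =>
      obtain ⟨a, h1, h2⟩ := ih
      obtain ⟨_ | l, h3, h4⟩ := h
      · have h4 : y.2 = z.2 := h4
        exact ⟨a, h1.tail h3, h4 ▸ h2⟩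
      · let t : M.LTrans := ⟨(y.1, l, z.1), h3⟩
        refine ⟨some t, .refl, (h2.tail (hstep a (some t) y.2 h1)).tail
          ⟨rfl, M.number t, l.2.1, l.2.2.1, l.2.2.2, rfl, rfl, ?_⟩⟩
        obtain ⟨v, h5, h6⟩ := h4
        refine ⟨v, ?_, ?_⟩
        · simpa [head, t] using h5
        · have h7 := Function.update_comp_eq_of_injective y.2
            (Equiv.swap 0 (M.head (some t))).injective 0 v
          rw [Equiv.swap_apply_left] at h7
          rw [h6]
          exact h7
  · rintro ⟨p, p', hp, h⟩
    suffices ∀ x, Relation.ReflTransGen ((M.cellData s hs).PhaseStep w) (false, acc, p) x →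
        match x with
        -- The claim is conditional: an edge of the word may also arrive at a cell for a wrong
        -- symbol, which is the source of no edge of the graphing.
        | (false, n, c) => ∀ a, n = M.endCell a → ∃ P, c = (fun j => P (Equiv.swap 0 (M.head a) j)) ∧
            M.Reach (cAct w) (M.start, p) (M.dst a, P)
        | (true, n, c) => ∃ b P, n = M.beginCell s b ∧
            c = (fun j => P (Equiv.swap 0 (M.head b) j)) ∧
            M.Reach (cAct w) (M.start, p) (M.src b, P) by
      obtain ⟨b, P, h1, -, h2⟩ := this _ h.to_reflTransGen
      refine ⟨p, P, hp, ?_⟩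
      rcases b with _ | t
      · exact h2
      · rcases hs with rfl | rfl
        · exact absurd h1.symm (vertex_ne_acc _ _ _)
        · exact absurd h1.symm (vertex_ne_rej _ _ _)
    intro x hx
    induction hx with
    | refl =>
      intro a ha
      obtain rfl : none = a := M.endCell_injective ha
      exact ⟨p, by simp [head], .refl⟩
    | @tail x y _ h ih =>
      obtain ⟨_ | _, n, c⟩ := x
      · obtain ⟨b, n', c'⟩ := y
        obtain ⟨rfl, ⟨⟨a, b⟩, he⟩, h1, h2, h3⟩ := h
        obtain ⟨P, rfl, h4⟩ := ih a (Finset.mem_singleton.1 h1)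
        have h1 : n = M.endCell a := Finset.mem_singleton.1 h1
        refine ⟨b, P, ?_, funext fun j => ?_, h4.trans (hsilent P _ _ he)⟩
        · have h2 : n' = n + (M.beginCell s b - M.endCell a) := h2
          rw [h2, h1]; ring
        · refine (h3 j).trans ?_
          change P (Equiv.swap 0 (M.head a) ((Equiv.swap 0 (M.head a) *
            Equiv.swap 0 (M.head b)) j)) = _
          rw [Equiv.Perm.mul_apply, Equiv.swap_apply_self]
      · obtain ⟨b, n', c'⟩ := y
        obtain ⟨rfl, q, a, b, fwd, h1, h2, v, h3, h4⟩ := h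
        obtain ⟨t, P, h5, rfl, h6⟩ := ih
        have h1 : n = vertex q a fwd := h1
        rcases t with _ | t
        · have h5 : n = s := h5
          rcases hs with rfl | rfl
          · exact absurd (h1.symm.trans h5) (vertex_ne_acc _ _ _)
          · exact absurd (h1.symm.trans h5) (vertex_ne_rej _ _ _)
        intro t' ht'
        rcases t' with _ | t'
        · exact absurd (h2.symm.trans ht') (vertex_ne_acc _ _ _)
        obtain ⟨rfl, rfl, rfl⟩ := vertex_injective (h1.symm.trans h5)
        obtain ⟨h7, h8, -⟩ := vertex_injective (h2.symm.trans ht')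
        obtain rfl := M.number_injective h7
        refine ⟨Function.update P (M.head (some t)) v, ?_, h6.tail ⟨some t.1.2.1, t.2, v, ?_, rfl⟩⟩
        · have h7 := Function.update_comp_eq_of_injective P
            (Equiv.swap 0 (M.head (some t))).injective 0 v
          rw [Equiv.swap_apply_left] at h7
          exact h4.trans h7.symm
        · rw [← h8]
          simpa [head] using h3

end Prog

/-! ## Multihead automata and graphings -/

/-- Both tests reduce to this equality, with `s` the cell accept or reject: the path to `s` is the
accepting computation, and T_coNL merely negates its existence. -/
theorem twoNFA_eq (i : ℕ∞) (hi : 1 ≤ i) (s : ℤ) (hs : s = acc ∨ s = rej) :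
    {L : Language Bool | ∃ P ∈ programs (microcosm i), L = {w : List Bool |
      Graphing.meas (Graphing.exec P (expWord w)) (returnGraphing s hs) ≠ 0}} = twoNFA i := by
  ext L
  constructor
  · rintro ⟨P, ⟨h1, h2, h3⟩, rfl⟩
    have := h2.1
    obtain ⟨k, hk, ⟨D⟩⟩ := exists_cellData hi h1 h2
    obtain ⟨M, hM⟩ := exists_headLang_eq_circLang (D.prog s)
    have : headLang M = {w : List Bool |
        Graphing.meas (Graphing.exec P (expWord w)) (returnGraphing s hs) ≠ 0} := by
      rw [hM]
      ext w
      exact (D.mem_circLang_prog s w).trans (meas_exec_ne_zero_iff h3.1 h1 D w s hs).symm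
    rw [← this]
    exact headLang_mem_twoNFA hk M (Equiv.refl _)
  · rintro ⟨k₀, hk₀, M, rfl⟩
    obtain ⟨k, h1, h2⟩ : ∃ k, k₀ ≤ k + 1 ∧ ((k + 1 : ℕ) : ℕ∞) ≤ i := by
      -- The number of coordinates is `k + 1`, so an automaton without heads receives one that it
      -- ignores.
      rcases k₀ with _ | k
      · exact ⟨0, by omega, by simpa using hi⟩
      · exact ⟨k, le_rfl, hk₀⟩
    obtain ⟨M₁, hM₁⟩ := M.exists_prog h1
    obtain ⟨M₂, hM₂⟩ := exists_circular M₁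
    refine ⟨M₂.toGraphing s hs, M₂.toGraphing_mem_programs h2 s hs, ?_⟩
    ext w
    refine Iff.trans ?_ (meas_exec_ne_zero_iff rfl (M₂.toGraphing_mem_programs h2 s hs).1
      (M₂.cellData s hs) w s hs).symm
    rw [← M₂.mem_circLang_iff]
    constructor
    · intro hw
      obtain ⟨p', hp'⟩ := (hM₂ w (fun _ => 0) fun _ => Nat.zero_le _).2 ((hM₁ w _).2 ⟨rfl, hw⟩)
      exact ⟨_, p', fun _ => Nat.zero_le _, hp'⟩
    -- The path may begin in any box of accept; the initial test made by `M₁` forces all heads to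
    -- begin at 0.
    · rintro ⟨p, p', hp, h⟩
      exact ((hM₁ w _).1 ((hM₂ w p hp).1 ⟨p', h⟩)).2

theorem characterises_testNL (i : ℕ∞) (hi : 1 ≤ i) :
    Characterises (microcosm i) testNL (twoNFA i) := by
  rw [Characterises, ← twoNFA_eq i hi acc (.inl rfl)]
  have : ∀ P, lang P testNL = {w : List Bool |
      Graphing.meas (Graphing.exec P (expWord w)) (returnGraphing acc (.inl rfl)) ≠ 0} := fun P =>
    Set.ext mem_lang_testNL_iff
  simp only [this]

theorem characterises_testCoNL (i : ℕ∞) (hi : 1 ≤ i) :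
    Characterises (microcosm i) testCoNL (coTwoNFA i) := by
  have : ∀ P, (lang P testCoNL)ᶜ = {w : List Bool |
      Graphing.meas (Graphing.exec P (expWord w)) (returnGraphing rej (.inr rfl)) ≠ 0} := fun P =>
    Set.ext fun w => not_congr (mem_lang_testCoNL_iff w)
  rw [Characterises, coTwoNFA, ← twoNFA_eq i hi rej (.inr rfl)]
  ext L
  refine exists_congr fun P => and_congr_right fun _ => ?_
  rw [← this]
  exact compl_inj_iff.symm

/-! ## Two-way automata with one head recognise the regular languages -/

theorem exists_multiheadNFA_of_le {k k' : ℕ} (hk : k ≤ k') (M : MultiheadNFA k) :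
    ∃ M' : MultiheadNFA k', M'.language = M.language := by
  obtain ⟨M', hM'⟩ := M.exists_prog hk
  refine ⟨M'.toMultihead (Equiv.refl _), ?_⟩
  rw [Prog.language_toMultihead]
  ext w
  exact (hM' w _).trans (by simp)

namespace MultiheadNFA

variable (M : MultiheadNFA 1)

/-- A step of a two-way automaton with one head. -/
def Step₁ (w : List Bool) (c c' : M.State × ℕ) : Prop :=
  ∃ d : Dir, (c'.1, fun _ => d) ∈ M.trans c.1 (fun _ => tapeAt w c.2) ∧ d.Moves c.2 c'.2 ∧
    c'.2 ≤ w.length + 1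

theorem mem_language_iff_step₁ {w : List Bool} : w ∈ M.language ↔
    ∃ c, Relation.ReflTransGen (M.Step₁ w) (M.start, 0) c ∧ c.1 ∈ M.accept := by
  have hf : ∀ {α : Type} (f : Fin 1 → α), f = fun _ => f 0 := fun f => funext fun j => by
    rw [Subsingleton.elim j 0]
  constructor
  · rintro ⟨c, h, hc⟩
    refine ⟨(c.1, c.2 0), ?_, hc⟩
    clear hc
    induction h with
    | refl => exact .refl
    | @tail b c _ h ih =>
      obtain ⟨d, h1, h2⟩ := h
      refine ih.tail ⟨d 0, ?_, h2 0⟩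
      rw [hf d, hf fun j => tapeAt w (b.2 j)] at h1
      exact h1
  · rintro ⟨c, h, hc⟩
    refine ⟨(c.1, fun _ => c.2), ?_, hc⟩
    clear hc
    induction h with
    | refl => exact .refl
    | tail _ h ih =>
      obtain ⟨d, h1, h2⟩ := h
      exact ih.tail ⟨fun _ => d, h1, fun _ => h2⟩

/-- The steps that start in a prefix `u` of the input. -/
def PrefixStep (u : List Bool) (c c' : M.State × ℕ) : Prop :=
  c.2 ≤ u.length ∧ ∃ d : Dir, (c'.1, fun _ => d) ∈ M.trans c.1 (fun _ => tapeAt u c.2) ∧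
    d.Moves c.2 c'.2

theorem _root_.IG.tapeAt_append_of_le {u z : List Bool} {p : ℕ} (hp : p ≤ u.length) :
    tapeAt (u ++ z) p = tapeAt u p := by
  rcases p with _ | p
  · rfl
  · rw [tapeAt, tapeAt, List.getElem?_append_left hp]

theorem _root_.IG.tapeAt_append_right (u z : List Bool) (i : ℕ) :
    tapeAt (u ++ z) (u.length + 1 + i) = z[i]?.elim .right .letter := by
  rw [show u.length + 1 + i = (u.length + i) + 1 by ring, tapeAt,
    List.getElem?_append_right (by omega), Nat.add_sub_cancel_left]

/-- On the left end marker and on `u` the head sees nothing of `z`, and a single move leads at most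
to |u| + 1, which is always a position of the tape. -/
theorem step₁_append_iff {u z : List Bool} {c c' : M.State × ℕ} (hc : c.2 ≤ u.length) :
    M.Step₁ (u ++ z) c c' ↔ M.PrefixStep u c c' := by
  simp only [Step₁, PrefixStep, hc, true_and, tapeAt_append_of_le hc]
  refine exists_congr fun d => and_congr_right fun _ => and_iff_left_of_imp fun h => ?_
  rw [List.length_append]
  rcases d <;> simp only [Dir.Moves] at h <;> omega

/-- The configurations in which the head enters the prefix `u`: at the beginning, or from the
right. -/
def entry (u : List Bool) : Option M.State → M.State × ℕ
  | none => (M.start, 0)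
  | some q => (q, u.length)

/-- The behaviour of an automaton on the prefix `u`: in which states it can leave it, and whether it
can accept in it. -/
def Crossing (u : List Bool) (e : Option M.State) : Option M.State → Prop
  | some q => Relation.ReflTransGen (M.PrefixStep u) (M.entry u e) (q, u.length + 1)
  | none => ∃ c, Relation.ReflTransGen (M.PrefixStep u) (M.entry u e) c ∧ c.1 ∈ M.accept

theorem reflTransGen_append {u z : List Bool} {c c' : M.State × ℕ}
    (h : Relation.ReflTransGen (M.PrefixStep u) c c') :
    Relation.ReflTransGen (M.Step₁ (u ++ z)) c c' := by
  induction h with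
  | refl => exact .refl
  | tail _ h ih => exact ih.tail ((M.step₁_append_iff h.1).2 h)

/-- A computation on `u ++ z` alternates between stretches inside `u` and stretches to its right.
Equal crossing relations allow each stretch inside `u` to be replaced by one inside `u'` with the
same entry and the same exit; the others are copied with the head shifted. -/
theorem append_mem_of_crossing_eq {u u' z : List Bool} (h : M.Crossing u = M.Crossing u')
    (hz : u ++ z ∈ M.language) : u' ++ z ∈ M.language := by
  rw [mem_language_iff_step₁] at hz ⊢
  let Good : Option M.State → Prop := fun e =>
    Relation.ReflTransGen (M.Step₁ (u' ++ z)) (M.start, 0) (M.entry u' e)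
  -- While the head is in `u`, only the last entry is matched by a computation on `u' ++ z`; the
  -- current stretch is transferred when the head leaves `u` or accepts in it.
  suffices ∀ c, Relation.ReflTransGen (M.Step₁ (u ++ z)) (M.start, 0) c →
      (c.2 ≤ u.length ∧ ∃ e, Good e ∧ Relation.ReflTransGen (M.PrefixStep u) (M.entry u e) c) ∨
      ∃ i, c.2 = u.length + 1 + i ∧
        Relation.ReflTransGen (M.Step₁ (u' ++ z)) (M.start, 0) (c.1, u'.length + 1 + i) by
    obtain ⟨c, h1, h2⟩ := hz
    rcases this c h1 with ⟨-, e, h3, h4⟩ | ⟨i, -, h3⟩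
    · have : M.Crossing u e none := ⟨c, h4, h2⟩
      rw [h] at this
      obtain ⟨c', h5, h6⟩ := this
      exact ⟨c', h3.trans (M.reflTransGen_append h5), h6⟩
    · exact ⟨_, h3, h2⟩
  intro c hc
  induction hc with
  | refl => exact .inl ⟨Nat.zero_le _, none, .refl, .refl⟩
  | @tail b c _ hs ih =>
    rcases ih with ⟨h1, e, h2, h3⟩ | ⟨i, h1, h2⟩
    · have hs := (M.step₁_append_iff h1).1 hs
      by_cases hc : c.2 ≤ u.length
      · exact .inl ⟨hc, e, h2, h3.tail hs⟩
      · have hc' : c.2 = u.length + 1 := by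
          obtain ⟨-, d, -, hd⟩ := hs
          rcases d <;> simp only [Dir.Moves] at hd <;> omega
        have : M.Crossing u e (some c.1) := by
          change Relation.ReflTransGen _ _ _
          rw [← hc']
          exact h3.tail hs
        rw [h] at this
        exact .inr ⟨0, hc', h2.trans (M.reflTransGen_append this)⟩
    · obtain ⟨d, h3, h4, h5⟩ := hs
      rw [h1, tapeAt_append_right] at h3
      have key : ∀ v, d.Moves (u'.length + 1 + i) v → v ≤ (u' ++ z).length + 1 →
          Relation.ReflTransGen (M.Step₁ (u' ++ z)) (M.start, 0) (c.1, v) := by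
        intro v h6 h7
        refine h2.tail ⟨d, ?_, h6, h7⟩
        rw [tapeAt_append_right]
        exact h3
      rw [List.length_append] at h5 key
      by_cases hc : c.2 ≤ u.length
      · refine .inl ⟨hc, some c.1, key _ ?_ (by omega), ?_⟩
        · rcases d <;> simp only [Dir.Moves] at h4 ⊢ <;> omega
        · have : c.2 = u.length := by
            rcases d <;> simp only [Dir.Moves] at h4 <;> omega
          rw [entry, ← this]
      · refine .inr ⟨c.2 - (u.length + 1), by omega, key _ ?_ (by omega)⟩
        rcases d <;> simp only [Dir.Moves] at h4 ⊢ <;> omega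

/-- Left quotients depend on the crossing relation only, and there are finitely many relations on a
finite set, so the theorem of Myhill and Nerode applies. -/
theorem isRegular_language : M.language.IsRegular := by
  rw [Language.isRegular_iff_finite_range_leftQuotient]
  have := M.finite_state
  have hf : M.language.leftQuotient.FactorsThrough M.Crossing := fun u u' h =>
    Set.ext fun z => ⟨M.append_mem_of_crossing_eq h, M.append_mem_of_crossing_eq h.symm⟩
  refine (finite_range (Function.extend M.Crossing M.language.leftQuotient
    (fun _ => (∅ : Set (List Bool))))).subset ?_
  rintro _ ⟨u, rfl⟩
  exact ⟨M.Crossing u, hf.extend_apply _ u⟩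

end MultiheadNFA

/-- A deterministic automaton as a two-way automaton with one head. -/
def ofDFA {σ : Type} [Fintype σ] (M : DFA Bool σ) : MultiheadNFA 1 where
  State := Option (Option σ)
  finite_state := inferInstance
  start := none
  accept := {some none}
  trans q s := {x | match q, s 0 with
    | none, .left => x = (some (some M.start), fun _ => .right)
    | some (some q), .letter b => x = (some (some (M.step q b)), fun _ => .right)
    | some (some q), .right => q ∈ M.accept ∧ x = (some none, fun _ => .stay)
    | _, _ => False}

theorem language_ofDFA {σ : Type} [Fintype σ] (M : DFA Bool σ) :
    (ofDFA M).language = M.accepts := by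
  ext w
  rw [MultiheadNFA.mem_language_iff_step₁]
  constructor
  · rintro ⟨⟨q, p⟩, h, hq⟩
    obtain rfl : q = some none := hq
    suffices ∀ c, Relation.ReflTransGen ((ofDFA M).Step₁ w) ((ofDFA M).start, 0) c →
        match c with
        | (none, _) => True
        | (some none, _) => w ∈ M.accepts
        -- After `i` letters the head is at `i + 1`, as the left end marker occupies the position 0.
        | (some (some q), p) => ∃ i ≤ w.length, p = i + 1 ∧ q = M.eval (w.take i) from this _ h
    intro c hc
    induction hc with
    | refl => trivial
    | @tail b c _ hs ih =>
      obtain ⟨d, h1, h2, h3⟩ := hs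
      obtain ⟨_ | _ | q, p⟩ := b
      · simp only at h1
        generalize hs : tapeAt w p = s at h1
        obtain _ | b | _ := s
        · obtain ⟨q', p'⟩ := c
          have h1 : (q', fun _ : Fin 1 => d) = (some (some M.start), fun _ => .right) := h1
          obtain ⟨rfl, hd⟩ := Prod.ext_iff.1 h1
          obtain rfl : d = .right := congrFun hd 0
          obtain rfl := tapeAt_eq_left.1 hs
          exact ⟨0, Nat.zero_le _, h2, by simp⟩
        · exact (show False from h1).elim
        · exact (show False from h1).elim
      · exact (show False from h1).elim
      · obtain ⟨i, hi, rfl, rfl⟩ := ih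
        simp only at h1
        generalize hs : tapeAt w (i + 1) = s at h1
        obtain _ | b | _ := s
        · exact (show False from h1).elim
        · obtain ⟨q', p'⟩ := c
          have h1 : (q', fun _ : Fin 1 => d) = (some (some (M.step _ b)), fun _ => .right) := h1
          obtain ⟨rfl, hd⟩ := Prod.ext_iff.1 h1
          obtain rfl : d = .right := congrFun hd 0
          have hi' : i < w.length := by
            by_contra h
            rw [tapeAt_eq_right.2 (by omega)] at hs
            cases hs
          have hb : w[i] = b := by simpa [tapeAt, hi'] using hs
          refine ⟨i + 1, hi', h2, ?_⟩
          rw [List.take_succ_eq_append_getElem hi', DFA.eval_append_singleton, hb]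
        · obtain ⟨q', p'⟩ := c
          obtain ⟨h4, h5⟩ : M.eval (w.take i) ∈ M.accept ∧
            (q', fun _ : Fin 1 => d) = (some none, fun _ => .stay) := h1
          obtain ⟨rfl, hd⟩ := Prod.ext_iff.1 h5
          have := tapeAt_eq_right.1 hs
          rw [List.take_of_length_le (by omega)] at h4
          exact h4
  · intro hw
    have key : ∀ i ≤ w.length, Relation.ReflTransGen ((ofDFA M).Step₁ w) ((ofDFA M).start, 0)
        (some (some (M.eval (w.take i))), i + 1) := by
      intro i
      induction i with
      | zero => exact fun _ => .single ⟨.right, rfl, rfl, by simp⟩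
      | succ i ih =>
        intro hi
        refine (ih (by omega)).tail ⟨.right, ?_, rfl, by omega⟩
        have : tapeAt w (i + 1) = .letter w[i] := by simp [tapeAt, show i < w.length from hi]
        simp only [this]
        rw [List.take_succ_eq_append_getElem hi, DFA.eval_append_singleton]
        rfl
    refine ⟨(some none, w.length + 1), (key _ le_rfl).tail ⟨.stay, ?_, rfl, le_rfl⟩, rfl⟩
    simp only [tapeAt_eq_right.2 (Nat.lt_succ_self w.length)]
    refine ⟨?_, rfl⟩
    rwa [List.take_length]

theorem twoNFA_one : twoNFA 1 = regular := by
  ext L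
  constructor
  · rintro ⟨k, hk, M, rfl⟩
    obtain ⟨M', h⟩ := exists_multiheadNFA_of_le (by exact_mod_cast hk : k ≤ 1) M
    rw [← h]
    exact M'.isRegular_language
  · rintro ⟨σ, _, M, rfl⟩
    exact ⟨1, le_rfl, ofDFA M, (language_ofDFA M).symm⟩

theorem coTwoNFA_one : coTwoNFA 1 = regular := by
  ext L
  rw [coTwoNFA, twoNFA_one]
  exact Language.IsRegular_compl

/-! ## Arithmetic with heads -/

section Arith

variable {ι : Type} [DecidableEq ι] {j z : ι}

/-- All heads are on the tape, and the head `z` is on the left end marker. -/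
def Clear (z : ι) (w : List Bool) (p : ι → ℕ) : Prop := p z = 0 ∧ ∀ i, p i ≤ w.length + 1

theorem locImpl_sub (j : ι) (a : ℕ) :
    LocImpl hAct j (fun w u => u ≤ w.length + 1) fun _ u v => u = v + a := by
  induction a with
  | zero => exact LocImpl.skip
  | succ a ih =>
    refine (ih.seq (fun w u v hu h => by omega) (locImpl_hRel univ .left)).congr (fun _ _ h => h)
      fun w u hu v => ⟨?_, ?_⟩
    · rintro ⟨x, rfl, -, h, -⟩
      have h : x = v + 1 := h
      omega
    · rintro rfl
      exact ⟨v + 1, by omega, trivial, rfl, by omega⟩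

theorem locImpl_add (j : ι) (a : ℕ) :
    LocImpl hAct j (fun w u => u ≤ w.length + 1) fun w u v => v = u + a ∧ v ≤ w.length + 1 := by
  induction a with
  | zero =>
    refine LocImpl.skip.congr (fun _ _ h => h) fun w u hu v => ⟨?_, ?_⟩
    · rintro rfl; exact ⟨rfl, hu⟩
    · rintro ⟨rfl, -⟩; rfl
  | succ a ih =>
    refine (ih.seq (fun w u v hu h => h.2) (locImpl_hRel univ .right)).congr (fun _ _ h => h)
      fun w u hu v => ⟨?_, ?_⟩
    · rintro ⟨x, ⟨rfl, -⟩, -, h, h'⟩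
      have h : v = u + a + 1 := h
      omega
    · rintro ⟨rfl, h⟩
      exact ⟨u + a, ⟨rfl, by omega⟩, trivial, rfl, h⟩

/-- Repeatedly subtract `a` from the number with index `j` and add `c` to the number with index `z`,
until the former is zero. -/
theorem impl_transfer {Λ C : Type} {𝒮 : List Bool → Sem Λ C (ι → ℕ)}
    {V V' : List Bool → (ι → ℕ) → Prop} (hjz : j ≠ z) {a c : ℕ}
    (h1 : Impl 𝒮 V fun _ => locRel j fun u v => u = v + a)
    (hV1 : ∀ w p p', V w p → locRel j (fun u v => u = v + a) p p' → V' w p')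
    (h2 : Impl 𝒮 V' fun w => locRel z fun u v => v = u + c ∧ v ≤ w.length + 1)
    (hV2 : ∀ w p p', V' w p → locRel z (fun u v => v = u + c ∧ v ≤ w.length + 1) p p' → V w p')
    (h3 : Impl 𝒮 V fun _ => locRel j fun u v => u = 0 ∧ v = u)
    (hz : ∀ w p, V w p → p z ≤ w.length + 1) :
    Impl 𝒮 V fun w p p' => ∃ m, p j = m * a ∧ p z + m * c ≤ w.length + 1 ∧
      p' = Function.update (Function.update p j 0) z (p z + m * c) := by
  -- `V` holds between the rounds and `V'` after the subtraction within a round. For counters with a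
  -- bounded sum, `V'` records the room that the subtraction has made for the addition.
  have hbody := h1.seq hV1 h2
  have hVb : ∀ w p p', V w p → Relation.Comp (locRel j fun u v => u = v + a)
      (locRel z fun u v => v = u + c ∧ v ≤ w.length + 1) p p' → V w p' :=
    fun w p p' hp ⟨x, h, h'⟩ => hV2 w _ _ (hV1 w _ _ hp h) h'
  have hstar := hbody.star hVb
  have hVs : ∀ w p p', V w p → Relation.ReflTransGen (Relation.Comp (locRel j fun u v => u = v + a)
      (locRel z fun u v => v = u + c ∧ v ≤ w.length + 1)) p p' → V w p' := by
    intro w p p' hp h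
    induction h with
    | refl => exact hp
    | tail _ h ih => exact hVb w _ _ ih h
  refine (hstar.seq hVs h3).congr (fun _ _ h => h) fun w p hp p' => ⟨?_, ?_⟩
  · rintro ⟨x, h, v, ⟨h3, h4⟩, rfl⟩
    -- Here `m` is the number of completed rounds. The loop may stop at any time, and the final test
    -- for zero admits only the moment at which `m * a` exhausts the number.
    suffices ∃ m, p j = x j + m * a ∧ p z + m * c ≤ w.length + 1 ∧
        x = Function.update (Function.update p j (x j)) z (p z + m * c) by
      obtain ⟨m, h5, h6, h7⟩ := this
      refine ⟨m, by omega, h6, ?_⟩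
      simp only [h4, Function.update_eq_self]
      rw [h7, h3]
    clear h3 h4
    induction h with
    | refl => exact ⟨0, by simp, by simpa using hz w p hp, by simp⟩
    | @tail x y _ h ih =>
      obtain ⟨m, h5, h6, h7⟩ := ih
      obtain ⟨_, ⟨v, h8, rfl⟩, v', ⟨rfl, h9⟩, rfl⟩ := h
      rw [Function.update_of_ne hjz.symm] at h9 ⊢
      have hx : x z = p z + m * c := by rw [h7]; simp
      refine ⟨m + 1, ?_, by rw [add_mul]; omega, ?_⟩
      · rw [Function.update_of_ne hjz, Function.update_self, add_mul]; omega
      · funext i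
        have h7 := congrFun h7 i
        by_cases hi : i = z
        · subst hi
          simp only [Function.update_self]
          rw [add_mul]; omega
        · simp only [ne_eq, hi, not_false_eq_true, Function.update_of_ne] at h7 ⊢
          by_cases hi' : i = j
          · subst hi'; simp [hjz]
          · simpa [hi'] using h7
  · rintro ⟨m, h1, h2, rfl⟩
    refine ⟨Function.update (Function.update p j 0) z (p z + m * c), ?_, 0, ⟨?_, ?_⟩, ?_⟩
    · clear hp
      induction m generalizing p with
      | zero =>
        have : Function.update (Function.update p j 0) z (p z + 0 * c) = p := by
          rw [zero_mul] at h1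
          rw [zero_mul, add_zero, ← h1, Function.update_eq_self, Function.update_eq_self]
        rw [this]
      | succ m ih =>
        rw [add_mul] at h1 h2
        let y := Function.update (Function.update p j (m * a)) z (p z + c)
        have hyz : y z = p z + c := by simp [y]
        have hyj : y j = m * a := by simp [y, hjz]
        have := ih y hyj (by rw [hyz]; omega)
        refine .head ⟨Function.update p j (m * a), ⟨_, by omega, rfl⟩, p z + c, ⟨?_, by omega⟩, rfl⟩ ?_
        · simp [hjz.symm]
        · convert this using 1
          funext i
          by_cases hi : i = z
          · subst hi; simp only [Function.update_self, hyz]; ring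
          · by_cases hi' : i = j
            · subst hi'; simp [hi]
            · simp [hi, hi', y]
    · simp [hjz]
    · simp [hjz]
    · funext i
      by_cases hi : i = j
      · subst hi; simp [hjz]
      · simp [hi]

theorem impl_head_transfer (hjz : j ≠ z) (a c : ℕ) :
    Impl (hSem ι) (fun w p => ∀ i, p i ≤ w.length + 1) fun w p p' => ∃ m, p j = m * a ∧
      p z + m * c ≤ w.length + 1 ∧
        p' = Function.update (Function.update p j 0) z (p z + m * c) := by
  have hV : ∀ {w : List Bool} {p p' : ι → ℕ} {i : ι} {r : ℕ → ℕ → Prop},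
      (∀ i, p i ≤ w.length + 1) → locRel i r p p' → (∀ v, r (p i) v → v ≤ w.length + 1) →
      ∀ i, p' i ≤ w.length + 1 := by
    rintro w p _ i r hp ⟨v, hv, rfl⟩ h i'
    by_cases hi : i' = i
    · subst hi; simpa using h v hv
    · simpa [hi] using hp i'
  refine impl_transfer hjz ((locImpl_sub j a).mono fun w p hp => hp j)
    (fun w p p' hp h => hV hp h fun v hv => by have := hp j; omega)
    ((locImpl_add z c).mono fun w p hp => hp z)
    (fun w p p' hp h => hV hp h fun v hv => hv.2) ?_ fun w p hp => hp z
  refine (Impl.act_exact (act := hAct) (j, {TapeSym.left}, Dir.stay)).congr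
    (V := fun _ _ => True) (fun _ _ _ => trivial) fun w p hp p' => ?_
  refine exists_congr fun v => and_congr_left fun _ => ?_
  have := hp j
  simp only [hRel, mem_singleton_iff, tapeAt_eq_left, Dir.Moves]
  omega

/-- Replace a multiple `m * a` by the multiple `m * c`, with the help of the head `z`. -/
theorem impl_scale (hjz : j ≠ z) (a c : ℕ) : Impl (hSem ι) (Clear z) fun w =>
    locRel j fun u v => ∃ m, u = m * a ∧ v = m * c ∧ v ≤ w.length + 1 := by
  -- The first transfer changes the scale from `a` to `c` while it fills the empty head `z`; the
  -- second one brings the result back and leaves `z` empty again.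
  refine ((impl_head_transfer hjz a c).seq ?_ (impl_head_transfer hjz.symm 1 1)).congr (fun w p hp => hp.2)
    fun w p hp p' => ⟨?_, ?_⟩
  · rintro w p _ hp ⟨m, h1, h2, rfl⟩ i
    by_cases hi : i = z
    · subst hi; simpa using h2
    · by_cases hi' : i = j
      · subst hi'; simp [hi]
      · simpa [hi, hi'] using hp i
  · rintro ⟨_, ⟨m, h1, h2, rfl⟩, m', h3, h4, rfl⟩
    simp only [Function.update_self, hp.1, zero_add, mul_one] at h2 h3
    subst h3
    refine ⟨m * c, ⟨m, h1, rfl, h2⟩, funext fun i => ?_⟩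
    by_cases hi : i = j
    · subst hi; simp [hjz]
    · by_cases hi' : i = z
      · subst hi'; simp [hi, hp.1]
      · simp [hi, hi']
  · rintro ⟨_, ⟨m, h1, rfl, h2⟩, rfl⟩
    refine ⟨_, ⟨m, h1, by rw [hp.1]; omega, rfl⟩, m * c, ?_, ?_, funext fun i => ?_⟩
    · simp [hp.1]
    · simpa [hjz] using h2
    · by_cases hi : i = j
      · subst hi; simp [hjz]
      · by_cases hi' : i = z
        · subst hi'; simp [hi, hp.1]
        · simp [hi, hi']

theorem Clear.update {w : List Bool} {p p' : ι → ℕ} (hjz : j ≠ z) (hp : Clear z w p)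
    {r : ℕ → ℕ → Prop} (h : locRel j r p p') (hr : ∀ v, r (p j) v → v ≤ w.length + 1) :
    Clear z w p' := by
  obtain ⟨v, hv, rfl⟩ := h
  refine ⟨by simpa [hjz.symm] using hp.1, fun i => ?_⟩
  by_cases hi : i = j
  · subst hi; simpa using hr v hv
  · simpa [hi] using hp.2 i

/-- Append a binary digit to the number represented by a head. -/
theorem impl_push (hjz : j ≠ z) (c : ℕ) : Impl (hSem ι) (Clear z) fun w =>
    locRel j fun u v => v = 2 * u + c ∧ v ≤ w.length + 1 := by
  refine ((impl_scale hjz 1 2).seq (fun w p p' hp h => hp.update hjz h ?_)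
    ((locImpl_add j c).mono fun w p hp => hp.2 j)).congr (fun _ _ h => h) fun w p hp p' => ⟨?_, ?_⟩
  · rintro v ⟨m, -, -, h⟩; exact h
  · rintro ⟨_, ⟨_, ⟨m, h1, rfl, h2⟩, rfl⟩, v, ⟨h3, h4⟩, rfl⟩
    simp only [Function.update_self] at h3
    exact ⟨v, ⟨by omega, h4⟩, by simp⟩
  · rintro ⟨v, ⟨h1, h2⟩, rfl⟩
    refine ⟨_, ⟨_, ⟨p j, by omega, rfl, by omega⟩, rfl⟩, v, ⟨?_, h2⟩, by simp⟩
    simp only [Function.update_self]; omega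

/-- Remove the last binary digit, which has to be `c`, of the number represented by a head. -/
theorem impl_pop (hjz : j ≠ z) (c : ℕ) : Impl (hSem ι) (Clear z) fun _ =>
    locRel j fun u v => u = 2 * v + c := by
  refine (((locImpl_sub j c).mono fun w p (hp : Clear z w p) => hp.2 j).seq
    (fun w p p' hp h => hp.update hjz h ?_) (impl_scale hjz 2 1)).congr (fun _ _ h => h)
    fun w p hp p' => ⟨?_, ?_⟩
  · intro v hv
    have := hp.2 j
    omega
  · rintro ⟨_, ⟨v, h1, rfl⟩, v', ⟨m, h2, rfl, h3⟩, rfl⟩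
    simp only [Function.update_self] at h2
    exact ⟨m * 1, by omega, by simp⟩
  · rintro ⟨v, h1, rfl⟩
    have := hp.2 j
    refine ⟨_, ⟨2 * v, h1, rfl⟩, v, ⟨v, ?_, by omega, by omega⟩, by simp⟩
    simp only [Function.update_self]; omega

end Arith

/-! ## Two stacks of digits -/

/-- The number whose binary digits are the values of `f` at those numbers below `h` that satisfy
`P`; the digit at the greatest of them is the last one. -/
def below (P : ℕ → Prop) [DecidablePred P] (f : ℕ → ℕ) : ℕ → ℕ
  | 0 => 0
  | h + 1 => if P h then 2 * below P f h + f h else below P f h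

/-- The number whose binary digits are the values of `f` at those numbers among the `m` successors
of `h` that satisfy `P`; the digit at the least of them is the last one. -/
def above (P : ℕ → Prop) [DecidablePred P] (f : ℕ → ℕ) : ℕ → ℕ → ℕ
  | 0, _ => 0
  | m + 1, h => if P (h + 1) then 2 * above P f m (h + 1) + f (h + 1) else above P f m (h + 1)

section Digits

variable {P : ℕ → Prop} [DecidablePred P] {f g : ℕ → ℕ}

theorem below_congr {h : ℕ} (hfg : ∀ i < h, f i = g i) : below P f h = below P g h := by
  induction h with
  | zero => rfl
  | succ h ih =>
    rw [below, below, ih fun i hi => hfg i (hi.trans h.lt_succ_self), hfg h h.lt_succ_self]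

theorem above_congr {m h : ℕ} (hfg : ∀ i, h < i → f i = g i) : above P f m h = above P g m h := by
  induction m generalizing h with
  | zero => rfl
  | succ m ih =>
    rw [above, above, ih fun i hi => hfg i (h.lt_succ_self.trans hi), hfg _ h.lt_succ_self]

theorem above_eq_zero {m h : ℕ} (hf : ∀ i, f i = 0) : above P f m h = 0 := by
  induction m generalizing h with
  | zero => rfl
  | succ m ih => rw [above, ih, hf, mul_zero, ite_self]

/-- The number has one binary digit for each position that satisfies `P`. The estimates for both
stacks bound the values of the heads. -/
theorem below_lt (hf : ∀ i, f i ≤ 1) (h : ℕ) : below P f h + 1 ≤ 2 ^ Nat.count P h := by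
  induction h with
  | zero => simp [below]
  | succ h ih =>
    rw [below, Nat.count_succ]
    have := hf h
    split_ifs
    · rw [pow_succ]; omega
    · exact ih

theorem above_lt (hf : ∀ i, f i ≤ 1) (m h : ℕ) :
    (above P f m h + 1) * 2 ^ Nat.count P (h + 1) ≤ 2 ^ Nat.count P (h + 1 + m) := by
  induction m generalizing h with
  | zero => simp [above]
  | succ m ih =>
    have h1 := ih (h + 1)
    rw [Nat.count_succ, show h + 1 + 1 + m = h + 1 + (m + 1) by ring] at h1
    refine le_trans ?_ h1
    rw [above]
    have := hf (h + 1)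
    split_ifs
    · rw [pow_succ, mul_comm (2 ^ _) 2, ← mul_assoc]
      exact Nat.mul_le_mul_right _ (by omega)
    · exact le_rfl

theorem count_mod_le {B r : ℕ} (hB : 0 < B) (hr : r < B) (K : ℕ) :
    Nat.count (fun i => i % B = r) (B * K) = K := by
  have := Nat.count_modEq_card (b := B * K) hB r
  simp only [Nat.ModEq, Nat.mod_eq_of_lt hr] at this
  rw [this]
  simp [hB]

end Digits

/-- The digit of the symbol `x` on the track of the symbol `a`. -/
def digit {α : Type} [DecidableEq α] (z x a : α) : ℕ := if x = a ∧ a ≠ z then 1 else 0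

theorem digit_le {α : Type} [DecidableEq α] (z x a : α) : digit z x a ≤ 1 := by
  unfold digit; split_ifs <;> simp

theorem digit_self {α : Type} [DecidableEq α] (z a : α) : digit z z a = 0 := by
  unfold digit; split_ifs with h
  · exact absurd h.1.symm h.2
  · rfl

/-- A symbol other than `z` shows on its own track, and `z` is the only one that shows on none.
Leaving `z` without a trace makes the blank tape all zeros. -/
theorem eq_of_digit_eq {α : Type} [DecidableEq α] {z x y : α}
    (h : ∀ a, digit z x a = digit z y a) : x = y := by
  by_contra hne
  have h1 := h x
  have h2 := h y
  simp only [digit, true_and, Ne.symm hne, hne, false_and, if_false] at h1 h2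
  by_cases hx : x = z
  · subst hx
    simp [Ne.symm hne] at h2
  · simp [hx] at h1

/-- Adding one either raises the remainder or carries into the quotient. As the remainders are part
of the finite control, the case is known when the program is built. -/
theorem mul_add_eq_iff {B u v r r' : ℕ} (hr : r < B) (hr' : r' < B) :
    B * v + r' = B * u + r + 1 ↔ r' = r + 1 ∧ v = u ∨ r' = 0 ∧ r + 1 = B ∧ v = u + 1 := by
  constructor
  · intro h
    rcases lt_trichotomy v u with hv | rfl | hv
    · obtain ⟨k, rfl⟩ := Nat.exists_eq_add_of_lt hv
      have : B * (v + k + 1) = B * v + B * k + B := by ring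
      have := Nat.zero_le (B * k)
      omega
    · exact .inl ⟨by omega, rfl⟩
    · obtain ⟨k, rfl⟩ := Nat.exists_eq_add_of_lt hv
      have : B * (u + k + 1) = B * u + B * k + B := by ring
      rcases k with _ | k
      · exact .inr ⟨by omega, by omega, rfl⟩
      · have : B * (k + 1) = B * k + B := by ring
        have := Nat.zero_le (B * k)
        omega
  · rintro (⟨rfl, rfl⟩ | ⟨rfl, rfl, rfl⟩) <;> ring

/-! ## Simulation of Turing machines by automata with several heads -/

namespace NTM

/-- The heads of the simulating automaton: the input head, a head for the quotient of the position
of the work head by `B`, an auxiliary head, and, for each side of the work head, each remainder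
modulo `B` and each symbol, a head for the positions of this symbol. -/
abbrev Reg (B : ℕ) (α : Type) : Type := Option (Option (Option (Bool × Fin B × α)))

/-- The auxiliary head. -/
abbrev aux {B : ℕ} {α : Type} : Reg B α := some (some none)

/-- Append a digit, or do nothing. -/
def pushRel (w : List Bool) (b : Prop) (c u v : ℕ) : Prop :=
  b ∧ v = 2 * u + c ∧ v ≤ w.length + 1 ∨ ¬ b ∧ u = v

/-- Remove a digit, or do nothing. -/
def popRel (b : Prop) (c u v : ℕ) : Prop := b ∧ u = 2 * v + c ∨ ¬ b ∧ u = v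

variable (M : NTM)

section

variable [DecidableEq M.Work]

/-- The positions of the heads that represent a configuration whose work tape is considered up to
the position `N`. -/
def encode (B N : ℕ) (c : M.Config) : Reg B M.Work → ℕ
  | none => c.inPos
  | some none => c.workPos / B
  | some (some none) => 0
  | some (some (some (false, r, a))) =>
    below (fun i => i % B = r) (fun i => digit M.blank (c.work i) a) c.workPos
  | some (some (some (true, r, a))) =>
    above (fun i => i % B = r) (fun i => digit M.blank (c.work i) a) (N - 1 - c.workPos) c.workPos

/-- The movement of a head of the simulating automaton, for a step that reads `s`, writes `x`, moves
in the directions `d` and `e`, and leads from a cell with remainder `ρ` to a cell with remainder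
`ρ'` that contains `y`. -/
def regRel {B : ℕ} (w : List Bool) (s : TapeSym) (x y : M.Work) (d e : Dir) (ρ ρ' : Fin B) :
    Reg B M.Work → ℕ → ℕ → Prop
  | none => hRel w {s} d
  | some none => fun u v => match e with
    | .left => B * u + ρ = B * v + ρ' + 1
    | .stay => u = v ∧ ρ = ρ' ∧ x = y
    | .right => B * v + ρ' = B * u + ρ + 1 ∧ v ≤ w.length + 1
  | some (some none) => Eq
  | some (some (some (t, r, a))) => match e, t with
    | .left, true => pushRel w (ρ = r) (digit M.blank x a)
    | .left, false => popRel (ρ' = r) (digit M.blank y a)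
    | .stay, _ => Eq
    | .right, false => pushRel w (ρ = r) (digit M.blank x a)
    | .right, true => popRel (ρ' = r) (digit M.blank y a)

variable {M} {B N K : ℕ} {w : List Bool}

/-- A residue class modulo `B` has exactly `K` positions below `B * K`, so each stack holds at most
`K` digits and its value is less than 2^K ≤ |w| + 2. Cutting the tape into residue classes serves to
make `K` this small. -/
theorem encode_le (hB : 0 < B) {c : M.Config} (hc : c.workPos < B * K)
    (hi : c.inPos ≤ w.length + 1) (hK : 2 ^ K ≤ w.length + 2) (i : Reg B M.Work) :
    M.encode B (B * K) c i ≤ w.length + 1 := by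
  rcases i with _ | _ | _ | ⟨_ | _, r, a⟩
  · exact hi
  · have h1 : c.workPos / B < K := Nat.div_lt_of_lt_mul hc
    have h2 : K < 2 ^ K := Nat.lt_two_pow_self
    change c.workPos / B ≤ _
    omega
  · exact Nat.zero_le _
  · have h1 := below_lt (P := fun i => i % B = r) (f := fun i => digit M.blank (c.work i) a)
      (fun i => digit_le _ _ _) c.workPos
    have h2 := Nat.pow_le_pow_right (show 0 < 2 by norm_num)
      (Nat.count_monotone (fun i => i % B = r) hc.le)
    rw [count_mod_le hB r.2] at h2
    change below _ _ _ ≤ _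
    omega
  · have h1 := above_lt (P := fun i => i % B = r) (f := fun i => digit M.blank (c.work i) a)
      (fun i => digit_le _ _ _) (B * K - 1 - c.workPos) c.workPos
    rw [show c.workPos + 1 + (B * K - 1 - c.workPos) = B * K by omega,
      count_mod_le hB r.2] at h1
    have h2 := (Nat.le_mul_of_pos_right _ (by positivity)).trans h1
    change above _ _ _ _ ≤ _
    omega

/-- Once the control has guessed the next remainder and symbol, nothing is left to choose for the
heads. Together with `regRel_encode` this identifies the positions that they reach with the encoding
of the next configuration. -/
theorem regRel_functional {s : TapeSym} {x y : M.Work} {d e : Dir} {ρ ρ' : Fin B}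
    {i : Reg B M.Work} {u v v' : ℕ} (h : M.regRel w s x y d e ρ ρ' i u v)
    (h' : M.regRel w s x y d e ρ ρ' i u v') : v = v' := by
  have hp : ∀ {b : Prop} {c}, pushRel w b c u v → pushRel w b c u v' → v = v' := by
    rintro b c (h | h) (h' | h')
    · omega
    · exact absurd h.1 h'.1
    · exact absurd h'.1 h.1
    · omega
  have hq : ∀ {b : Prop} {c}, popRel b c u v → popRel b c u v' → v = v' := by
    rintro b c (h | h) (h' | h')
    · omega
    · exact absurd h.1 h'.1
    · exact absurd h'.1 h.1
    · omega
  have hB : 0 < B := ρ.pos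
  rcases i with _ | _ | _ | ⟨t, r, a⟩
  · obtain ⟨-, h, -⟩ := h
    obtain ⟨-, h', -⟩ := h'
    cases d <;> simp only [Dir.Moves] at h h' <;> omega
  · cases e
    · have h : B * u + ρ = B * v + ρ' + 1 := h
      have h' : B * u + ρ = B * v' + ρ' + 1 := h'
      exact Nat.eq_of_mul_eq_mul_left hB (by omega)
    · exact h.1.symm.trans h'.1
    · have h := h.1
      have h' := h'.1
      exact Nat.eq_of_mul_eq_mul_left hB (by omega)
  · exact h.symm.trans h'
  · cases e <;> cases t
    · exact hq h h'
    · exact hp h h'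
    · exact h.symm.trans h'
    · exact h.symm.trans h'
    · exact hp h h'
    · exact hq h h'

/-- The symbol under the work head is kept in the control, not in a stack. A movement pushes the
written symbol onto the stacks of the side that is left behind, in the residue class of the old
position, and pops the new symbol from the stacks of the other side, in the class of the new
position. -/
theorem regRel_encode (hB : 0 < B) (hK : 2 ^ K ≤ w.length + 2) {c c' : M.Config} {x : M.Work}
    {d e : Dir} (h1 : c'.work = Function.update c.work c.workPos x)
    (hd : d.Moves c.inPos c'.inPos) (hi : c'.inPos ≤ w.length + 1)
    (he : e.Moves c.workPos c'.workPos) (hc : c.workPos < B * K) (hc' : c'.workPos < B * K)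
    (i : Reg B M.Work) :
    M.regRel w (tapeAt w c.inPos) x (c'.work c'.workPos) d e ⟨c.workPos % B, Nat.mod_lt _ hB⟩
      ⟨c'.workPos % B, Nat.mod_lt _ hB⟩ i (M.encode B (B * K) c i) (M.encode B (B * K) c' i) := by
  -- A push and an advance of the quotient demand that the result be a position of the tape; this is
  -- where the space bound enters.
  have hle := encode_le hB hc' hi hK i
  have hx : c'.work c.workPos = x := by rw [h1, Function.update_self]
  have hw : ∀ i, i ≠ c.workPos → c'.work i = c.work i := fun i hi => by
    rw [h1, Function.update_of_ne hi]
  rcases i with _ | _ | _ | ⟨t, r, a⟩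
  · exact ⟨rfl, hd, hi⟩
  · have e1 := Nat.div_add_mod c.workPos B
    have e2 := Nat.div_add_mod c'.workPos B
    cases e
    · have he : c.workPos = c'.workPos + 1 := he
      change B * (c.workPos / B) + c.workPos % B = B * (c'.workPos / B) + c'.workPos % B + 1
      omega
    · have he : c'.workPos = c.workPos := he
      refine ⟨?_, Fin.ext ?_, ?_⟩
      · change c.workPos / B = c'.workPos / B
        rw [he]
      · change c.workPos % B = c'.workPos % B
        rw [he]
      · rw [he, hx]
    · have he : c'.workPos = c.workPos + 1 := he
      refine ⟨?_, hle⟩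
      change B * (c'.workPos / B) + c'.workPos % B = B * (c.workPos / B) + c.workPos % B + 1
      omega
  · rfl
  · have hb : ∀ h ≤ c.workPos, below (fun i => i % B = r) (fun i => digit M.blank (c'.work i) a) h =
        below (fun i => i % B = r) (fun i => digit M.blank (c.work i) a) h := fun h hh =>
      below_congr fun i hi => by rw [hw i (by omega)]
    have ha : ∀ m h, c.workPos ≤ h →
        above (fun i => i % B = r) (fun i => digit M.blank (c'.work i) a) m h =
        above (fun i => i % B = r) (fun i => digit M.blank (c.work i) a) m h := fun m h hh =>
      above_congr fun i hi => by rw [hw i (by omega)]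
    cases e
    · have he : c.workPos = c'.workPos + 1 := he
      have hm : B * K - 1 - c'.workPos = B * K - 1 - c.workPos + 1 := by omega
      cases t
      · change popRel _ _ (below _ _ _) (below _ _ _)
        rw [← hb _ le_rfl, he, below, popRel, Fin.ext_iff]
        split_ifs with h
        · exact .inl ⟨h, rfl⟩
        · exact .inr ⟨h, rfl⟩
      · change pushRel _ _ _ (above _ _ _ _) (above _ _ _ _)
        change above _ _ _ _ ≤ _ at hle
        rw [hm, above, ← he, hx, ha _ _ le_rfl] at hle ⊢
        rw [pushRel, Fin.ext_iff]
        split_ifs at hle ⊢ with h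
        · exact .inl ⟨h, rfl, hle⟩
        · exact .inr ⟨h, rfl⟩
    · have he : c'.workPos = c.workPos := he
      cases t
      · change below _ _ _ = below _ _ _
        rw [he, hb _ le_rfl]
      · change above _ _ _ _ = above _ _ _ _
        rw [he, ha _ _ le_rfl]
    · have he : c'.workPos = c.workPos + 1 := he
      have hm : B * K - 1 - c.workPos = B * K - 1 - c'.workPos + 1 := by omega
      cases t
      · change pushRel _ _ _ (below _ _ _) (below _ _ _)
        change below _ _ _ ≤ _ at hle
        rw [he, below, hx, hb _ le_rfl] at hle ⊢
        rw [pushRel, Fin.ext_iff]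
        split_ifs at hle ⊢ with h
        · exact .inl ⟨h, rfl, hle⟩
        · exact .inr ⟨h, rfl⟩
      · change popRel _ _ (above _ _ _ _) (above _ _ _ _)
        rw [hm, ← ha _ _ le_rfl, above, popRel, Fin.ext_iff, ← he]
        split_ifs with h
        · exact .inl ⟨h, rfl⟩
        · exact .inr ⟨h, rfl⟩

end

end NTM

/-! ### Correctness of the simulation and its program -/

namespace NTM

section

variable {M : NTM} [DecidableEq M.Work] {B K : ℕ} {w : List Bool}

/-- The new quotient and the guessed remainder determine the position of the work head, hence the
configuration `c'`. That the guesses agree with `c'` is claimed only below `B * K`, where the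
encoding is faithful; there the true encoding satisfies the same relations and can be compared with
`p'`. -/
theorem exists_step_of_regRel (hB : 0 < B) (hK : 2 ^ K ≤ w.length + 2) {c : M.Config}
    (hc : c.workPos < B * K) {q' : M.State} {s : TapeSym} {x y : M.Work} {d e : Dir} {ρ' : Fin B}
    (ht : (q', x, d, e) ∈ M.trans c.state s (c.work c.workPos)) {p' : Reg B M.Work → ℕ}
    (h : ∀ i, M.regRel w s x y d e ⟨c.workPos % B, Nat.mod_lt _ hB⟩ ρ' i
      (M.encode B (B * K) c i) (p' i)) :
    ∃ c' : M.Config, M.Step w c c' ∧ c'.state = q' ∧ (c'.workPos < B * K →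
      ρ' = ⟨c'.workPos % B, Nat.mod_lt _ hB⟩ ∧ y = c'.work c'.workPos ∧
        p' = M.encode B (B * K) c') := by
  obtain ⟨h1, h2, h3⟩ := h none
  obtain rfl : tapeAt w c.inPos = s := h1
  have h2 : d.Moves c.inPos (p' none) := h2
  have hm : e.Moves c.workPos (B * p' (some none) + ρ') := by
    have := Nat.div_add_mod c.workPos B
    have h4 := h (some none)
    cases e
    · have h4 : B * (c.workPos / B) + c.workPos % B = B * p' (some none) + ρ' + 1 := h4
      change c.workPos = _ + 1
      omega
    · obtain ⟨h5, h6, -⟩ := h4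
      have h5 : c.workPos / B = p' (some none) := h5
      change _ = c.workPos
      rw [← h5, ← h6]; exact this
    · have h5 : B * p' (some none) + ρ' = B * (c.workPos / B) + c.workPos % B + 1 := h4.1
      change _ = c.workPos + 1
      omega
  let c' : M.Config := ⟨q', p' none, B * p' (some none) + ρ',
    Function.update c.work c.workPos x⟩
  refine ⟨c', ⟨x, d, e, ht, rfl, h2, h3, hm⟩, rfl, fun hc' => ?_⟩
  have hρ : ρ' = ⟨c'.workPos % B, Nat.mod_lt _ hB⟩ :=
    Fin.ext (Nat.mul_add_mod_of_lt (a := p' (some none)) ρ'.2 |>.symm.trans (by rw [mul_comm]))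
  have hE := regRel_encode (c' := c') (x := x) (d := d) (e := e) hB hK rfl h2 h3 hm hc hc'
  rw [← hρ] at hE
  -- The guessed digit and the true one are both at most 1 and both have the parity of the number
  -- from which they are popped. As this holds on every track, the guessed symbol is the true one.
  have hp : ∀ {a u v v'}, popRel (ρ' = ρ') (digit M.blank y a) u v →
      popRel (ρ' = ρ') (digit M.blank (c'.work c'.workPos) a) u v' →
      digit M.blank y a = digit M.blank (c'.work c'.workPos) a := by
    rintro a u v v' (⟨-, h⟩ | h) (⟨-, h'⟩ | h')
    · have := digit_le M.blank y a
      have := digit_le M.blank (c'.work c'.workPos) a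
      omega
    · exact absurd rfl h'.1
    · exact absurd rfl h.1
    · exact absurd rfl h'.1
  have hy : y = c'.work c'.workPos := by
    cases e
    · exact eq_of_digit_eq (z := M.blank) fun a =>
        hp (h (some (some (some (false, ρ', a))))) (hE (some (some (some (false, ρ', a)))))
    · exact (h (some none)).2.2.symm.trans (hE (some none)).2.2
    · exact eq_of_digit_eq (z := M.blank) fun a =>
        hp (h (some (some (some (true, ρ', a))))) (hE (some (some (some (true, ρ', a)))))
  refine ⟨hρ, hy, funext fun i => regRel_functional (h i) ?_⟩
  rw [hy]
  exact hE i

theorem regRel_le {s : TapeSym} {x y : M.Work} {d e : Dir} {ρ ρ' : Fin B} {i : Reg B M.Work}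
    {u v : ℕ} (hu : u ≤ w.length + 1) (h : M.regRel w s x y d e ρ ρ' i u v) :
    v ≤ w.length + 1 := by
  have hp : ∀ {b : Prop} {c}, pushRel w b c u v → v ≤ w.length + 1 := by
    rintro b c (h | h) <;> omega
  have hq : ∀ {b : Prop} {c}, popRel b c u v → v ≤ w.length + 1 := by
    rintro b c (h | h) <;> omega
  rcases i with _ | _ | _ | ⟨t, r, a⟩
  · exact h.2.2
  · cases e
    · rcases (mul_add_eq_iff ρ'.2 ρ.2).1 h with h | h <;> omega
    · exact h.1 ▸ hu
    · exact h.2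
  · exact (show u = v from h) ▸ hu
  · cases e <;> cases t
    · exact hq h
    · exact hp h
    · exact (show u = v from h) ▸ hu
    · exact (show u = v from h) ▸ hu
    · exact hp h
    · exact hq h

theorem clear_of_locRel {s : TapeSym} {x y : M.Work} {d e : Dir} {ρ ρ' : Fin B} {i : Reg B M.Work}
    {p p' : Reg B M.Work → ℕ} (hp : Clear aux w p)
    (h : locRel i (M.regRel w s x y d e ρ ρ' i) p p') : Clear aux w p' := by
  by_cases hi : i = aux
  · subst hi
    obtain ⟨v, hv, rfl⟩ := h
    rw [← show _ = v from hv, Function.update_eq_self]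
    exact hp
  · exact hp.update hi h fun v hv => regRel_le (hp.2 i) hv

/-- Remainders and symbols are constants of the program, so each relation becomes a push, a pop, a
change of the quotient by one, no change, or the empty relation. -/
theorem impl_regRel (s : TapeSym) (x y : M.Work) (d e : Dir) (ρ ρ' : Fin B) (i : Reg B M.Work) :
    Impl (hSem (Reg B M.Work)) (Clear aux) fun w =>
      locRel i (M.regRel w s x y d e ρ ρ' i) := by
  have hskip : ∀ i : Reg B M.Work, Impl (hSem (Reg B M.Work)) (Clear aux) fun _ => locRel i Eq :=
    fun i => Impl.mono (LocImpl.skip (act := hAct) (D := fun _ _ => True)) fun _ _ _ => trivial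
  have hpush : ∀ (b : Prop) (c : ℕ) (i : Reg B M.Work), i ≠ aux →
      Impl (hSem (Reg B M.Work)) (Clear aux) fun w => locRel i (pushRel w b c) := by
    intro b c i hi
    by_cases hb : b
    · refine (impl_push hi c).congr (fun _ _ h => h) fun w p _ p' => ?_
      simp [locRel, pushRel, hb]
    · refine (hskip i).congr (fun _ _ h => h) fun w p _ p' => ?_
      simp [locRel, pushRel, hb]
  have hpop : ∀ (b : Prop) (c : ℕ) (i : Reg B M.Work), i ≠ aux →
      Impl (hSem (Reg B M.Work)) (Clear aux) fun w => locRel i (popRel b c) := by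
    intro b c i hi
    by_cases hb : b
    · refine (impl_pop hi c).congr (fun _ _ h => h) fun w p _ p' => ?_
      simp [locRel, popRel, hb]
    · refine (hskip i).congr (fun _ _ h => h) fun w p _ p' => ?_
      simp [locRel, popRel, hb]
  rcases i with _ | _ | _ | ⟨t, r, a⟩
  · exact Impl.mono (locImpl_hRel (D := fun _ _ => True) {s} d) fun _ _ _ => trivial
  · cases e
    · refine Impl.mono (V := fun w p => p (some none) ≤ w.length + 1) ?_ fun w p hp => hp.2 _
      change LocImpl hAct (some none : Reg B M.Work) (fun w u => u ≤ w.length + 1) fun _ u v => B * u + ρ = B * v + ρ' + 1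
      simp only [mul_add_eq_iff ρ'.2 ρ.2]
      by_cases h1 : (ρ : ℕ) = ρ' + 1
      · refine LocImpl.skip.congr (fun _ _ h => h) fun w u _ v => ?_
        simp [h1]
      · by_cases h2 : (ρ : ℕ) = 0 ∧ (ρ' : ℕ) + 1 = B
        · refine (locImpl_sub _ 1).congr (fun _ _ h => h) fun w u _ v => ?_
          have := ρ.pos
          omega
        · refine LocImpl.of_false fun w u _ v h => ?_
          rcases h with h | h
          · exact h1 h.1
          · exact h2 ⟨h.1, h.2.1⟩
    · by_cases h : ρ = ρ' ∧ x = y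
      · refine Impl.congr (hskip (some none)) (fun _ _ h => h) fun w p _ p' => ?_
        change locRel _ _ p p' ↔ locRel _ (fun u v => u = v ∧ _) p p'
        simp only [h, and_true]
      · exact Impl.mono (LocImpl.of_false (act := hAct) (D := fun _ _ => True)
          fun _ _ _ _ h' => h h'.2) fun _ _ _ => trivial
    · refine Impl.mono (V := fun w p => p (some none) ≤ w.length + 1) ?_ fun w p hp => hp.2 _
      change LocImpl hAct (some none : Reg B M.Work) (fun w u => u ≤ w.length + 1) fun w u v =>
        B * v + ρ' = B * u + ρ + 1 ∧ v ≤ w.length + 1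
      simp only [mul_add_eq_iff ρ.2 ρ'.2]
      by_cases h1 : (ρ' : ℕ) = ρ + 1
      · refine LocImpl.skip.congr (fun _ _ h => h) fun w u (hu : u ≤ _) v => ?_
        simp only [h1]
        constructor
        · rintro rfl; exact ⟨.inl ⟨trivial, rfl⟩, hu⟩
        · rintro ⟨⟨-, h⟩ | ⟨h, -⟩, -⟩
          · exact h.symm
          · omega
      · by_cases h2 : (ρ' : ℕ) = 0 ∧ (ρ : ℕ) + 1 = B
        · refine (locImpl_add _ 1).congr (fun _ _ h => h) fun w u _ v => ?_
          have := ρ.pos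
          omega
        · refine LocImpl.of_false fun w u _ v h => ?_
          rcases h.1 with h | h
          · exact h1 h.1
          · exact h2 ⟨h.1, h.2.1⟩
  · exact hskip _
  · cases e <;> cases t
    · exact hpop _ _ _ (by simp)
    · exact hpush _ _ _ (by simp)
    · exact hskip _
    · exact hskip _
    · exact hpush _ _ _ (by simp)
    · exact hpop _ _ _ (by simp)

end

theorem LogSpace.exists_prog {M : NTM} [DecidableEq M.Work] (h : M.LogSpace) :
    ∃ (B : ℕ) (M' : Prog (HLab (Reg B M.Work))), headLang M' = M.language := by
  obtain ⟨b, hb⟩ := h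
  -- The initial configuration, at position 0, already satisfies the strict bound.
  have hb0 : 0 < b := by
    have := hb [] _ .refl
    exact Nat.pos_of_ne_zero fun h => by simp [h] at this
  have hB : 0 < 2 * b := by omega
  let B := 2 * b
  -- With `B = 2 * b` classes, about (log n)/2 digits per head suffice: `B * K w` exceeds every
  -- visited position, while 2^K ≤ n + 2 even for the shortest words, where `K w = 1`.
  let K : List Bool → ℕ := fun w => Nat.log 2 w.length / 2 + 1
  have hK : ∀ w, 2 ^ K w ≤ w.length + 2 := by
    intro w
    have h1 : 2 ^ Nat.log 2 w.length ≤ w.length + 1 := by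
      rcases eq_or_ne w.length 0 with h | h
      · simp [h]
      · exact (Nat.pow_log_le_self 2 h).trans (Nat.le_succ _)
    rcases lt_or_ge (Nat.log 2 w.length) 2 with h | h
    · have : K w = 1 := by simp only [K]; omega
      rw [this]; omega
    · have : K w ≤ Nat.log 2 w.length := by simp only [K]; omega
      have := Nat.pow_le_pow_right (show 0 < 2 by norm_num) this
      omega
  have hlt : ∀ w c, Relation.ReflTransGen (M.Step w) M.init c → c.workPos < B * K w := by
    intro w c hc
    refine (hb w c hc).trans_le ?_
    calc b * (Nat.log 2 w.length + 1) ≤ b * (2 * (Nat.log 2 w.length / 2 + 1)) :=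
          Nat.mul_le_mul_left _ (by omega)
      _ = B * K w := by simp only [B, K]; ring
  have := M.finite_state
  have := M.finite_work
  let T := {t : M.State × TapeSym × M.Work × M.State × M.Work × Dir × Dir //
    t.2.2.2 ∈ M.trans t.1 t.2.1 t.2.2.1}
  let S := Option (M.State × Fin B × M.Work)
  -- An edge carries a transition of the machine, the current remainder, and guesses of the next
  -- remainder and of the symbol that the work head will find; a vertex holds the state, the
  -- remainder and the scanned symbol.
  let E := (T × Fin B × Fin B × M.Work) ⊕ (M.accept × Fin B × M.Work)
  let src : E → S := fun e => match e with
    | .inl (t, ρ, _, _) => some (t.1.1, ρ, t.1.2.2.1)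
    | .inr (q, ρ, x) => some (q, ρ, x)
  let dst : E → S := fun e => match e with
    | .inl (t, _, ρ', y) => some (t.1.2.2.2.1, ρ', y)
    | .inr _ => none
  have : Fintype (Reg B M.Work) := Fintype.ofFinite _
  let l : List (Reg B M.Work) := Finset.univ.toList
  let R : E → List Bool → (Reg B M.Work → ℕ) → (Reg B M.Work → ℕ) → Prop := fun e w =>
    match e with
    | .inl (t, ρ, ρ', y) => listRel (l.map fun i => locRel i (M.regRel w t.1.2.1 t.1.2.2.2.2.1 y
        t.1.2.2.2.2.2.1 t.1.2.2.2.2.2.2 ρ ρ' i))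
    | .inr _ => Eq
  have hT : ∀ (t : T) (ρ ρ' : Fin B) (y : M.Work) w p p', R (.inl (t, ρ, ρ', y)) w p p' ↔
      ∀ i, M.regRel w t.1.2.1 t.1.2.2.2.2.1 y t.1.2.2.2.2.2.1 t.1.2.2.2.2.2.2 ρ ρ' i
        (p i) (p' i) := by
    intro t ρ ρ' y w p p'
    refine (listRel_locRel (f := id) Function.injective_id (fun i => M.regRel w t.1.2.1
      t.1.2.2.2.2.1 y t.1.2.2.2.2.2.1 t.1.2.2.2.2.2.2 ρ ρ' i) (Finset.nodup_toList _)).trans ?_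
    simp
  have hR : ∀ e, Impl (hSem (Reg B M.Work)) (Clear aux) (R e) := by
    rintro (⟨t, ρ, ρ', y⟩ | _)
    · exact Impl.list l (fun i _ => impl_regRel _ _ _ _ _ _ _ i)
        fun i _ w p p' hp h => clear_of_locRel hp h
    · exact Impl.skip
  have hV : ∀ e w p p', Clear aux w p → R e w p p' → Clear aux w p' := by
    rintro (⟨t, ρ, ρ', y⟩ | _) w p p' hp h
    · have h := (hT _ _ _ _ _ _ _).1 h
      refine ⟨?_, fun i => regRel_le (hp.2 i) (h i)⟩
      exact (show p aux = p' aux from h aux).symm.trans hp.1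
    · exact (show p = p' from h) ▸ hp
  obtain ⟨M', hM'⟩ := Impl.graph (src := src) (dst := dst) (V := fun _ => Clear aux) hR hV
    (some (M.start, ⟨0, hB⟩, M.blank)) none
  refine ⟨B, M', ?_⟩
  have h0 : ∀ w, M.encode B (B * K w) M.init = fun _ => 0 := by
    intro w
    funext i
    rcases i with _ | _ | _ | ⟨_ | _, r, a⟩
    · rfl
    · exact Nat.zero_div _
    · rfl
    · rfl
    · exact above_eq_zero fun _ => digit_self _ _
  let ctl : M.Config → S := fun c => some (c.state, ⟨c.workPos % B, Nat.mod_lt _ hB⟩,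
    c.work c.workPos)
  have hctl : ctl M.init = some (M.start, ⟨0, hB⟩, M.blank) := by
    simp [ctl, init]
  ext w
  have hw : w ∈ headLang M' ↔ ∃ p, Relation.ReflTransGen (GStep src dst fun e => R e w)
      (some (M.start, ⟨0, hB⟩, M.blank), fun _ => 0) (none, p) :=
    exists_congr fun p => hM'.reach_exact (w := w) ⟨rfl, fun _ => Nat.zero_le _⟩
  rw [hw]
  constructor
  · rintro ⟨p, hp⟩
    suffices ∀ x : S × (Reg B M.Work → ℕ), Relation.ReflTransGen (GStep src dst fun e => R e w)
        (some (M.start, ⟨0, hB⟩, M.blank), fun _ => 0) x → (x.1 = none → w ∈ M.language) ∧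
        (x.1 ≠ none → ∃ c, Relation.ReflTransGen (M.Step w) M.init c ∧ x.1 = ctl c ∧
          x.2 = M.encode B (B * K w) c) from (this _ hp).1 rfl
    intro x hx
    induction hx with
    | refl => exact ⟨fun h => by simp at h, fun _ => ⟨M.init, .refl, hctl.symm, (h0 w).symm⟩⟩
    | @tail x z _ hs ih =>
      obtain ⟨x, p₁⟩ := x
      obtain ⟨z, p₂⟩ := z
      obtain ⟨⟨t, ρ, ρ', y⟩ | ⟨q, ρ, y⟩, rfl, rfl, hs⟩ := hs
      · obtain ⟨c, hc, h1, h2⟩ := ih.2 (by simp [src])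
        refine ⟨fun h => by simp [dst] at h, fun _ => ?_⟩
        obtain ⟨⟨q, s, x, q', x', d, e⟩, ht⟩ := t
        have h1 : some (q, ρ, x) = some (c.state, (⟨c.workPos % B, Nat.mod_lt _ hB⟩ : Fin B),
          c.work c.workPos) := h1
        simp only [Option.some.injEq, Prod.mk.injEq] at h1
        obtain ⟨rfl, rfl, rfl⟩ := h1
        obtain rfl : p₁ = _ := h2
        obtain ⟨c', h3, rfl, h4⟩ := exists_step_of_regRel hB (hK w) (hlt w c hc) ht
          ((hT _ _ _ _ _ _ _).1 hs)
        -- The configuration after the step is reachable, so the space bound applies to it and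
        -- confirms the guesses.
        obtain ⟨rfl, rfl, rfl⟩ := h4 (hlt w c' (hc.tail h3))
        exact ⟨c', hc.tail h3, rfl, rfl⟩
      · obtain ⟨c, hc, h1, -⟩ := ih.2 (by simp [src])
        refine ⟨fun _ => ⟨c, hc, ?_⟩, fun h => absurd rfl h⟩
        have h1 : some (q.1, ρ, y) = some (c.state, (⟨c.workPos % B, Nat.mod_lt _ hB⟩ : Fin B),
          c.work c.workPos) := h1
        simp only [Option.some.injEq, Prod.mk.injEq] at h1
        rw [← h1.1]; exact q.2
  · rintro ⟨c, hc, hq⟩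
    suffices ∀ c, Relation.ReflTransGen (M.Step w) M.init c → c.inPos ≤ w.length + 1 ∧
        Relation.ReflTransGen (GStep src dst fun e => R e w)
        (some (M.start, ⟨0, hB⟩, M.blank), fun _ => 0) (ctl c, M.encode B (B * K w) c) from
      ⟨_, (this c hc).2.tail ⟨.inr (⟨c.state, hq⟩, _, _), rfl, rfl, rfl⟩⟩
    intro c hc
    clear hq
    induction hc with
    | refl => rw [hctl, h0]; exact ⟨Nat.zero_le _, .refl⟩
    | @tail c c' hc h ih =>
      have hc' := hlt w c' (hc.tail h)
      obtain ⟨x, d, e, h1, h2, h3, h4, h5⟩ := h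
      refine ⟨h4, ih.2.tail ⟨.inl (⟨(c.state, tapeAt w c.inPos, c.work c.workPos, c'.state, x, d, e),
        h1⟩, ⟨c.workPos % B, Nat.mod_lt _ hB⟩, ⟨c'.workPos % B, Nat.mod_lt _ hB⟩,
        c'.work c'.workPos), rfl, rfl, (hT _ _ _ _ _ _ _).2 fun i => ?_⟩⟩
      exact regRel_encode hB (hK w) h2 h3 h4 h5 (hlt w c hc) hc' i

end NTM

theorem nLogspace_subset_twoNFA : nLogspace ⊆ twoNFA ⊤ := by
  classical
  rintro _ ⟨M, hM, rfl⟩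
  obtain ⟨B, M', h⟩ := hM.exists_prog
  have := M.finite_work
  obtain ⟨k, ⟨e⟩⟩ := Finite.exists_equiv_fin (NTM.Reg B M.Work)
  rw [← h]
  exact headLang_mem_twoNFA le_top M' e

/-! ## Programs that rewrite a work tape -/

/-- The instructions of Turing machines with work alphabet `Γ`: the admissible symbols on the input
tape, the relation between the old and the new symbol on the work tape, and two movements. -/
abbrev TLab (Γ : Type) : Type := Set TapeSym × (Γ → Γ → Prop) × Dir × Dir

/-- The position of the input head, the position of the work head, and the work tape. -/
abbrev TConf (Γ : Type) : Type := ℕ × ℕ × (ℕ → Γ)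

/-- The effect of an instruction of a Turing machine. -/
def tAct {Γ : Type} (w : List Bool) (l : TLab Γ) (c c' : TConf Γ) : Prop :=
  tapeAt w c.1 ∈ l.1 ∧ ∃ x, l.2.1 (c.2.2 c.2.1) x ∧ c'.2.2 = Function.update c.2.2 c.2.1 x ∧
    l.2.2.1.Moves c.1 c'.1 ∧ c'.1 ≤ w.length + 1 ∧ l.2.2.2.Moves c.2.1 c'.2.1

/-- The work tape that contains a list of symbols, of which the first one is marked. -/
def tapeOf {β : Type} (u : List β) (i : ℕ) : Option (Bool × β) :=
  u[i]?.map fun x => (decide (i = 0), x)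

/-- The number of cells that a simulation of heads uses. -/
def spaceBound (w : List Bool) : ℕ := Nat.log 2 w.length + 2

/-- The representation of an input position and a list of symbols. -/
def listSem (β : Type) (w : List Bool) :
    Sem (TLab (Option (Bool × β))) (TConf (Option (Bool × β))) (ℕ × List β) where
  act := tAct w
  safe c := c.2.1 ≤ spaceBound w
  rep c a := c = (a.1, 0, tapeOf a.2) ∧ a.1 ≤ w.length + 1 ∧ a.2 ≠ [] ∧ a.2.length ≤ spaceBound w
  safe_of_rep := by rintro _ a ⟨rfl, -⟩; exact Nat.zero_le _

section Tape

variable {β : Type}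

theorem tapeOf_append_cons (u v : List β) (x : β) :
    tapeOf (u ++ x :: v) u.length = some (decide (u.length = 0), x) := by
  simp [tapeOf]

theorem tapeOf_length (u : List β) : tapeOf u u.length = none := by simp [tapeOf]

theorem update_tapeOf (u v : List β) (x y : β) :
    Function.update (tapeOf (u ++ x :: v)) u.length (some (decide (u.length = 0), y)) =
      tapeOf (u ++ y :: v) := by
  funext i
  by_cases hi : i = u.length
  · subst hi; rw [Function.update_self, tapeOf_append_cons]
  · rw [Function.update_of_ne hi]
    rcases lt_or_ge i u.length with h | h
    · simp [tapeOf, List.getElem?_append_left h]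
    · obtain ⟨k, rfl⟩ := Nat.exists_eq_add_of_lt (lt_of_le_of_ne h (Ne.symm hi))
      simp [tapeOf, List.getElem?_append, add_assoc]

theorem update_tapeOf_length {u : List β} (hu : u ≠ []) (o : Option β) :
    Function.update (tapeOf u) u.length (o.map fun x => (false, x)) = tapeOf (u ++ o.toList) := by
  have hl : u.length ≠ 0 := by simpa using hu
  rcases o with _ | x
  · simp [← tapeOf_length u]
  · funext i
    by_cases hi : i = u.length
    · subst hi
      simp [tapeOf, hu]
    · rw [Function.update_of_ne hi]
      rcases lt_or_ge i u.length with h | h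
      · simp [tapeOf, List.getElem?_append_left h]
      · obtain ⟨k, rfl⟩ := Nat.exists_eq_add_of_lt (lt_of_le_of_ne h (Ne.symm hi))
        simp [tapeOf, add_assoc]

end Tape

/-- The runs of a letter-to-letter transducer. -/
inductive Run {Q β : Type} (δ : Q → β → β → Q → Prop) (q₀ : Q) : List β → List β → Q → Prop
  | nil : Run δ q₀ [] [] q₀
  | snoc {u u' : List β} {q q' : Q} {x x' : β} (h : Run δ q₀ u u' q) (h' : δ q x x' q') :
    Run δ q₀ (u ++ [x]) (u' ++ [x']) q'

theorem Run.length_eq {Q β : Type} {δ : Q → β → β → Q → Prop} {q₀ q : Q} {u u' : List β}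
    (h : Run δ q₀ u u' q) : u'.length = u.length := by
  induction h with
  | nil => rfl
  | snoc _ _ ih => simp [ih]

/-- The result of a run of a transducer, which may append a symbol at the end. -/
def passRel {Q β : Type} (δ : Q → β → β → Q → Prop) (fin : Q → Option β → Prop) (q₀ : Q)
    (a a' : ℕ × List β) : Prop :=
  ∃ q u' o, Run δ q₀ a.2 u' q ∧ fin q o ∧ a' = (a.1, u' ++ o.toList)

/-- The program that runs a transducer and returns to the marked cell. -/
def passProg {Q β : Type} [Finite Q] (δ : Q → β → β → Q → Prop) (fin : Q → Option β → Prop)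
    (q₀ : Q) : Prog (TLab (Option (Bool × β))) where
  State := Q ⊕ Bool
  finite_state := inferInstance
  start := .inl q₀
  final := .inr true
  trans
    | .inl q, l, .inl q' => l = some (univ, fun y y' => ∃ m x x', y = some (m, x) ∧
        y' = some (m, x') ∧ δ q x x' q', .stay, .right)
    | .inl q, l, .inr false => l = some (univ, fun y y' => y = none ∧
        ∃ o, fin q o ∧ y' = o.map fun x => (false, x), .stay, .left)
    | .inr false, l, .inr false => l = some (univ, fun y y' => y' = y ∧ ∃ x, y = some (false, x),
        .stay, .left)
    | .inr false, l, .inr true => l = some (univ, fun y y' => y' = y ∧ ∃ x, y = some (true, x),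
        .stay, .stay)
    | _, _, _ => False

/-- The first blank cell shows where the list ends, and the mark on the first cell stops the way
back, so the head stays within the list and the cell after it. The hypothesis `hV` provides room
whenever a symbol is appended. -/
theorem impl_pass {Q β : Type} [Finite Q] {δ : Q → β → β → Q → Prop}
    {fin : Q → Option β → Prop} {q₀ : Q} {V : List Bool → ℕ × List β → Prop}
    (hV : ∀ w a u' q x, V w a → Run δ q₀ a.2 u' q → fin q (some x) →
      a.2.length < spaceBound w) :
    Impl (listSem β) V fun _ => passRel δ fin q₀ := by
  have hlen : ∀ w a a', V w a → a.2.length ≤ spaceBound w → passRel δ fin q₀ a a' →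
      a'.2.length ≤ spaceBound w := by
    rintro w a _ ha hl ⟨q, u', o, h1, h2, rfl⟩
    rcases o with _ | x
    · simpa [h1.length_eq] using hl
    · simpa [h1.length_eq] using hV w a u' q x ha h1 h2
  have key : ∀ w c a, (listSem β w).rep c a → V w a → ∀ x,
      (passProg δ fin q₀).Reach (tAct w) (.inl q₀, c) x →
      match x with
      | (.inl q, c') => ∃ u v u', a.2 = u ++ v ∧ Run δ q₀ u u' q ∧
          c' = (a.1, u.length, tapeOf (u' ++ v))
      | (.inr false, c') => ∃ a', passRel δ fin q₀ a a' ∧ c'.1 = a'.1 ∧ c'.2.1 < a'.2.length ∧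
          c'.2.2 = tapeOf a'.2
      | (.inr true, c') => ∃ a', passRel δ fin q₀ a a' ∧ c' = (a'.1, 0, tapeOf a'.2) := by
    rintro w _ a ⟨rfl, h1, h2, h3⟩ ha x hx
    induction hx with
    | refl => exact ⟨[], a.2, [], rfl, .nil, rfl⟩
    | @tail x y _ h ih =>
      obtain ⟨l, hl, h⟩ := h
      rcases x with ⟨q | _ | _, c₁⟩ <;> rcases y with ⟨q' | _ | _, c₂⟩
      · obtain rfl := hl
        obtain ⟨u, v, u', h4, h5, rfl⟩ := ih
        obtain ⟨-, _, ⟨m, x, x', h6, rfl, h7⟩, h8, h9, -, h10⟩ := h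
        have h6 : tapeOf (u' ++ v) u.length = some (m, x) := h6
        have h8 : c₂.2.2 = Function.update (tapeOf (u' ++ v)) u.length (some (m, x')) := h8
        have h9 : c₂.1 = a.1 := h9
        have h10 : c₂.2.1 = u.length + 1 := h10
        rw [← h5.length_eq] at h6 h8
        rcases v with _ | ⟨y, v⟩
        · rw [List.append_nil, tapeOf_length] at h6
          cases h6
        · rw [tapeOf_append_cons] at h6
          simp only [Option.some.injEq, Prod.mk.injEq] at h6
          obtain ⟨rfl, rfl⟩ := h6
          rw [update_tapeOf] at h8
          refine ⟨u ++ [y], v, u' ++ [x'], by simp [h4], h5.snoc h7, ?_⟩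
          rw [List.append_assoc, List.singleton_append, ← h8, List.length_append,
            List.length_singleton, ← h10, ← h9]
      · obtain rfl := hl
        obtain ⟨u, v, u', h4, h5, rfl⟩ := ih
        obtain ⟨-, _, ⟨h6, o, h7, rfl⟩, h8, h9, -, h10⟩ := h
        have h6 : tapeOf (u' ++ v) u.length = none := h6
        have h8 : c₂.2.2 = Function.update (tapeOf (u' ++ v)) u.length
          (o.map fun x => (false, x)) := h8
        have h9 : c₂.1 = a.1 := h9
        have h10 : u.length = c₂.2.1 + 1 := h10
        rw [← h5.length_eq] at h6 h8
        rcases v with _ | ⟨y, v⟩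
        -- The instruction moves the work head to the left, which is impossible at the cell 0; hence
        -- the list is not empty.
        · have h11 : u' ≠ [] := by
            rintro rfl
            have := h5.length_eq
            simp only [List.length_nil] at this
            omega
          rw [List.append_nil] at h4
          rw [List.append_nil, update_tapeOf_length h11] at h8
          refine ⟨(a.1, u' ++ o.toList), ⟨q, u', o, h4 ▸ h5, h7, rfl⟩, h9, ?_, h8⟩
          have := h5.length_eq
          simp only [List.length_append]
          omega
        · rw [tapeOf_append_cons] at h6
          cases h6
      · exact hl.elim
      · exact hl.elim
      · obtain rfl := hl
        obtain ⟨a', h4, h5, h6, h7⟩ := ih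
        obtain ⟨-, _, ⟨rfl, -⟩, h8, h9, -, h10⟩ := h
        have h9 : c₂.1 = c₁.1 := h9
        have h10 : c₁.2.1 = c₂.2.1 + 1 := h10
        refine ⟨a', h4, h9.trans h5, by omega, ?_⟩
        rw [h8, Function.update_eq_self, h7]
      · obtain rfl := hl
        obtain ⟨a', h4, h5, h6, h7⟩ := ih
        obtain ⟨-, _, ⟨rfl, x, h11⟩, h8, h9, -, h10⟩ := h
        have h9 : c₂.1 = c₁.1 := h9
        have h10 : c₂.2.1 = c₁.2.1 := h10
        refine ⟨a', h4, ?_⟩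
        rw [Function.update_eq_self] at h8
        have h12 : c₁.2.1 = 0 := by
          rw [h7, tapeOf] at h11
          simp only [Option.map_eq_some_iff, Prod.mk.injEq, decide_eq_true_eq] at h11
          obtain ⟨_, -, h, -⟩ := h11
          exact h
        rw [← h5, ← h7, ← h12, ← h9, ← h10, ← h8]
      · exact hl.elim
      · exact hl.elim
      · exact hl.elim
  refine ⟨passProg δ fin q₀, fun w c a hc ha x hx => ?_, fun w c a hc ha c' hx => ?_,
    fun w c a hc ha a' hR => ?_⟩
  · have := key w c a hc ha x hx
    obtain ⟨rfl, h1, h2, h3⟩ := hc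
    rcases x with ⟨q | _ | _, c₁⟩
    · obtain ⟨u, v, u', h4, h5, rfl⟩ := this
      rw [h4, List.length_append] at h3
      exact (Nat.le_add_right _ _).trans h3
    · obtain ⟨a', h4, h5, h6, h7⟩ := this
      exact h6.le.trans (hlen w a a' ha h3 h4)
    · obtain ⟨a', h4, rfl⟩ := this
      exact Nat.zero_le _
  · obtain ⟨a', h4, rfl⟩ := key w c a hc ha _ hx
    obtain ⟨rfl, h1, h2, h3⟩ := hc
    refine ⟨a', ⟨rfl, ?_, ?_, hlen w a a' ha h3 h4⟩, h4⟩
    · obtain ⟨q, u', o, h5, h6, rfl⟩ := h4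
      exact h1
    · obtain ⟨q, u', o, h5, h6, rfl⟩ := h4
      intro h
      obtain ⟨h, -⟩ := List.append_eq_nil_iff.1 h
      have := h5.length_eq
      rw [h] at this
      exact h2 (List.length_eq_zero_iff.1 this.symm)
  · obtain ⟨rfl, h1, h2, h3⟩ := hc
    have h3' := hlen w a a' ha h3 hR
    obtain ⟨q, u', o, h4, h5, rfl⟩ := hR
    have hl := h4.length_eq
    have h6 : u' ≠ [] := by
      rintro rfl
      exact h2 (List.length_eq_zero_iff.1 hl.symm)
    refine ⟨(a.1, 0, tapeOf (u' ++ o.toList)), ⟨rfl, h1, by simp [h6], h3'⟩, ?_⟩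
    have hpass : ∀ u u' q, Run δ q₀ u u' q → ∀ v, (passProg δ fin q₀).Reach (tAct w)
        (.inl q₀, a.1, 0, tapeOf (u ++ v)) (.inl q, a.1, u.length, tapeOf (u' ++ v)) := by
      intro u u' q h
      induction h with
      | nil => exact fun v => .refl
      | @snoc u u' q q' x x' h h' ih =>
        intro v
        have := ih (x :: v)
        rw [List.append_assoc, List.append_assoc, List.singleton_append, List.singleton_append]
        refine this.tail ⟨_, rfl, trivial, some (decide (u'.length = 0), x'),
          ⟨decide (u'.length = 0), x, x', ?_, rfl, h'⟩, ?_, rfl, h1, ?_⟩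
        · change tapeOf (u' ++ x :: v) u.length = _
          rw [← h.length_eq, tapeOf_append_cons]
        · change _ = Function.update (tapeOf (u' ++ x :: v)) u.length _
          rw [← h.length_eq, update_tapeOf]
        · change _ = u.length + 1
          simp
    have hback : ∀ k, k < (u' ++ o.toList).length → (passProg δ fin q₀).Reach (tAct w)
        (.inr false, a.1, k, tapeOf (u' ++ o.toList))
        (.inr true, a.1, 0, tapeOf (u' ++ o.toList)) := by
      intro k hk
      induction k with
      | zero =>
        refine .single ⟨_, rfl, trivial, _, ⟨rfl, (u' ++ o.toList)[0], ?_⟩, ?_, rfl, h1, rfl⟩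
        · change tapeOf _ 0 = _
          simp [tapeOf]
        · change _ = Function.update (tapeOf _) 0 (tapeOf _ 0)
          rw [Function.update_eq_self]
      | succ k ih =>
        refine .head (b := ((.inr false : Q ⊕ Bool), a.1, k, tapeOf (u' ++ o.toList)))
          ⟨_, rfl, trivial, _, ⟨rfl, (u' ++ o.toList)[k + 1], ?_⟩, ?_, rfl, h1, rfl⟩
          (ih (by omega))
        · change tapeOf _ (k + 1) = _
          simp [tapeOf, List.getElem?_eq_getElem hk]
        · change _ = Function.update (tapeOf _) (k + 1) (tapeOf _ (k + 1))
          rw [Function.update_eq_self]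
    have h7 := hpass _ _ _ h4 []
    rw [List.append_nil, List.append_nil] at h7
    have h8 : 0 < u'.length := List.length_pos_iff.2 h6
    refine (h7.tail ?_).trans (hback (u'.length - 1) (by rw [List.length_append]; omega))
    refine ⟨_, rfl, trivial, o.map fun x => (false, x), ⟨?_, o, h5, rfl⟩, ?_, rfl, h1, ?_⟩
    · change tapeOf u' a.2.length = none
      rw [← hl, tapeOf_length]
    · change _ = Function.update (tapeOf u') a.2.length _
      rw [← hl, update_tapeOf_length h6]
    · change a.2.length = _ + 1
      change a.2.length = u'.length - 1 + 1
      omega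

/-! ## Binary counters on a work tape -/

section Counters

variable {κ : Type}

/-- The number on the track `j`, whose least significant digit comes first. -/
def trackVal (j : κ) : List (κ → Bool) → ℕ
  | [] => 0
  | x :: u => (x j).toNat + 2 * trackVal j u

theorem trackVal_append (j : κ) (u : List (κ → Bool)) (x : κ → Bool) :
    trackVal j (u ++ [x]) = trackVal j u + 2 ^ u.length * (x j).toNat := by
  induction u with
  | nil => simp [trackVal]
  | cons y u ih => simp only [List.cons_append, trackVal, ih, List.length_cons]; ring

theorem trackVal_lt (j : κ) (u : List (κ → Bool)) : trackVal j u < 2 ^ u.length := by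
  induction u with
  | nil => simp [trackVal]
  | cons y u ih =>
    have := Bool.toNat_le (y j)
    simp only [trackVal, List.length_cons, pow_succ]
    omega

/-- The numbers represented by a position on the input tape and a list of symbols. -/
def regs (a : ℕ × List (κ → Bool)) (o : Option κ) : ℕ := o.elim a.1 fun j => trackVal j a.2

/-- The representation of numbers by the position on the input tape and the tracks of the work
tape. -/
def regSem (κ : Type) (w : List Bool) :
    Sem (TLab (Option (Bool × (κ → Bool)))) (TConf (Option (Bool × (κ → Bool)))) (Option κ → ℕ) where
  act := tAct w
  safe c := c.2.1 ≤ spaceBound w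
  rep c p := ∃ a, (listSem (κ → Bool) w).rep c a ∧ p = regs a
  safe_of_rep := by rintro c _ ⟨a, h, -⟩; exact (listSem _ w).safe_of_rep c a h

/-- A number has many lists of digits, as zeros may follow the most significant one. Completeness
therefore asks only for some list that represents the result. -/
theorem Impl.regSem {V : List Bool → (Option κ → ℕ) → Prop}
    {R : List Bool → ℕ × List (κ → Bool) → ℕ × List (κ → Bool) → Prop}
    {R' : List Bool → (Option κ → ℕ) → (Option κ → ℕ) → Prop}
    (h : Impl (listSem (κ → Bool)) (fun w a => V w (regs a)) R)
    (hs : ∀ w a a', V w (regs a) → R w a a' → R' w (regs a) (regs a'))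
    (hc : ∀ w a p', V w (regs a) → R' w (regs a) p' → ∃ a', p' = regs a' ∧ R w a a') :
    Impl (IG.regSem κ) V R' := by
  obtain ⟨M, hM⟩ := h
  refine ⟨M, ?_, ?_, ?_⟩
  · rintro w c _ ⟨a, h1, rfl⟩ h2
    exact hM.safe w c a h1 h2
  · rintro w c _ ⟨a, h1, rfl⟩ h2 c' h3
    obtain ⟨a', h4, h5⟩ := hM.sound w c a h1 h2 c' h3
    exact ⟨_, ⟨a', h4, rfl⟩, hs w a a' h2 h5⟩
  · rintro w c _ ⟨a, h1, rfl⟩ h2 p' h3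
    obtain ⟨a', rfl, h4⟩ := hc w a p' h2 h3
    obtain ⟨c', h5, h6⟩ := hM.complete w c a h1 h2 a' h4
    exact ⟨c', ⟨a', h5, rfl⟩, h6⟩

/-- Every position on the input tape, the right end marker included, has at most `spaceBound w`
binary digits. -/
theorem lt_two_pow_spaceBound (w : List Bool) : w.length + 1 < 2 ^ spaceBound w := by
  have := Nat.lt_pow_succ_log_self (b := 2) (by norm_num) w.length
  have h : 2 ^ spaceBound w = 2 * 2 ^ (Nat.log 2 w.length + 1) := by
    rw [spaceBound, pow_succ]; ring
  rw [Nat.succ_eq_add_one] at this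
  omega

/-- Pass over a symbol that has the digit zero on the track `j`. -/
def zeroStep (j : κ) (_ : Unit) (x x' : κ → Bool) (_ : Unit) : Prop := x' = x ∧ x j = false

theorem run_zeroStep_iff {j : κ} {u u' : List (κ → Bool)} :
    Run (zeroStep j) () u u' () ↔ u' = u ∧ trackVal j u = 0 := by
  constructor
  · generalize () = q
    intro h
    induction h with
    | nil => exact ⟨rfl, rfl⟩
    | snoc _ h ih =>
      obtain ⟨rfl, h⟩ := h
      rw [ih.1, trackVal_append, ih.2, h]
      simp
  · rintro ⟨rfl, h⟩
    induction u' using List.reverseRecOn with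
    | nil => exact .nil
    | append_singleton u x ih =>
      rw [trackVal_append] at h
      refine (ih (by omega)).snoc ⟨rfl, ?_⟩
      cases hx : x j
      · rfl
      · simp [hx] at h

variable [DecidableEq κ]

/-- Add one (`s = true`) or subtract one (`s = false`), with carry `q`. -/
def carryStep (j : κ) (s q : Bool) (x x' : κ → Bool) (q' : Bool) : Prop :=
  x' = Function.update x j (xor (x j) q) ∧ q' = (q && (x j == s))

theorem exists_run_carryStep (j : κ) (s : Bool) (u : List (κ → Bool)) :
    ∃ u' q, Run (carryStep j s) true u u' q := by
  induction u using List.reverseRecOn with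
  | nil => exact ⟨_, _, .nil⟩
  | append_singleton u x ih =>
    obtain ⟨u', q, h⟩ := ih
    exact ⟨_, _, h.snoc ⟨rfl, rfl⟩⟩

/-- The least digit comes first, so after l digits the pending carry has the weight 2^l: in an
addition it is still owed to the result, in a subtraction it has been borrowed. -/
theorem trackVal_of_run_carryStep {j : κ} {s q : Bool} {u u' : List (κ → Bool)}
    (h : Run (carryStep j s) true u u' q) :
    (∀ i, i ≠ j → trackVal i u' = trackVal i u) ∧
      (bif s then trackVal j u' + 2 ^ u.length * q.toNat = trackVal j u + 1
        else trackVal j u' + 1 = trackVal j u + 2 ^ u.length * q.toNat) := by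
  induction h with
  | nil => cases s <;> simp [trackVal]
  | @snoc u u' q q' x x' h h' ih =>
    obtain ⟨rfl, rfl⟩ := h'
    have hl := h.length_eq
    refine ⟨fun i hi => ?_, ?_⟩
    · rw [trackVal_append, trackVal_append, ih.1 i hi, hl, Function.update_of_ne hi]
    · have ih := ih.2
      rw [trackVal_append, trackVal_append, hl, Function.update_self, List.length_append,
        List.length_singleton, pow_succ]
      cases s <;> cases q <;> cases x j <;> simp at ih ⊢ <;> omega

/-- The symbol that has the digit one on the track `j`. -/
def oneAt (j : κ) : κ → Bool := Function.update (fun _ => false) j true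

theorem regs_of_passRel_inc {j : κ} {a a' : ℕ × List (κ → Bool)}
    (h : passRel (carryStep j true) (fun q o => o = bif q then some (oneAt j) else none) true a a') :
    regs a' = Function.update (regs a) (some j) (regs a (some j) + 1) := by
  obtain ⟨q, u', _, h1, rfl, rfl⟩ := h
  obtain ⟨h2, h3⟩ := trackVal_of_run_carryStep h1
  have hl := h1.length_eq
  rw [cond_true] at h3
  funext o
  rcases o with _ | i
  · simp [regs]
  · by_cases hi : i = j
    · subst hi
      rw [Function.update_self]
      cases q
      · simpa [regs] using h3
      · simpa [regs, trackVal_append, oneAt, hl] using h3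
    · rw [Function.update_of_ne (by simpa using hi)]
      cases q
      · simpa [regs] using h2 i hi
      · simpa [regs, trackVal_append, oneAt, hi] using h2 i hi

theorem regs_of_passRel_dec {j : κ} {a a' : ℕ × List (κ → Bool)}
    (h : passRel (carryStep j false) (fun q o => q = false ∧ o = none) true a a') :
    regs a (some j) = regs a' (some j) + 1 ∧
      regs a' = Function.update (regs a) (some j) (regs a' (some j)) := by
  obtain ⟨q, u', _, h1, ⟨rfl, rfl⟩, rfl⟩ := h
  obtain ⟨h2, h3⟩ := trackVal_of_run_carryStep h1
  rw [cond_false] at h3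
  refine ⟨by simpa [regs] using h3.symm, funext fun o => ?_⟩
  rcases o with _ | i
  · simp [regs]
  · by_cases hi : i = j
    · subst hi; simp
    · rw [Function.update_of_ne (by simpa using hi)]
      simpa [regs] using h2 i hi

/-- A new digit is written only on overflow. Then 2^l ≤ u + 1 ≤ |w| + 1 for the length l of the list
and the old value u, so there is still room for it. -/
theorem impl_inc (j : κ) : Impl (regSem κ) (fun w p => p (some j) ≤ w.length) fun w =>
    locRel (some j) fun u v => v = u + 1 ∧ v ≤ w.length + 1 := by
  refine Impl.regSem (impl_pass (δ := carryStep j true)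
    (fin := fun q o => o = bif q then some (oneAt j) else none) (q₀ := true) ?_) ?_ ?_
  · intro w a u' q x h1 h2 h3
    have h4 := (trackVal_of_run_carryStep h2).2
    cases q
    · simp at h3
    · have h1 : trackVal j a.2 ≤ w.length := h1
      simp only [cond_true, Bool.toNat_true, mul_one] at h4
      have := lt_two_pow_spaceBound w
      exact (Nat.pow_lt_pow_iff_right (a := 2) (by norm_num)).1 (by omega)
  · intro w a a' h1 h2
    exact ⟨_, ⟨rfl, Nat.succ_le_succ h1⟩, regs_of_passRel_inc h2⟩
  · rintro w a _ h1 ⟨_, ⟨rfl, -⟩, rfl⟩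
    obtain ⟨u', q, h⟩ := exists_run_carryStep j true a.2
    have : passRel (carryStep j true) (fun q o => o = bif q then some (oneAt j) else none) true a
      (a.1, u' ++ (bif q then some (oneAt j) else none).toList) := ⟨q, u', _, h, rfl, rfl⟩
    exact ⟨_, (regs_of_passRel_inc this).symm, this⟩

theorem impl_dec {V : List Bool → (Option κ → ℕ) → Prop} (j : κ) :
    Impl (regSem κ) V fun _ => locRel (some j) fun u v => u = v + 1 := by
  refine Impl.regSem (impl_pass (δ := carryStep j false) (fin := fun q o => q = false ∧ o = none)
    (q₀ := true) ?_) ?_ ?_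
  · rintro w a u' q x - - ⟨-, h⟩
    cases h
  · intro w a a' _ h2
    exact ⟨_, regs_of_passRel_dec h2⟩
  · rintro w a _ _ ⟨v, h, rfl⟩
    obtain ⟨u', q, h2⟩ := exists_run_carryStep j false a.2
    have h : trackVal j a.2 = v + 1 := h
    have h3 := (trackVal_of_run_carryStep h2).2
    cases q
    · have h4 : passRel (carryStep j false) (fun q o => q = false ∧ o = none) true a
        (a.1, u' ++ (none : Option (κ → Bool)).toList) := ⟨_, u', _, h2, ⟨rfl, rfl⟩, rfl⟩
      refine ⟨_, ?_, h4⟩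
      rw [(regs_of_passRel_dec h4).2]
      congr 1
      have := (regs_of_passRel_dec h4).1
      have h : regs a (some j) = v + 1 := h
      omega
    -- A pending borrow would make the result at least 2^l, more than l digits can represent. It
    -- occurs only in a subtraction from zero, which the program thus refuses.
    · have h5 := trackVal_lt j u'
      rw [h2.length_eq] at h5
      simp only [cond_false, Bool.toNat_true, mul_one] at h3
      omega

theorem impl_zero {V : List Bool → (Option κ → ℕ) → Prop} (j : κ) :
    Impl (regSem κ) V fun _ => locRel (some j) fun u v => u = 0 ∧ v = u := by
  have key : ∀ a a' : ℕ × List (κ → Bool), passRel (zeroStep j) (fun _ o => o = none) () a a' ↔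
      a' = a ∧ trackVal j a.2 = 0 := by
    intro a a'
    constructor
    · rintro ⟨_, u', _, h1, rfl, rfl⟩
      obtain ⟨rfl, h2⟩ := run_zeroStep_iff.1 h1
      exact ⟨by simp, h2⟩
    · rintro ⟨rfl, h⟩
      exact ⟨(), a'.2, none, run_zeroStep_iff.2 ⟨rfl, h⟩, rfl, by simp⟩
  refine Impl.regSem (impl_pass (δ := zeroStep j) (fin := fun _ o => o = none) (q₀ := ()) ?_) ?_ ?_
  · rintro w a u' q x - - h
    cases h
  · intro w a a' _ h
    obtain ⟨rfl, h⟩ := (key _ _).1 h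
    exact ⟨_, ⟨h, rfl⟩, by simp⟩
  · rintro w a _ _ ⟨v, ⟨h, rfl⟩, rfl⟩
    exact ⟨a, by simp, (key _ _).2 ⟨rfl, h⟩⟩

/-- An instruction that concerns the input head only. -/
theorem impl_input {V : List Bool → (Option κ → ℕ) → Prop} (S : Set TapeSym) (d : Dir) :
    Impl (regSem κ) V fun w => locRel none (hRel w S d) := by
  refine Impl.act (S, (fun y y' => y' = y), d, .stay) ?_ ?_
  · rintro w _ _ c' ⟨a, ⟨rfl, h1, h2, h3⟩, rfl⟩ - ⟨h4, _, rfl, h5, h6, h7, h8⟩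
    have h8 : c'.2.1 = 0 := h8
    rw [Function.update_eq_self] at h5
    have h5 : c'.2.2 = tapeOf a.2 := h5
    refine ⟨regs (c'.1, a.2), ⟨(c'.1, a.2), ⟨?_, h7, h2, h3⟩, rfl⟩, c'.1, ⟨h4, h6, h7⟩, ?_⟩
    · change c' = (c'.1, 0, tapeOf a.2)
      rw [← h8, ← h5]
    · funext o
      cases o <;> simp [regs]
  · rintro w _ _ _ ⟨a, ⟨rfl, h1, h2, h3⟩, rfl⟩ - ⟨v, ⟨h4, h5, h6⟩, rfl⟩
    refine ⟨(v, 0, tapeOf a.2), ⟨(v, a.2), ⟨rfl, h6, h2, h3⟩, ?_⟩, h4, _, rfl, ?_, h5, h6, rfl⟩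
    · funext o
      cases o <;> simp [regs]
    · exact (Function.update_eq_self _ _).symm

theorem impl_reg_inc (b : Option κ) : Impl (regSem κ) (fun w p => p b ≤ w.length) fun w =>
    locRel b fun u v => v = u + 1 ∧ v ≤ w.length + 1 := by
  rcases b with _ | j
  · exact (impl_input univ .right).congr (fun _ _ h => h) fun w p _ p' =>
      exists_congr fun v => and_congr_left fun _ => by simp [hRel, Dir.Moves]
  · exact impl_inc j

theorem impl_reg_dec (b : Option κ) : Impl (regSem κ) (fun w p => p b ≤ w.length + 1) fun _ =>
    locRel b fun u v => u = v + 1 := by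
  rcases b with _ | j
  · refine (impl_input univ .left).congr (fun _ _ h => h) fun w p (hp : p none ≤ _) p' =>
      exists_congr fun v => and_congr_left fun _ => ?_
    simp only [hRel, Dir.Moves, mem_univ, true_and]
    omega
  · exact impl_dec j

theorem impl_reg_zero (b : Option κ) : Impl (regSem κ) (fun w p => p b ≤ w.length + 1) fun _ =>
    locRel b fun u v => u = 0 ∧ v = u := by
  rcases b with _ | j
  · refine (impl_input {.left} .stay).congr (fun _ _ h => h) fun w p (hp : p none ≤ _) p' =>
      exists_congr fun v => and_congr_left fun _ => ?_
    simp only [hRel, Dir.Moves, mem_singleton_iff, tapeAt_eq_left]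
    omega
  · exact impl_zero j

/-- A unit is taken from one register before it is added to the other. A sum of at most |w| + 1
therefore leaves room for every addition, and the transfer cannot fail. -/
theorem impl_reg_transfer {a b : Option κ} (hab : a ≠ b) :
    Impl (regSem κ) (fun w p => p a + p b ≤ w.length + 1) fun _ p p' =>
      p' = Function.update (Function.update p a 0) b (p b + p a) := by
  refine (impl_transfer (V' := fun w p => p a + p b ≤ w.length) (a := 1) (c := 1) hab
    ((impl_reg_dec a).mono fun w p hp => by omega) ?_ ((impl_reg_inc b).mono fun w p hp => by omega)
    ?_ ((impl_reg_zero a).mono fun w p hp => by omega) fun w p hp => by omega).congr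
    (fun _ _ h => h) fun w p hp p' => ⟨?_, ?_⟩
  · rintro w p _ hp ⟨v, h, rfl⟩
    rw [Function.update_self, Function.update_of_ne hab.symm]
    omega
  · rintro w p _ hp ⟨v, h, rfl⟩
    rw [Function.update_self, Function.update_of_ne hab]
    omega
  · rintro ⟨m, h1, h2, rfl⟩
    rw [h1]
  · rintro rfl
    exact ⟨p a, by omega, by omega, by rw [mul_one]⟩

/-- The simulation of an instruction that concerns the head `j`, by means of the input head. -/
theorem impl_head (j : κ) (S : Set TapeSym) (d : Dir) :
    Impl (regSem κ) (fun w p => p none = 0 ∧ ∀ i, p i ≤ w.length + 1) fun w =>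
      locRel (some j) (hRel w S d) := by
  -- The input head rests on the left end marker between instructions. It takes over the value of
  -- the counter, which puts it on the cell that the simulated head scans; it executes the
  -- instruction there and hands the new value back.
  have h1 := (impl_reg_transfer (κ := κ) (a := some j) (b := none) (by simp)).mono
    (V' := fun w p => p none = 0 ∧ ∀ i, p i ≤ w.length + 1)
    fun w p hp => by rw [hp.1]; exact hp.2 (some j)
  have h2 := impl_input (κ := κ) (V := fun w p => p (some j) = 0 ∧ p none ≤ w.length + 1) S d
  have h3 := (impl_reg_transfer (κ := κ) (a := none) (b := some j) (by simp)).mono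
    (V' := fun w p => p (some j) = 0 ∧ p none ≤ w.length + 1)
    fun w p hp => by rw [hp.1]; exact hp.2
  refine ((h1.seq ?_ h2).seq ?_ h3).congr (fun _ _ h => h) fun w p hp p' => ⟨?_, ?_⟩
  · rintro w p _ hp rfl
    refine ⟨by simp, ?_⟩
    have := hp.2 (some j)
    simp [hp.1, this]
  · rintro w p _ hp ⟨_, rfl, v, hv, rfl⟩
    exact ⟨by simp, by simpa using hv.2.2⟩
  · rintro ⟨_, ⟨_, rfl, v, hv, rfl⟩, rfl⟩
    refine ⟨v, by simpa [hp.1] using hv, funext fun o => ?_⟩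
    rcases o with _ | i
    · simp [hp.1]
    · by_cases hi : i = j
      · subst hi; simp
      · simp [hi]
  · rintro ⟨v, hv, rfl⟩
    refine ⟨_, ⟨_, rfl, v, by simpa [hp.1] using hv, rfl⟩, funext fun o => ?_⟩
    rcases o with _ | i
    · simp [hp.1]
    · by_cases hi : i = j
      · subst hi; simp
      · simp [hi]

end Counters

/-! ### Turing machines from tape programs -/

/-- The Turing machine that writes the symbol `m` and continues with the program `P`. -/
def Prog.toNTM {Γ : Type} [Finite Γ] (P : Prog (TLab Γ)) (z m : Γ) : NTM where
  State := Option P.State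
  finite_state := by
    have := P.finite_state
    infer_instance
  Work := Γ
  finite_work := inferInstance
  blank := z
  start := none
  accept := {some P.final}
  trans
    | none, _, _ => {(some P.start, m, .stay, .stay)}
    | some q, s, x => {t | ∃ q', t.1 = some q' ∧ (P.trans q none q' ∧ t.2 = (x, .stay, .stay) ∨
        ∃ l, P.trans q (some l) q' ∧ s ∈ l.1 ∧ l.2.1 x t.2.1 ∧ t.2.2 = l.2.2)}

section

variable {Γ : Type} [Finite Γ] {P : Prog (TLab Γ)} {z m : Γ} {w : List Bool}

theorem Prog.step_toNTM {q : P.State} {c : TConf Γ} (hc : c.1 ≤ w.length + 1)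
    {x : (P.toNTM z m).Config} :
    (P.toNTM z m).Step w ⟨some q, c.1, c.2.1, c.2.2⟩ x ↔
      ∃ q', x.state = some q' ∧ P.Step (tAct w) (q, c) (q', x.inPos, x.workPos, x.work) := by
  constructor
  · rintro ⟨a, d, e, ⟨q', h1, h⟩, h2, h3, h4, h5⟩
    refine ⟨q', h1, ?_⟩
    rcases h with ⟨h, h'⟩ | ⟨l, h, h6, h7, h8⟩
    · obtain rfl : a = c.2.2 c.2.1 := congrArg Prod.fst h'
      obtain rfl : d = .stay := congrArg (fun t => t.2.1) h'
      obtain rfl : e = .stay := congrArg (fun t => t.2.2) h'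
      refine ⟨none, h, ?_⟩
      have h2 : x.work = Function.update c.2.2 c.2.1 (c.2.2 c.2.1) := h2
      rw [Function.update_eq_self] at h2
      have h3 : x.inPos = c.1 := h3
      have h5 : x.workPos = c.2.1 := h5
      change c = (x.inPos, x.workPos, x.work)
      rw [h2, h3, h5]
      rfl
    · have h8 : (d, e) = l.2.2 := h8
      refine ⟨some l, h, h6, a, h7, h2, ?_, h4, ?_⟩
      · rw [← h8]; exact h3
      · rw [← h8]; exact h5
  · rintro ⟨q', h1, _ | l, h, h'⟩
    · have h' : c = (x.inPos, x.workPos, x.work) := h'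
      subst h'
      refine ⟨x.work x.workPos, .stay, .stay, ⟨q', h1, .inl ⟨h, rfl⟩⟩, ?_, rfl, hc, rfl⟩
      exact (Function.update_eq_self _ _).symm
    · obtain ⟨h2, a, h3, h4, h5, h6, h7⟩ := h'
      exact ⟨a, l.2.2.1, l.2.2.2, ⟨q', h1, .inr ⟨l, h, h2, h3, rfl⟩⟩, h4, h5, h6, h7⟩

theorem Prog.reach_toNTM {x : (P.toNTM z m).Config} :
    Relation.ReflTransGen ((P.toNTM z m).Step w) (P.toNTM z m).init x ↔ x = (P.toNTM z m).init ∨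
      ∃ q, x.state = some q ∧ x.inPos ≤ w.length + 1 ∧ P.Reach (tAct w)
        (P.start, 0, 0, Function.update (fun _ => z) 0 m) (q, x.inPos, x.workPos, x.work) := by
  constructor
  · intro h
    induction h with
    | refl => exact .inl rfl
    | @tail x y _ h ih =>
      right
      rcases ih with rfl | ⟨q, h1, h2, h3⟩
      · obtain ⟨a, d, e, h1, h2, h3, h4, h5⟩ := h
        have h1 : (y.state, a, d, e) = (some P.start, m, .stay, .stay) := h1
        have ha : a = m := congrArg (fun t => t.2.1) h1
        obtain rfl : d = .stay := congrArg (fun t => t.2.2.1) h1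
        obtain rfl : e = .stay := congrArg (fun t => t.2.2.2) h1
        refine ⟨P.start, congrArg Prod.fst h1, h4, ?_⟩
        have h3 : y.inPos = 0 := h3
        have h5 : y.workPos = 0 := h5
        have h2 : y.work = Function.update (fun _ => z) 0 a := h2
        rw [h2, h3, h5, ha]
        exact .refl
      · obtain ⟨s, i, p, t⟩ := x
        obtain rfl : s = some q := h1
        obtain ⟨q', h4, h5⟩ := (Prog.step_toNTM (P := P) (z := z) (m := m) (c := (i, p, t)) h2).1 h
        obtain ⟨a, d, e, -, -, -, h6, -⟩ := h
        exact ⟨q', h4, h6, h3.tail h5⟩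
  · rintro (rfl | ⟨q, h1, h2, h3⟩)
    · exact .refl
    · suffices ∀ y : P.State × TConf Γ, P.Reach (tAct w)
          (P.start, 0, 0, Function.update (fun _ => z) 0 m) y → y.2.1 ≤ w.length + 1 ∧
          Relation.ReflTransGen ((P.toNTM z m).Step w) (P.toNTM z m).init
            ⟨some y.1, y.2.1, y.2.2.1, y.2.2.2⟩ by
        have := (this _ h3).2
        rwa [← h1] at this
      intro y hy
      induction hy with
      | refl => exact ⟨Nat.zero_le _, .single ⟨m, .stay, .stay, rfl, rfl, rfl, Nat.zero_le _, rfl⟩⟩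
      | @tail y y' _ h ih =>
        have := (Prog.step_toNTM (z := z) (m := m) (c := y.2) ih.1
          (x := ⟨some y'.1, y'.2.1, y'.2.2.1, y'.2.2.2⟩)).2 ⟨y'.1, rfl, h⟩
        refine ⟨?_, ih.2.tail this⟩
        obtain ⟨a, d, e, -, -, -, h6, -⟩ := this
        exact h6

end

/-- Each head is a binary counter on its own track of the work tape, of about log n digits. Tests of
symbols go through the real input head, and the safety clause of `Prog.Implements` yields the space
bound for all computations, accepting or not. -/
theorem twoNFA_top_subset_nLogspace : twoNFA ⊤ ⊆ nLogspace := by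
  rintro _ ⟨k, -, M, rfl⟩
  obtain ⟨M', hM'⟩ := M.exists_prog le_rfl
  have := M'.finite_state
  let E := {t : M'.State × Option (HLab (Fin k)) × M'.State // M'.trans t.1 t.2.1 t.2.2}
  let R : E → List Bool → (Option (Fin k) → ℕ) → (Option (Fin k) → ℕ) → Prop := fun e w =>
    e.1.2.1.elim Eq fun l => locRel (some l.1) (hRel w l.2.1 l.2.2)
  have hR : ∀ e, Impl (regSem (Fin k)) (fun w p => p none = 0 ∧ ∀ i, p i ≤ w.length + 1) (R e) := by
    rintro ⟨⟨q, _ | ⟨j, S, d⟩, q'⟩, h⟩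
    · exact Impl.skip
    · exact impl_head j S d
  obtain ⟨P, hP⟩ := Impl.graph (src := fun e : E => e.1.1) (dst := fun e : E => e.1.2.2)
    (V := fun _ (w : List Bool) (p : Option (Fin k) → ℕ) => p none = 0 ∧ ∀ i, p i ≤ w.length + 1)
    (R := R) hR (by
      rintro ⟨⟨q, _ | ⟨j, S, d⟩, q'⟩, h⟩ w p p' hp hr
      · exact (show p = p' from hr) ▸ hp
      · obtain ⟨v, hv, rfl⟩ := hr
        refine ⟨by simpa using hp.1, fun i => ?_⟩
        by_cases hi : i = some j
        · subst hi; simpa using hv.2.2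
        · simpa [hi] using hp.2 i) M'.start M'.final
  let lift : (Fin k → ℕ) → Option (Fin k) → ℕ := fun p o => o.elim 0 p
  have hlift : ∀ p j v, Function.update (lift p) (some j) v = lift (Function.update p j v) := by
    intro p j v
    funext o
    rcases o with _ | i
    · simp [lift]
    · by_cases hi : i = j
      · subst hi; simp [lift]
      · simp [lift, hi]
  have hlang : ∀ w, (∃ p, Relation.ReflTransGen (GStep (fun e : E => e.1.1) (fun e : E => e.1.2.2)
      fun e => R e w) (M'.start, lift fun _ => 0) (M'.final, p)) ↔ w ∈ M.language := by
    intro w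
    refine Iff.trans ?_ ((hM' w fun _ => 0).trans (and_iff_right rfl))
    constructor
    · rintro ⟨p, hp⟩
      suffices ∀ y, Relation.ReflTransGen (GStep (fun e : E => e.1.1) (fun e : E => e.1.2.2)
          fun e => R e w) (M'.start, lift fun _ => 0) y → ∃ p, y.2 = lift p ∧
          M'.Reach (hAct w) (M'.start, fun _ => 0) (y.1, p) by
        obtain ⟨p', -, h⟩ := this _ hp
        exact ⟨p', h⟩
      intro y hy
      induction hy with
      | refl => exact ⟨_, rfl, .refl⟩
      | @tail x y _ h ih =>
        obtain ⟨p, h1, h2⟩ := ih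
        obtain ⟨q, p₁⟩ := x
        obtain ⟨q', p₂⟩ := y
        obtain rfl : p₁ = lift p := h1
        obtain ⟨⟨⟨_, _ | ⟨j, S, d⟩, _⟩, h⟩, rfl, rfl, h3⟩ := h
        · exact ⟨p, (show lift p = p₂ from h3).symm, h2.tail ⟨none, h, rfl⟩⟩
        · obtain ⟨v, hv, rfl⟩ := h3
          exact ⟨Function.update p j v, hlift p j v, h2.tail ⟨some (j, S, d), h, v, hv, rfl⟩⟩
    · rintro ⟨p, hp⟩
      refine ⟨lift p, ?_⟩
      suffices ∀ y, M'.Reach (hAct w) (M'.start, fun _ => 0) y →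
          Relation.ReflTransGen (GStep (fun e : E => e.1.1) (fun e : E => e.1.2.2)
            fun e => R e w) (M'.start, lift fun _ => 0) (y.1, lift y.2) from this _ hp
      intro y hy
      induction hy with
      | refl => exact .refl
      | @tail x y _ h ih =>
        obtain ⟨q, p⟩ := x
        obtain ⟨q', p'⟩ := y
        obtain ⟨_ | ⟨j, S, d⟩, h, h'⟩ := h
        · obtain rfl : p = p' := h'
          exact ih.tail ⟨⟨(q, none, q'), h⟩, rfl, rfl, rfl⟩
        · obtain ⟨v, hv, rfl⟩ := h'
          exact ih.tail ⟨⟨(q, some (j, S, d), q'), h⟩, rfl, rfl, v, hv, (hlift p j v).symm⟩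
  have hrep : ∀ w, (regSem (Fin k) w).rep
      (0, 0, Function.update (fun _ : ℕ => none) 0 (some (true, fun _ => false)))
      (lift fun _ => 0) := by
    intro w
    -- The representation needs a non-empty list with a marked first cell; one cell with the digit 0
    -- on all tracks represents all heads at 0.
    refine ⟨(0, [fun _ => false]), ⟨?_, Nat.zero_le _, by simp, ?_⟩, ?_⟩
    · have : tapeOf [fun _ : Fin k => false] =
          Function.update (fun _ : ℕ => none) 0 (some (true, fun _ => false)) := by
        funext i
        rcases i with _ | i <;> simp [tapeOf]
      rw [this]
    · simp [spaceBound]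
    · funext o
      cases o <;> simp [lift, regs, trackVal]
  have hV : ∀ w : List Bool, lift (fun _ => 0) none = 0 ∧ ∀ i, lift (fun _ => 0) i ≤ w.length + 1 := by
    refine fun w => ⟨rfl, fun i => ?_⟩
    cases i <;> exact Nat.zero_le _
  -- The work head stays at or below log n + 2, which is less than 3 (log n + 1).
  refine ⟨P.toNTM none (some (true, fun _ => false)), ⟨3, fun w c hc => ?_⟩, ?_⟩
  · rcases Prog.reach_toNTM.1 hc with rfl | ⟨q, -, -, h⟩
    · exact Nat.mul_pos (by norm_num) (Nat.succ_pos _)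
    · have h : c.workPos ≤ Nat.log 2 w.length + 2 := hP.safe w _ _ (hrep w) (hV w) _ h
      omega
  · ext w
    rw [← hlang w]
    constructor
    · rintro ⟨p, hp⟩
      obtain ⟨c, h1, h2⟩ := hP.complete w _ _ (hrep w) (hV w) p hp
      obtain ⟨a, ⟨rfl, h3, -⟩, -⟩ := h1
      exact ⟨⟨some P.final, _, _, _⟩, Prog.reach_toNTM.2 (.inr ⟨P.final, rfl, h3, h2⟩), rfl⟩
    · rintro ⟨c, hc, hq⟩
      have hq : c.state = some P.final := hq
      rcases Prog.reach_toNTM.1 hc with rfl | ⟨q, h1, -, h⟩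
      · cases hq
      · obtain rfl : P.final = q := Option.some_injective _ (hq.symm.trans h1)
        obtain ⟨p, -, h2⟩ := hP.sound w _ _ (hrep w) (hV w) _ h
        exact ⟨p, h2⟩

theorem nLogspace_eq_twoNFA : nLogspace = twoNFA ⊤ :=
  nLogspace_subset_twoNFA.antisymm twoNFA_top_subset_nLogspace

theorem coNLogspace_eq_coTwoNFA : coNLogspace = coTwoNFA ⊤ := by
  simp only [coNLogspace, coTwoNFA, nLogspace_eq_twoNFA]

end IG

end

theorem theorem5 :
    (∀ i : ℕ∞, 1 ≤ i →
      IG.Characterises (IG.microcosm i) IG.testNL (IG.twoNFA i) ∧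
      IG.Characterises (IG.microcosm i) IG.testCoNL (IG.coTwoNFA i)) ∧
    (IG.Characterises (IG.microcosm 1) IG.testNL IG.regular ∧
      IG.Characterises (IG.microcosm 1) IG.testCoNL IG.regular) ∧
    (IG.Characterises (IG.microcosm ⊤) IG.testNL IG.nLogspace ∧
      IG.Characterises (IG.microcosm ⊤) IG.testCoNL IG.coNLogspace) := by
  have key := fun (i : ℕ∞) (hi : 1 ≤ i) =>
    And.intro (IG.characterises_testNL i hi) (IG.characterises_testCoNL i hi)
  refine ⟨key, ?_, ?_⟩
  · have := key 1 le_rfl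
    rwa [IG.twoNFA_one, IG.coTwoNFA_one] at this
  · rw [IG.nLogspace_eq_twoNFA, IG.coNLogspace_eq_coTwoNFA]
    exact key ⊤ le_top
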